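/- Let $D\subset\mathbb C^n$ ($n\ge 1$) be a bounded symmetric domain, i.e. a bounded domain on which the group $\mathrm{Aut}(D)$ of biholomorphic self-maps acts transitively and in which every point is an isolated fixed point of an involution in $\mathrm{Aut}(D)$. Let $\Gamma\subset \mathrm{Aut}(D)$ be a discrete subgroup that acts freely on $D$ and whose quotient $M=\Gamma\backslash D$ is compact, let $m\ge 1$, and let $\rho:\Gamma\to U(m)$ be a unitary representation. Write $J(\gamma,z)$ for the complex Jacobian determinant of $\gamma$ at $z$, $\mathcal K$ for the Bergman kernel of $D$, $dV_e$ for Lebesgue measure, $dV(w)=\mathcal K(w,w)\,dV_e(w)$, and $c(D,k)$ for the constant determined by $$c(D,k)\int_D \frac{\mathcal K(z,w)^k\,\mathcal K(w,z)^k}{\mathcal K(w,w)^{k}}\,dV(w)=\mathcal K(z,z)^k\qquad(z\in D).$$ Let $\mathcal A(\Gamma,m,k,\rho)$ be the space of holomorphic maps $F:D\to\mathbb C^m$ with $J(\gamma,z)^kF(\gamma z)=\rho(\gamma)F(z)$ for all $\gamma\in\Gamma$, $z\in D$. For $p\in D$ and $1\le j\le m$ put $$\Theta_p^{(j;k)}(z)=c(D,k)\sum_{\gamma\in\Gamma}J(\gamma,z)^k\,\mathcal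 K(\gamma z,p)^k\,\rho(\gamma^{-1})e_j,$$ where $e_1,\dots,e_m$ is the standard basis of $\mathbb C^m$. Call points $p_1,\dots,p_d\in D$ in general position (for weight $k$) if there are nonzero linear functionals $\varphi_1,\dots,\varphi_d$ on $\mathbb C^m$ such that the functionals $F\mapsto\varphi_l(F(p_l))$, $1\le l\le d$, do not all lie in one hyperplane of the dual space $\mathcal A(\Gamma,m,k,\rho)^*$. Then there is $k_0$ such that for every integer $k\ge k_0$: 1. the series defining $\Theta_p^{(j;k)}(z)$ converges absolutely for all $p,z\in D$ and $1\le j\le m$; 2. $\mathcal A(\Gamma,m,k,\rho)$ is finite-dimensional, and for every $d\ge\dim\mathcal A(\Gamma,m,k,\rho)$ generic $d$-tuples of points of $D$ are in general position: there is a holomorphic function on $D^d$, not identically zero, such that all $(p_1,\dots,p_d)\in D^d$ outside its zero set are in general position; 3. for every $d$ and all points $p_1,\dots,p_d\in D$ in general position, the $\mathbb C$-linear span of $\{\Theta_{p_l}^{(j;k)} : 1\le l\le d,\ 1\le j\le m\}$ is $\mathcal A(\Gamma,m,k,\rho)$. -/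

import Mathlib

open MeasureTheory Topology Filter

noncomputable section

namespace BoundedSymmetric

/-- The group of self-homeomorphisms of a space acts on the space. -/
instance homeomorphMulAction (X : Type*) [TopologicalSpace X] : MulAction (X ≃ₜ X) X where
  smul g x := g x
  one_smul _ := rfl
  mul_smul _ _ _ := rfl

/-- A function on an open set `D` of a complex normed space is holomorphic. The extension by zero
only serves to have a function on the whole space; its values outside `D` play no role. -/
def IsHolomorphic {V E : Type*} [NormedAddCommGroup V] [NormedSpace ℂ V]
    [NormedAddCommGroup E] [NormedSpace ℂ E] {D : Set V} (f : D → E) : Prop :=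
  DifferentiableOn ℂ (Function.extend Subtype.val f 0) D

theorem extend_val {V E : Type*} [Zero E] {D : Set V} (f : D → E) {z : V} (hz : z ∈ D) :
    Function.extend Subtype.val f 0 z = f ⟨z, hz⟩ :=
  Subtype.val_injective.extend_apply f 0 ⟨z, hz⟩

variable {n : ℕ}

/-- The group `Aut(D)` of biholomorphic self-maps of `D ⊆ ℂⁿ`. -/
def Aut (D : Set (Fin n → ℂ)) : Subgroup (D ≃ₜ D) where
  carrier := {g | IsHolomorphic (fun z : D => (g z : Fin n → ℂ)) ∧
    IsHolomorphic (fun z : D => (g⁻¹ z : Fin n → ℂ))}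
  one_mem' := by
    have h : IsHolomorphic (fun z : D => (z : Fin n → ℂ)) :=
      differentiableOn_id.congr fun z hz => extend_val _ hz
    exact ⟨h, h⟩
  mul_mem' := by
    have key : ∀ a b : D ≃ₜ D, IsHolomorphic (fun z : D => (a z : Fin n → ℂ)) →
        IsHolomorphic (fun z : D => (b z : Fin n → ℂ)) →
        IsHolomorphic (fun z : D => ((a * b) z : Fin n → ℂ)) := by
      intro a b ha hb
      have hmaps : Set.MapsTo
          (Function.extend Subtype.val (fun z : D => (b z : Fin n → ℂ)) 0) D D := by
        intro z hz
        rw [extend_val _ hz]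
        exact (b ⟨z, hz⟩).2
      refine (DifferentiableOn.comp ha hb hmaps).congr fun z hz => ?_
      rw [extend_val _ hz, Function.comp_apply, extend_val _ (hmaps hz)]
      have e : (⟨_, hmaps hz⟩ : D) = b ⟨z, hz⟩ :=
        Subtype.ext (extend_val (fun z : D => (b z : Fin n → ℂ)) hz)
      rw [e]
      rfl
    intro a b ha hb
    refine ⟨key a b ha.1 hb.1, ?_⟩
    rw [mul_inv_rev]
    exact key _ _ hb.2 ha.2
  inv_mem' := by
    intro a ha
    refine ⟨ha.2, ?_⟩
    rw [inv_inv]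
    exact ha.1

/-- Bounded symmetric domains `D = G/K` with `G = Aut(D)`: bounded domains in `ℂⁿ` on which
`Aut(D)` acts transitively and each of whose points is an isolated fixed point of an involutive
automorphism. -/
structure IsBoundedSymmetricDomain (D : Set (Fin n → ℂ)) : Prop where
  isOpen : IsOpen D
  isConnected : IsConnected D
  isBounded : Bornology.IsBounded D
  transitive : ∀ p q : D, ∃ g ∈ Aut D, g p = q
  symmetric : ∀ p : D, ∃ s ∈ Aut D, s * s = 1 ∧ s p = p ∧ ∀ᶠ z in 𝓝[≠] p, s z ≠ z

/-- `Γ` is a discrete subgroup of `Aut(D)` (with the compact-open topology) such that `Γ \ D` is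
smooth (`Γ` acts without fixed points) and compact. -/
structure IsCocompactSmooth {D : Set (Fin n → ℂ)} (Γ : Subgroup (D ≃ₜ D)) : Prop where
  le_aut : Γ ≤ Aut D
  discrete : IsDiscrete ((fun g : D ≃ₜ D => (g : C(D, D))) '' (Γ : Set (D ≃ₜ D)))
  free : ∀ g ∈ Γ, ∀ z : D, g z = z → g = 1
  compact : CompactSpace (MulAction.orbitRel.Quotient Γ D)

/-- The complex Jacobian determinant `J(g, z)`. -/
def jac {D : Set (Fin n → ℂ)} (g : D ≃ₜ D) (z : D) : ℂ :=
  (fderiv ℂ (Function.extend Subtype.val (fun w : D => (g w : Fin n → ℂ)) 0) z).det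

/-- Lebesgue measure `dV_e` of `ℂⁿ = ℝ²ⁿ`, restricted to `D`. -/
def euclideanVolume (D : Set (Fin n → ℂ)) : Measure D := Measure.comap Subtype.val volume

/-- `K` is the reproducing kernel of the space of square integrable holomorphic functions on `D`. -/
structure IsBergmanKernel (D : Set (Fin n → ℂ)) (K : D → D → ℂ) : Prop where
  holomorphic : ∀ w, IsHolomorphic fun z => K z w
  memLp : ∀ w, MemLp (fun z => K z w) 2 (euclideanVolume D)
  hermitian : ∀ z w, K z w = starRingEnd ℂ (K w z)
  reproducing : ∀ f : D → ℂ, IsHolomorphic f → MemLp f 2 (euclideanVolume D) →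
    ∀ z, f z = ∫ w : D, f w * K z w ∂(euclideanVolume D)

open Classical in
/-- The Bergman kernel of `D`: the unique function with the property above. -/
def bergmanKernel (D : Set (Fin n → ℂ)) : D → D → ℂ :=
  if h : ∃ K, IsBergmanKernel D K then h.choose else 0

/-- The equation that determines the constant `c(D, k)`; the invariant volume `dV(w)` is
`K(w, w)` times Lebesgue measure. -/
def IsWeightConst (D : Set (Fin n → ℂ)) (k : ℕ) (c : ℂ) : Prop :=
  ∀ z : D, c * ∫ w : D, bergmanKernel D z w ^ k * bergmanKernel D w z ^ k /
    bergmanKernel D w w ^ k * bergmanKernel D w w ∂(euclideanVolume D) =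
      bergmanKernel D z z ^ k

open Classical in
/-- The constant `c(D, k)` for which `c(D, k) K(z, w) ^ k` is the reproducing kernel of the
weighted Bergman space with weight `K(z, z) ^ (-k) dV(z)`. -/
def weightConst (D : Set (Fin n → ℂ)) (k : ℕ) : ℂ :=
  if h : ∃ c, IsWeightConst D k c then h.choose else 0

variable {D : Set (Fin n → ℂ)} {m : ℕ}

/-- The space `A(Γ, m, k, ρ)` of `ℂᵐ`-valued holomorphic automorphic forms of weight `k`. -/
def automorphicForms (Γ : Subgroup (D ≃ₜ D)) (ρ : Γ →* Matrix.unitaryGroup (Fin m) ℂ) (k : ℕ) :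
    Submodule ℂ (D → Fin m → ℂ) where
  carrier := {F | IsHolomorphic F ∧ ∀ (γ : Γ) (z : D),
    jac γ.1 z ^ k • F (γ.1 z) = (ρ γ : Matrix (Fin m) (Fin m) ℂ).mulVec (F z)}
  zero_mem' := by
    refine ⟨(differentiableOn_const (0 : Fin m → ℂ)).congr fun z hz => extend_val _ hz, ?_⟩
    intro γ z
    simp
  add_mem' := by
    rintro F G ⟨hF, hF'⟩ ⟨hG, hG'⟩
    refine ⟨(DifferentiableOn.add hF hG).congr fun z hz => ?_, fun γ z => ?_⟩
    · simp [extend_val _ hz]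
    · simp only [Pi.add_apply, smul_add, Matrix.mulVec_add, hF', hG']
  smul_mem' := by
    rintro c F ⟨hF, hF'⟩
    refine ⟨(DifferentiableOn.const_smul hF c).congr fun z hz => ?_, fun γ z => ?_⟩
    · simp [extend_val _ hz]
    · rw [Pi.smul_apply, Pi.smul_apply, smul_comm, hF', Matrix.mulVec_smul]

/-- The term of index `γ` of the Poincaré series: `ρ(γ⁻¹) T_p(γ z) J(γ, z) ^ k`, where `T_p` has
`j`-th component `K(·, p) ^ k` and all other components zero. -/
def poincareTerm (Γ : Subgroup (D ≃ₜ D)) (ρ : Γ →* Matrix.unitaryGroup (Fin m) ℂ) (k : ℕ)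
    (j : Fin m) (p z : D) (γ : Γ) : Fin m → ℂ :=
  jac γ.1 z ^ k • (ρ γ⁻¹ : Matrix (Fin m) (Fin m) ℂ).mulVec
    (Pi.single j (bergmanKernel D (γ.1 z) p ^ k))

/-- The vector-valued Poincaré series `Θ_p^{(j;k)}`. -/
def poincareSeries (Γ : Subgroup (D ≃ₜ D)) (ρ : Γ →* Matrix.unitaryGroup (Fin m) ℂ) (k : ℕ)
    (j : Fin m) (p : D) : D → Fin m → ℂ :=
  fun z => weightConst D k • ∑' γ : Γ, poincareTerm Γ ρ k j p z γ

/-- The linear functional `F ↦ φ(F(p))` on automorphic forms. Up to a scalar it is the image of the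
point `(p, [φ])` of the projectivized dual bundle of `W = E_ρ ⊗ K_M^k` under the map into the
projective space of the dual of `H⁰(M, W)` given by the dual of the tautological line bundle. -/
def evalFunctional (Γ : Subgroup (D ≃ₜ D)) (ρ : Γ →* Matrix.unitaryGroup (Fin m) ℂ) (k : ℕ)
    (p : D) (φ : Module.Dual ℂ (Fin m → ℂ)) : Module.Dual ℂ (automorphicForms Γ ρ k) :=
  φ ∘ₗ LinearMap.proj p ∘ₗ (automorphicForms Γ ρ k).subtype

/-- The points `p₁, …, p_d` are in general position: there are points `(p_l, [φ_l])` of the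
projectivized dual bundle over them whose images in the projective space of the dual of the space
of automorphic forms do not lie on a common hyperplane. -/
def InGeneralPosition (Γ : Subgroup (D ≃ₜ D)) (ρ : Γ →* Matrix.unitaryGroup (Fin m) ℂ) (k : ℕ)
    {d : ℕ} (p : Fin d → D) : Prop :=
  ∃ φ : Fin d → Module.Dual ℂ (Fin m → ℂ), (∀ l, φ l ≠ 0) ∧
    ¬ ∃ S : Submodule ℂ (Module.Dual ℂ (automorphicForms Γ ρ k)),
      IsCoatom S ∧ ∀ l, evalFunctional Γ ρ k (p l) (φ l) ∈ S

/-- A property of `d`-tuples of points of a domain `D` holds generically: it holds outside the zero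
locus of a holomorphic function on `D × ⋯ × D` that is not identically zero. -/
def HoldsGenerically {d : ℕ} (P : (Fin d → D) → Prop) : Prop :=
  ∃ Φ : (Fin d → Fin n → ℂ) → ℂ, DifferentiableOn ℂ Φ {p | ∀ l, p l ∈ D} ∧
    (∃ p : Fin d → D, Φ (fun l => p l) ≠ 0) ∧
    ∀ p : Fin d → D, Φ (fun l => p l) ≠ 0 → P p

end BoundedSymmetric

end

/-!
By transitivity and polarization, `c(D, k) K(z, w) ^ k` is the reproducing kernel of the holomorphic
functions that are square integrable for the weight `K(w, w) ^ (-k) dV(w)`. It also reproduces a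
holomorphic `f` with `|f(w)| ≤ C K(w, w) ^ (k / 2)`, although such an `f` need not be square
integrable: `f K(·, z) ^ l` is square integrable in weight `k + l`, and if `f(z) = 0`, reproducing
these products for all `l ≥ 1` shows that `f K(z, ·) ^ k` is orthogonal to the positive powers of
`|K(z, w)| ^ 2 / (K(z, z) K(w, w))`, which forces its integral to vanish.

The mean value inequality on a ball that meets only finitely many of its translates bounds the sum
of `|J(γ, z) K(γ z, p)| ^ 2` by the square norm of `K(·, p)`, so the Poincaré series converge for
`k ≥ 2`. An automorphic form `F` grows at most like `K(w, w) ^ (k / 2)` because the orbit space is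
compact, and unfolding the Petersson pairing of `F` with `Θ_p^{(j;k)}` gives the integral of `F_j`
against `c(D, k) K(p, w) ^ k`, which is `F_j(p)`. A form orthogonal to all `Θ_{p_l}^{(j;k)}`
therefore vanishes at every `p_l`; when the points are in general position it is zero, so these
series span. Finite dimensionality holds because the values of `F` on a compact set of
representatives are bounded by its `L²` norm there, which limits the number of orthonormal forms,
and genericity because evaluation functionals at `d` points fail to span only where a holomorphic
determinant vanishes.
-/

noncomputable section

namespace BoundedSymmetric

section Bounds

variable {V E : Type*} [NormedAddCommGroup V] [NormedAddCommGroup E]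

theorem mapsTo_closedBall_of_norm_le {f : V → E} {c : V} {R M : ℝ} (hR : 0 < R)
    (hM : ∀ z ∈ Metric.ball c R, ‖f z‖ ≤ M) :
    Set.MapsTo f (Metric.ball c R) (Metric.closedBall (f c) (2 * M)) := fun w hw => by
  rw [Metric.mem_closedBall, dist_eq_norm]
  linarith [norm_sub_le (f w) (f c), hM w hw, hM c (Metric.mem_ball_self hR)]

theorem exists_ball_norm_le {U : Set V} (hU : IsOpen U) {f : V → E} (hf : ContinuousOn f U)
    {z₀ : V} (hz₀ : z₀ ∈ U) :
    ∃ r > 0, ∃ M, Metric.ball z₀ r ⊆ U ∧ ∀ z ∈ Metric.ball z₀ r, ‖f z‖ ≤ M := by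
  have hbound : ∀ᶠ z in 𝓝 z₀, z ∈ U ∧ ‖f z‖ < ‖f z₀‖ + 1 :=
    (hU.eventually_mem hz₀).and ((hf.continuousAt (hU.mem_nhds hz₀)).norm.eventually_lt_const
      (lt_add_one _))
  obtain ⟨r, hr, h⟩ := Metric.eventually_nhds_iff_ball.1 hbound
  exact ⟨r, hr, _, fun z hz => (h z hz).1, fun z hz => (h z hz).2.le⟩

end Bounds

section SeveralVariables

variable {V W E : Type*} [NormedAddCommGroup V] [NormedSpace ℂ V] [NormedAddCommGroup W]
  [NormedSpace ℂ W] [NormedAddCommGroup E] [NormedSpace ℂ E]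

theorem norm_sub_le_of_norm_le_ball {f : V → E} {c z : V} {R M : ℝ}
    (hd : DifferentiableOn ℂ f (Metric.ball c R)) (hM : ∀ z ∈ Metric.ball c R, ‖f z‖ ≤ M)
    (hz : z ∈ Metric.ball c R) : ‖f z - f c‖ ≤ 2 * M / R * ‖z - c‖ := by
  rw [← dist_eq_norm, ← dist_eq_norm]
  exact Complex.dist_le_div_mul_dist_of_mapsTo_ball hd
    (mapsTo_closedBall_of_norm_le (Metric.pos_of_mem_ball hz) hM) hz

theorem norm_fderiv_le_of_norm_le_ball {f : V → E} {c : V} {R M : ℝ} (hR : 0 < R)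
    (hd : DifferentiableOn ℂ f (Metric.ball c R)) (hM : ∀ z ∈ Metric.ball c R, ‖f z‖ ≤ M) :
    ‖fderiv ℂ f c‖ ≤ 2 * M / R :=
  Complex.norm_fderiv_le_div_of_mapsTo_ball hd (mapsTo_closedBall_of_norm_le hR hM) hR

theorem norm_sub_sub_fderiv_le_of_norm_le_ball {f : V → E} {c z : V} {R M : ℝ}
    (hd : DifferentiableOn ℂ f (Metric.ball c R)) (hM : ∀ z ∈ Metric.ball c R, ‖f z‖ ≤ M)
    (hz : z ∈ Metric.ball c R) :
    ‖f z - f c - fderiv ℂ f c (z - c)‖ ≤ 4 * M * (‖z - c‖ / R) ^ 2 := by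
  have hR : 0 < R := Metric.pos_of_mem_ball hz
  set g : V → E := fun w => f w - fderiv ℂ f c (w - c) with hg
  have hgc : ∀ w, g w - g c = f w - f c - fderiv ℂ f c (w - c) := fun w => by
    simp only [hg, sub_self, map_zero, sub_zero]
    abel
  have hmaps : Set.MapsTo g (Metric.ball c R) (Metric.closedBall (g c) (4 * M)) := by
    intro w hw
    rw [Metric.mem_closedBall, dist_eq_norm, hgc]
    have hfw : ‖f w - f c‖ ≤ 2 * M := by
      simpa [dist_eq_norm] using mapsTo_closedBall_of_norm_le hR hM hw
    have hlin : ‖fderiv ℂ f c (w - c)‖ ≤ 2 * M / R * R :=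
      ContinuousLinearMap.le_of_opNorm_le_of_le _ (norm_fderiv_le_of_norm_le_ball hR hd hM)
        (mem_ball_iff_norm.1 hw).le
    rw [div_mul_cancel₀ _ hR.ne'] at hlin
    linarith [norm_sub_le (f w - f c) (fderiv ℂ f c (w - c))]
  have hlittle : (fun w => g w - g c) =o[𝓝 c] fun w => ‖w - c‖ ^ 1 := by
    simp only [hgc, pow_one]
    exact ((hd.differentiableAt (Metric.ball_mem_nhds c hR)).hasFDerivAt.isLittleO).norm_right
  have hgd : DifferentiableOn ℂ g (Metric.ball c R) := hd.sub (by fun_prop)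
  rw [← hgc, ← dist_eq_norm, ← dist_eq_norm]
  exact Complex.dist_le_mul_div_pow_of_mapsTo_ball_of_isLittleO hgd hmaps hlittle hz

theorem uniformCauchySeqOn_fderiv {ι : Type*} {l : Filter ι} {S U : Set V} {r : ℝ} (hr : 0 < r)
    (hSU : ∀ z ∈ S, Metric.ball z r ⊆ U) {F : ι → V → E} (hF : ∀ i, DifferentiableOn ℂ (F i) U)
    (h : UniformCauchySeqOn F l U) : UniformCauchySeqOn (fun i => fderiv ℂ (F i)) l S := by
  intro u hu
  obtain ⟨ε, hε, hεu⟩ := Metric.mem_uniformity_dist.1 hu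
  filter_upwards [h _ (Metric.dist_mem_uniformity (by positivity : 0 < ε * r / 4))] with p hp z hz
  apply hεu
  have hd : ∀ i, DifferentiableAt ℂ (F i) z := fun i =>
    ((hF i).mono (hSU z hz)).differentiableAt (Metric.ball_mem_nhds z hr)
  rw [dist_eq_norm, ← fderiv_sub (hd _) (hd _)]
  calc ‖fderiv ℂ (F p.1 - F p.2) z‖ ≤ 2 * (ε * r / 4) / r :=
        norm_fderiv_le_of_norm_le_ball hr (((hF p.1).sub (hF p.2)).mono (hSU z hz)) fun w hw => by
          simpa [dist_eq_norm] using (hp w (hSU z hz hw)).le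
    _ < ε := by field_simp; linarith

theorem differentiableOn_of_tendstoUniformlyOn [CompleteSpace E] {ι : Type*} {l : Filter ι}
    [l.NeBot] {U : Set V} (hU : IsOpen U) {F : ι → V → E} {f : V → E}
    (hF : ∀ i, DifferentiableOn ℂ (F i) U) (h : TendstoUniformlyOn F f l U) :
    DifferentiableOn ℂ f U := by
  intro z₀ hz₀
  obtain ⟨r, hr, hrU⟩ := Metric.isOpen_iff.1 hU z₀ hz₀
  have hsub : ∀ z ∈ Metric.ball z₀ (r / 2), Metric.ball z (r / 2) ⊆ U := fun z hz =>
    (Metric.ball_subset_ball' (by rw [Metric.mem_ball] at hz; linarith)).trans hrU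
  have hmem : ∀ z ∈ Metric.ball z₀ (r / 2), z ∈ U := fun z hz =>
    hsub z hz (Metric.mem_ball_self (half_pos hr))
  have hcauchy := uniformCauchySeqOn_fderiv (half_pos hr) hsub hF h.uniformCauchySeqOn
  have hlim : ∀ z ∈ Metric.ball z₀ (r / 2), ∃ L, Tendsto (fun i => fderiv ℂ (F i) z) l (𝓝 L) :=
    fun z hz => cauchy_map_iff_exists_tendsto.1 (hcauchy.cauchy_map hz)
  choose! f' hf' using hlim
  have hderiv := hasFDerivAt_of_tendstoUniformlyOn Metric.isOpen_ball
    (hcauchy.tendstoUniformlyOn_of_tendsto hf')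
    (fun i z hz => ((hF i).differentiableAt (hU.mem_nhds (hmem z hz))).hasFDerivAt)
    (fun z hz => h.tendsto_at (hmem z hz)) (Metric.mem_ball_self (half_pos hr))
  exact hderiv.differentiableAt.differentiableWithinAt

theorem norm_inv_smul_sub_sub_fderiv_le {f : V → E} {z v : V} {t : ℂ} {R M : ℝ}
    (hd : DifferentiableOn ℂ f (Metric.ball z R)) (hM : ∀ w ∈ Metric.ball z R, ‖f w‖ ≤ M)
    (ht : t ≠ 0) (htv : ‖t • v‖ < R) :
    ‖t⁻¹ • (f (z + t • v) - f z) - fderiv ℂ f z v‖ ≤ 4 * M * (‖v‖ / R) ^ 2 * ‖t‖ := by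
  have hschwarz := norm_sub_sub_fderiv_le_of_norm_le_ball hd hM
    (show z + t • v ∈ Metric.ball z R by simpa using htv)
  have hfactor : t⁻¹ • (f (z + t • v) - f z) - fderiv ℂ f z v =
      t⁻¹ • (f (z + t • v) - f z - fderiv ℂ f z (z + t • v - z)) := by
    rw [add_sub_cancel_left, map_smul, smul_sub _ (f _ - f _), inv_smul_smul₀ ht]
  rw [add_sub_cancel_left, norm_smul, mul_div_assoc, mul_pow] at hschwarz
  rw [hfactor, norm_smul, norm_inv, inv_mul_le_iff₀ (norm_pos_iff.2 ht), add_sub_cancel_left]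
  exact hschwarz.trans_eq (by ring)

/-- By the second order Schwarz estimate, difference quotients converge locally uniformly to the
directional derivative. -/
theorem differentiableOn_fderiv_apply [CompleteSpace E] {U : Set V} (hU : IsOpen U) {f : V → E}
    (hf : DifferentiableOn ℂ f U) (v : V) : DifferentiableOn ℂ (fun z => fderiv ℂ f z v) U := by
  intro z₀ hz₀
  obtain ⟨r, hr, M, hrU, hM⟩ := exists_ball_norm_le hU hf.continuousOn hz₀
  have hr2 : 0 < r / 2 := half_pos hr
  have hsub : ∀ z ∈ Metric.ball z₀ (r / 2), Metric.ball z (r / 2) ⊆ Metric.ball z₀ r :=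
    fun z hz => Metric.ball_subset_ball' (by rw [Metric.mem_ball] at hz; linarith)
  have hsmall : ∀ᶠ t : ℂ in 𝓝[≠] 0, t ≠ 0 ∧ ‖t • v‖ < r / 2 := by
    have hnear : ∀ᶠ t : ℂ in 𝓝 0, ‖t • v‖ < r / 2 :=
      ((continuous_id.smul continuous_const).norm.tendsto' _ _ (by simp)).eventually_lt_const hr2
    filter_upwards [self_mem_nhdsWithin, nhdsWithin_le_nhds hnear] with t ht htv using ⟨ht, htv⟩
  obtain ⟨t, htlim, ht⟩ := exists_seq_forall_of_frequently hsmall.frequently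
  have hmem : ∀ N, ∀ z ∈ Metric.ball z₀ (r / 2), z + t N • v ∈ Metric.ball z (r / 2) :=
    fun N z _ => by simpa using (ht N).2
  have hquot : ∀ N, ∀ z ∈ Metric.ball z₀ (r / 2),
      ‖(t N)⁻¹ • (f (z + t N • v) - f z) - fderiv ℂ f z v‖ ≤
        4 * M * (‖v‖ / (r / 2)) ^ 2 * ‖t N‖ := fun N z hz =>
    norm_inv_smul_sub_sub_fderiv_le (hf.mono ((hsub z hz).trans hrU))
      (fun w hw => hM w (hsub z hz hw)) (ht N).1 (ht N).2
  have hlim : Tendsto (fun N => 4 * M * (‖v‖ / (r / 2)) ^ 2 * ‖t N‖) atTop (𝓝 0) := by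
    simpa using (htlim.mono_right nhdsWithin_le_nhds).norm.const_mul (4 * M * (‖v‖ / (r / 2)) ^ 2)
  have hunif : TendstoUniformlyOn (fun N z => (t N)⁻¹ • (f (z + t N • v) - f z))
      (fun z => fderiv ℂ f z v) atTop (Metric.ball z₀ (r / 2)) := by
    rw [Metric.tendstoUniformlyOn_iff]
    intro ε hε
    filter_upwards [hlim.eventually_lt_const hε] with N hN z hz
    rw [dist_comm, dist_eq_norm]
    exact (hquot N z hz).trans_lt hN
  have hdiff : ∀ N, DifferentiableOn ℂ (fun z => (t N)⁻¹ • (f (z + t N • v) - f z))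
      (Metric.ball z₀ (r / 2)) := fun N =>
    ((hf.comp (by fun_prop) fun z hz => hrU (hsub z hz (hmem N z hz))).sub
      (hf.mono fun z hz => hrU (hsub z hz (Metric.mem_ball_self hr2)))).const_smul _
  exact ((differentiableOn_of_tendstoUniformlyOn Metric.isOpen_ball hdiff hunif).differentiableAt
    (Metric.ball_mem_nhds _ hr2)).differentiableWithinAt

theorem eq_zero_of_eventually_eq_zero [CompleteSpace E] {U : Set V} (hU : IsOpen U)
    (hc : IsPreconnected U) {f : V → E} (hf : DifferentiableOn ℂ f U) {z₀ : V} (hz₀ : z₀ ∈ U)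
    (h0 : ∀ᶠ z in 𝓝 z₀, f z = 0) : ∀ z ∈ U, f z = 0 := by
  suffices hsub : U ⊆ {z | ∀ᶠ w in 𝓝 z, f w = 0} from fun z hz => (hsub hz).self_of_nhds
  refine hc.subset_of_closure_inter_subset isOpen_setOfPred_eventually_nhds ⟨z₀, hz₀, h0⟩ ?_
  rintro z ⟨hzc, hzU⟩
  obtain ⟨r, hr, hrU⟩ := Metric.isOpen_iff.1 hU z hzU
  obtain ⟨a, ha, haz⟩ := Metric.mem_closure_iff.1 hzc r hr
  refine Filter.mem_of_superset (Metric.ball_mem_nhds z hr) fun u hu => ?_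
  -- restrict `f` to the complex line through `a` and `u`
  set line : ℂ → V := fun t => a + t • (u - a) with hline
  have hcont : Continuous line := by fun_prop
  have hconv : Convex ℝ (line ⁻¹' Metric.ball z r) :=
    ((convex_ball z r).translate_preimage_right a).linear_preimage
      ((LinearMap.toSpanSingleton ℂ V (u - a)).restrictScalars ℝ)
  have han : AnalyticOnNhd ℂ (f ∘ line) (line ⁻¹' Metric.ball z r) :=
    (hf.comp (by fun_prop : DifferentiableOn ℂ line (line ⁻¹' Metric.ball z r))
      fun t ht => hrU ht).analyticOnNhd (Metric.isOpen_ball.preimage hcont)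
  have hnear : (f ∘ line) =ᶠ[𝓝 0] 0 := by
    have hlim : Tendsto line (𝓝 0) (𝓝 a) := by simpa [hline] using hcont.tendsto 0
    exact hlim.eventually ha
  have hone := han.eqOn_zero_of_preconnected_of_eventuallyEq_zero hconv.isPreconnected
    (by simpa [hline, dist_comm] using haz) hnear (x := 1) (by simpa [hline] using hu)
  simpa [hline] using hone

theorem norm_sub_sub_fderiv_coprod_le {a s : V} {b t : W} {R M : ℝ} {f : V → W → E}
    (h1 : ∀ t ∈ Metric.ball b R, DifferentiableOn ℂ (fun s => f s t) (Metric.ball a R))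
    (h2 : ∀ s ∈ Metric.ball a R, DifferentiableOn ℂ (f s) (Metric.ball b R))
    (hM : ∀ s ∈ Metric.ball a R, ∀ t ∈ Metric.ball b R, ‖f s t‖ ≤ M)
    (hs : s ∈ Metric.ball a R) (ht : t ∈ Metric.ball b R) :
    ‖f s t - f a b - ((fderiv ℂ (fun s => f s b) a).coprod (fderiv ℂ (f a) b)) ((s, t) - (a, b))‖ ≤
      12 * M / R ^ 2 * ‖(s, t) - (a, b)‖ ^ 2 := by
  have hR : 0 < R := Metric.pos_of_mem_ball hs
  have ha : a ∈ Metric.ball a R := Metric.mem_ball_self hR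
  have hb : b ∈ Metric.ball b R := Metric.mem_ball_self hR
  have hM0 : 0 ≤ M := (norm_nonneg _).trans (hM a ha b hb)
  set N := ‖(s, t) - (a, b)‖
  have hsN : ‖s - a‖ ≤ N := norm_fst_le ((s, t) - (a, b))
  have htN : ‖t - b‖ ≤ N := norm_snd_le ((s, t) - (a, b))
  have hfst : ‖f s b - f a b - fderiv ℂ (fun s => f s b) a (s - a)‖ ≤ 4 * M * (N / R) ^ 2 :=
    (norm_sub_sub_fderiv_le_of_norm_le_ball (h1 b hb) (fun s hs => hM s hs b hb) hs).trans
      (by gcongr)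
  have hsnd : ‖f s t - f s b - fderiv ℂ (f s) b (t - b)‖ ≤ 4 * M * (N / R) ^ 2 :=
    (norm_sub_sub_fderiv_le_of_norm_le_ball (h2 s hs) (hM s hs) ht).trans (by gcongr)
  have hmixed : ‖(fderiv ℂ (f s) b - fderiv ℂ (f a) b) (t - b)‖ ≤
      2 * (2 * M / R * N) / R * N := by
    refine ContinuousLinearMap.le_of_opNorm_le_of_le _ ?_ htN
    rw [← fderiv_sub ((h2 s hs).differentiableAt (Metric.ball_mem_nhds b hR))
      ((h2 a ha).differentiableAt (Metric.ball_mem_nhds b hR))]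
    refine norm_fderiv_le_of_norm_le_ball hR ((h2 s hs).sub (h2 a ha)) fun t' ht' => ?_
    exact (norm_sub_le_of_norm_le_ball (h1 t' ht') (fun s hs => hM s hs t' ht') hs).trans
      (by gcongr)
  calc _ = ‖(f s t - f s b - fderiv ℂ (f s) b (t - b)) +
          (fderiv ℂ (f s) b - fderiv ℂ (f a) b) (t - b) +
          (f s b - f a b - fderiv ℂ (fun s => f s b) a (s - a))‖ := by
        congr 1
        simp only [Prod.mk_sub_mk, ContinuousLinearMap.coprod_apply, sub_apply]
        abel
    _ ≤ 4 * M * (N / R) ^ 2 + 2 * (2 * M / R * N) / R * N + 4 * M * (N / R) ^ 2 :=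
        norm_add₃_le.trans (by gcongr)
    _ = 12 * M / R ^ 2 * N ^ 2 := by ring

/-- Osgood's lemma. -/
theorem differentiableOn_prod_of_separately {U : Set V} {U' : Set W} (hU : IsOpen U)
    (hU' : IsOpen U') {f : V → W → E} {M : ℝ} (h1 : ∀ t ∈ U', DifferentiableOn ℂ (fun s => f s t) U)
    (h2 : ∀ s ∈ U, DifferentiableOn ℂ (f s) U') (hM : ∀ s ∈ U, ∀ t ∈ U', ‖f s t‖ ≤ M) :
    DifferentiableOn ℂ (fun p : V × W => f p.1 p.2) (U ×ˢ U') := by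
  rintro ⟨a, b⟩ ⟨ha, hb⟩
  obtain ⟨R, hR, hRsub⟩ := Metric.isOpen_iff.1 (hU.prod hU') (a, b) ⟨ha, hb⟩
  rw [← ball_prod_same] at hRsub
  have hRa : Metric.ball a R ⊆ U := fun s hs =>
    (@hRsub (s, b) ⟨hs, Metric.mem_ball_self hR⟩).1
  have hRb : Metric.ball b R ⊆ U' := fun t ht =>
    (@hRsub (a, t) ⟨Metric.mem_ball_self hR, ht⟩).2
  have hderiv : HasFDerivAt (fun p : V × W => f p.1 p.2)
      ((fderiv ℂ (fun s => f s b) a).coprod (fderiv ℂ (f a) b)) (a, b) := by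
    have hquad : (fun p : V × W => f p.1 p.2 - f a b -
        ((fderiv ℂ (fun s => f s b) a).coprod (fderiv ℂ (f a) b)) (p - (a, b))) =O[𝓝 (a, b)]
          fun p => ‖p - (a, b)‖ ^ 2 := by
      refine Asymptotics.IsBigO.of_bound (12 * M / R ^ 2) ?_
      filter_upwards [prod_mem_nhds (Metric.ball_mem_nhds a hR) (Metric.ball_mem_nhds b hR)]
        with p hp
      rw [norm_pow, norm_norm]
      exact norm_sub_sub_fderiv_coprod_le (fun t ht => (h1 t (hRb ht)).mono hRa)
        (fun s hs => (h2 s (hRa hs)).mono hRb) (fun s hs t ht => hM s (hRa hs) t (hRb ht)) hp.1 hp.2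
    exact .of_isLittleO (hquad.trans_isLittleO
      ((Asymptotics.isLittleO_norm_pow_id one_lt_two).comp_tendsto
        (tendsto_sub_nhds_zero_iff.2 tendsto_id)))
  exact hderiv.differentiableAt.differentiableWithinAt

end SeveralVariables

section Polarization

open scoped ComplexConjugate

theorem eqOn_zero_of_forall_real_eq_zero {W : Set ℂ} (hW : IsOpen W) (hc : IsPreconnected W)
    {g : ℂ → ℂ} (hg : DifferentiableOn ℂ g W) {x₀ : ℝ} (hx₀ : (x₀ : ℂ) ∈ W)
    (h0 : ∀ r : ℝ, (r : ℂ) ∈ W → g r = 0) : Set.EqOn g 0 W := by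
  have hlim : Tendsto ((↑) : ℝ → ℂ) (𝓝[≠] x₀) (𝓝[≠] (x₀ : ℂ)) :=
    Complex.continuous_ofReal.continuousAt.tendsto.inf (by simp)
  refine (hg.analyticOnNhd hW).eqOn_zero_of_preconnected_of_frequently_eq_zero hc hx₀
    (hlim.frequently (Eventually.frequently ?_))
  filter_upwards [(hlim.mono_right nhdsWithin_le_nhds).eventually_mem (hW.mem_nhds hx₀)]
    with r hr using h0 r hr

/-- In the coordinates `(x + i y, x - i y)` the set `t = conj s` is the real plane, a set of
uniqueness for holomorphic functions of `(x, y)`. -/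
theorem eq_zero_of_conj_diagonal {U : Set ℂ} (hU : IsOpen U) (hconv : Convex ℝ U)
    (hconj : ∀ s ∈ U, conj s ∈ U) {F : ℂ × ℂ → ℂ} (hF : DifferentiableOn ℂ F (U ×ˢ U))
    (hd : ∀ s ∈ U, F (s, conj s) = 0) {s t : ℂ} (hs : s ∈ U) (ht : t ∈ U) : F (s, t) = 0 := by
  have hreal_y (y : ℝ) (x : ℂ) (h1 : x + y * Complex.I ∈ U) (h2 : x - y * Complex.I ∈ U) :
      F (x + y * Complex.I, x - y * Complex.I) = 0 := by
    let W : Set ℂ := {x | x + y * Complex.I ∈ U ∧ x - y * Complex.I ∈ U}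
    have hWo : IsOpen W := (hU.preimage (by fun_prop)).inter (hU.preimage (by fun_prop))
    have hWc : Convex ℝ W := by
      simp only [W, sub_eq_add_neg]
      exact (hconv.translate_preimage_left _).inter (hconv.translate_preimage_left _)
    have hre : (x.re : ℂ) ∈ W := by
      have hcx : conj x ∈ W :=
        ⟨by simpa using hconj _ h2, by simpa [← sub_eq_add_neg] using hconj _ h1⟩
      have hmid := hWc ⟨h1, h2⟩ hcx (one_half_pos (α := ℝ)).le one_half_pos.le (add_halves 1)
      rw [← smul_add, Complex.add_conj, Complex.real_smul] at hmid
      simpa using hmid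
    refine eqOn_zero_of_forall_real_eq_zero hWo hWc.isPreconnected
      (g := fun x => F (x + y * Complex.I, x - y * Complex.I))
      (hF.comp (by fun_prop) fun _ hx => hx) hre (fun r hr => ?_) ⟨h1, h2⟩
    simpa [sub_eq_add_neg] using hd _ hr.1
  let W : Set ℂ := {y | s - 2 * Complex.I * y ∈ U}
  have hWc : Convex ℝ W := by
    have h := (hconv.translate_preimage_right s).linear_preimage
      ((LinearMap.mulLeft ℂ (-(2 * Complex.I))).restrictScalars ℝ)
    simpa [Set.preimage, sub_eq_add_neg, W] using h
  have hzero := eqOn_zero_of_forall_real_eq_zero (W := W) (hU.preimage (by fun_prop))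
    hWc.isPreconnected (g := fun y => F (s, s - 2 * Complex.I * y))
    (hF.comp (by fun_prop) fun _ hy => ⟨hs, hy⟩) (x₀ := 0) (by simpa [W] using hs) fun y hy => by
      have hline : s - y * Complex.I - y * Complex.I = s - 2 * Complex.I * y := by ring
      simpa [hline] using hreal_y y (s - y * Complex.I) (by simpa using hs) (hline ▸ hy)
  have hst : s - 2 * Complex.I * ((s - t) / (2 * Complex.I)) = t := by
    rw [mul_div_cancel₀ _ (by simp)]
    exact sub_sub_cancel s t
  simpa [hst] using hzero (x := (s - t) / (2 * Complex.I)) (by simpa [W, hst] using ht)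

/-- Polarization. -/
theorem eq_zero_of_diagonal_eq_zero {V : Type*} [NormedAddCommGroup V] [NormedSpace ℂ V]
    {U : Set V} (hU : IsOpen U) (hc : IsPreconnected U) {f : V → V → ℂ}
    (h1 : ∀ w ∈ U, DifferentiableOn ℂ (fun z => f z w) U)
    (h2 : ∀ z ∈ U, DifferentiableOn ℂ (fun w => conj (f z w)) U)
    (hb : ∀ z₀ ∈ U, ∃ r > 0, ∃ M, ∀ z ∈ Metric.ball z₀ r, ∀ w ∈ Metric.ball z₀ r, ‖f z w‖ ≤ M)
    (hd : ∀ z ∈ U, f z z = 0) : ∀ z ∈ U, ∀ w ∈ U, f z w = 0 := by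
  intro z hz w hw
  refine eq_zero_of_eventually_eq_zero hU hc (h1 w hw) hw ?_ z hz
  obtain ⟨r₁, hr₁, M, hM⟩ := hb w hw
  obtain ⟨r₂, hr₂, hU₂⟩ := Metric.isOpen_iff.1 hU w hw
  have hr : 0 < min r₁ r₂ := lt_min hr₁ hr₂
  refine Filter.mem_of_superset (Metric.ball_mem_nhds w (half_pos hr)) fun u hu => ?_
  -- complexify the segment from `w` to `u`
  let line : ℂ → V := fun s => w + s • (u - w)
  have hline : Differentiable ℂ line := by fun_prop
  have hmem : ∀ s ∈ Metric.ball (0 : ℂ) 2, line s ∈ Metric.ball w (min r₁ r₂) := by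
    intro s hs
    rw [mem_ball_zero_iff] at hs
    rw [mem_ball_iff_norm] at hu ⊢
    rw [add_sub_cancel_left, norm_smul]
    nlinarith [norm_nonneg (u - w), norm_nonneg s]
  have hmemM : ∀ s ∈ Metric.ball (0 : ℂ) 2, line s ∈ Metric.ball w r₁ := fun s hs =>
    Metric.ball_subset_ball (min_le_left _ _) (hmem s hs)
  have hmemU : ∀ s ∈ Metric.ball (0 : ℂ) 2, line s ∈ U := fun s hs =>
    hU₂ (Metric.ball_subset_ball (min_le_right _ _) (hmem s hs))
  have hconj : ∀ s ∈ Metric.ball (0 : ℂ) 2, conj s ∈ Metric.ball (0 : ℂ) 2 := by simp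
  have hsnd : ∀ s ∈ Metric.ball (0 : ℂ) 2,
      DifferentiableOn ℂ (fun t => f (line s) (line (conj t))) (Metric.ball 0 2) := by
    intro s hs t ht
    have h := ((h2 _ (hmemU s hs)).comp hline.differentiableOn hmemU).differentiableAt
      (Metric.isOpen_ball.mem_nhds (hconj t ht))
    have h' := h.conj_conj
    simp only [Complex.conj_conj] at h'
    exact (h'.congr_of_eventuallyEq (.of_forall fun t => by simp)).differentiableWithinAt
  have hF := differentiableOn_prod_of_separately Metric.isOpen_ball Metric.isOpen_ball
    (f := fun s t => f (line s) (line (conj t)))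
    (fun t ht => (h1 _ (hmemU _ (hconj t ht))).comp hline.differentiableOn hmemU) hsnd
    (fun s hs t ht => hM _ (hmemM s hs) _ (hmemM _ (hconj t ht)))
  simpa [line] using eq_zero_of_conj_diagonal Metric.isOpen_ball (convex_ball _ _) hconj hF
    (fun s hs => by simpa using hd _ (hmemU s hs)) (s := 1) (t := 0) (by simp) (by simp)

end Polarization

section Holomorphic

variable {V E : Type*} [NormedAddCommGroup V] [NormedSpace ℂ V]
  [NormedAddCommGroup E] [NormedSpace ℂ E] {D : Set V}

theorem IsHolomorphic.of_differentiableOn {f : D → E} {F : V → E} (hF : DifferentiableOn ℂ F D)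
    (h : ∀ z : D, f z = F z) : IsHolomorphic f :=
  hF.congr fun z hz => by rw [extend_val f hz, h ⟨z, hz⟩]

theorem IsHolomorphic.congr {f g : D → E} (hf : IsHolomorphic f) (h : ∀ z, g z = f z) :
    IsHolomorphic g := by
  rwa [show g = f from funext h]

theorem IsHolomorphic.continuous {f : D → E} (hf : IsHolomorphic f) : Continuous f := by
  have h := (continuousOn_iff_continuous_domRestrict.1 (DifferentiableOn.continuousOn hf))
  convert h using 1
  ext z
  exact (extend_val f z.2).symm

theorem isHolomorphic_const (c : E) : IsHolomorphic (fun _ : D => c) :=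
  .of_differentiableOn (differentiableOn_const c) fun _ => rfl

theorem IsHolomorphic.add {f g : D → E} (hf : IsHolomorphic f) (hg : IsHolomorphic g) :
    IsHolomorphic (fun z => f z + g z) :=
  .of_differentiableOn (DifferentiableOn.add hf hg) fun z => by simp

theorem IsHolomorphic.sub {f g : D → E} (hf : IsHolomorphic f) (hg : IsHolomorphic g) :
    IsHolomorphic (fun z => f z - g z) :=
  .of_differentiableOn (DifferentiableOn.sub hf hg) fun z => by simp

theorem IsHolomorphic.smul {f : D → ℂ} {g : D → E} (hf : IsHolomorphic f) (hg : IsHolomorphic g) :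
    IsHolomorphic (fun z => f z • g z) :=
  .of_differentiableOn (DifferentiableOn.smul hf hg) fun z => by simp

theorem IsHolomorphic.mul {f g : D → ℂ} (hf : IsHolomorphic f) (hg : IsHolomorphic g) :
    IsHolomorphic (fun z => f z * g z) := hf.smul hg

theorem IsHolomorphic.const_mul {f : D → ℂ} (c : ℂ) (hf : IsHolomorphic f) :
    IsHolomorphic (fun z => c * f z) := (isHolomorphic_const c).mul hf

theorem IsHolomorphic.pow {f : D → ℂ} (hf : IsHolomorphic f) (k : ℕ) :
    IsHolomorphic (fun z => f z ^ k) :=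
  .of_differentiableOn (DifferentiableOn.pow hf k) fun z => by simp

theorem IsHolomorphic.inv {f : D → ℂ} (hf : IsHolomorphic f) (h0 : ∀ z, f z ≠ 0) :
    IsHolomorphic (fun z => (f z)⁻¹) :=
  .of_differentiableOn (DifferentiableOn.inv hf fun z hz => by rw [extend_val f hz]; exact h0 _)
    fun z => by simp

theorem IsHolomorphic.sum {ι : Type*} (s : Finset ι) {f : ι → D → E}
    (hf : ∀ i ∈ s, IsHolomorphic (f i)) : IsHolomorphic (fun z => ∑ i ∈ s, f i z) :=
  .of_differentiableOn (DifferentiableOn.fun_sum hf) fun z => by simp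

theorem IsHolomorphic.clm_comp {E' : Type*} [NormedAddCommGroup E'] [NormedSpace ℂ E']
    (L : E →L[ℂ] E') {f : D → E} (hf : IsHolomorphic f) : IsHolomorphic (fun z => L (f z)) :=
  .of_differentiableOn (L.differentiable.comp_differentiableOn hf)
    fun z => by simp

theorem IsHolomorphic.apply {m : ℕ} {f : D → Fin m → ℂ} (hf : IsHolomorphic f) (i : Fin m) :
    IsHolomorphic (fun z => f z i) :=
  hf.clm_comp (ContinuousLinearMap.proj (R := ℂ) (φ := fun _ : Fin m => ℂ) i)

theorem IsHolomorphic.comp {V' : Type*} [NormedAddCommGroup V'] [NormedSpace ℂ V'] {D' : Set V'}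
    {f : D → E} (hf : IsHolomorphic f) {g : D' → D} (hg : IsHolomorphic (fun z => (g z : V))) :
    IsHolomorphic (fun z => f (g z)) := by
  refine .of_differentiableOn (F := Function.extend Subtype.val f 0 ∘
    Function.extend Subtype.val (fun z => (g z : V)) 0) (DifferentiableOn.comp hf hg fun z hz => ?_)
    fun z => ?_
  · rw [extend_val _ hz]; exact (g _).2
  · rw [Function.comp, extend_val _ z.2, extend_val f (g z).2]

theorem isHolomorphic_of_tendstoUniformlyOn [CompleteSpace E] (hD : IsOpen D) {ι : Type*}
    {l : Filter ι} [l.NeBot] {F : ι → D → E} {f : D → E} (hF : ∀ i, IsHolomorphic (F i))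
    (h : ∀ z : D, ∃ r > 0, TendstoUniformlyOn F f l (Metric.ball z r)) : IsHolomorphic f := by
  intro z hz
  obtain ⟨r, hr, h⟩ := h ⟨z, hz⟩
  have hU : IsOpen (D ∩ Metric.ball z r) := hD.inter Metric.isOpen_ball
  refine DifferentiableAt.differentiableWithinAt (DifferentiableOn.differentiableAt
    (differentiableOn_of_tendstoUniformlyOn (l := l) hU
      (F := fun i => Function.extend Subtype.val (F i) 0)
      (fun i => (hF i).mono Set.inter_subset_left) ?_)
    (hU.mem_nhds ⟨hz, Metric.mem_ball_self hr⟩))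
  rw [Metric.tendstoUniformlyOn_iff] at h ⊢
  intro ε hε
  filter_upwards [h ε hε] with i hi w hw
  rw [extend_val _ hw.1, extend_val _ hw.1]
  exact hi ⟨w, hw.1⟩ hw.2

theorem IsHolomorphic.norm_sub_le {f : D → E} (hf : IsHolomorphic f) {z w : D} {r M : ℝ}
    (hr : Metric.ball (z : V) r ⊆ D) (hM : ∀ u ∈ Metric.ball z r, ‖f u‖ ≤ M)
    (hw : w ∈ Metric.ball z r) : ‖f w - f z‖ ≤ 2 * M / r * dist w z := by
  have := norm_sub_le_of_norm_le_ball (DifferentiableOn.mono hf hr) (M := M) (z := (w : V))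
    (fun u hu => by rw [extend_val f (hr hu)]; exact hM ⟨u, hr hu⟩ hu) hw
  rwa [extend_val f w.2, extend_val f z.2, ← dist_eq_norm (w : V)] at this

end Holomorphic

section MeanValue

variable {V E : Type*} [NormedAddCommGroup V] [NormedSpace ℂ V] [NormedAddCommGroup E]
  [NormedSpace ℂ E]

theorem enorm_mul_two_pi_le_lintegral_circle [CompleteSpace E] {f : V → E} {z u : V} {r : ℝ}
    (hf : DifferentiableOn ℂ f (Metric.ball z r)) (hu : u ∈ Metric.ball 0 r) :
    ‖f z‖ₑ * ENNReal.ofReal (2 * Real.pi) ≤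
      ∫⁻ θ in Set.Ioc 0 (2 * Real.pi), ‖f (z + Complex.exp (θ * Complex.I) • u)‖ₑ := by
  have hmaps : Set.MapsTo (fun t : ℂ => z + t • u) (Metric.closedBall 0 1) (Metric.ball z r) := by
    intro t ht
    rw [mem_closedBall_zero_iff] at ht
    rw [mem_ball_zero_iff] at hu
    rw [mem_ball_iff_norm, add_sub_cancel_left, norm_smul]
    nlinarith [norm_nonneg u]
  have hdiff : DiffContOnCl ℂ (fun t : ℂ => f (z + t • u)) (Metric.ball 0 |1|) :=
    ((hf.comp (by fun_prop) hmaps).mono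
      (by simpa using Metric.closure_ball_subset_closedBall)).diffContOnCl
  have hmean := hdiff.circleAverage
  simp only [Real.circleAverage_def, intervalIntegral.integral_of_le Real.two_pi_pos.le, zero_smul,
    add_zero, circleMap_zero, Complex.ofReal_one, one_mul] at hmean
  rw [inv_smul_eq_iff₀ Real.two_pi_pos.ne'] at hmean
  rw [mul_comm, ← Real.enorm_of_nonneg Real.two_pi_pos.le, ← enorm_smul, ← hmean]
  exact enorm_integral_le_lintegral_enorm _

theorem setLIntegral_ball_add_left {V : Type*} [NormedAddCommGroup V] [MeasurableSpace V]
    [BorelSpace V] (μ : Measure V) [μ.IsAddHaarMeasure] (g : V → ENNReal) (z : V) (r : ℝ) :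
    ∫⁻ u in Metric.ball 0 r, g (z + u) ∂μ = ∫⁻ w in Metric.ball z r, g w ∂μ := by
  have h := (measurePreserving_add_left μ z).setLIntegral_comp_preimage_emb
    (MeasurableEquiv.addLeft z).measurableEmbedding g (Metric.ball z r)
  rwa [preimage_add_ball, sub_self] at h

variable [MeasurableSpace V] [BorelSpace V] [FiniteDimensional ℂ V] (μ : Measure V)
  [μ.IsAddHaarMeasure]

theorem measurePreserving_smul_of_norm_eq_one {c : ℂ} (hc : ‖c‖ = 1) :
    MeasurePreserving (fun u : V => c • u) μ μ := by
  have hdet : LinearMap.det ((LinearMap.lsmul ℂ V c).restrictScalars ℝ) = 1 := by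
    have hsmul : LinearMap.lsmul ℂ V c = c • LinearMap.id := by ext; simp
    rw [LinearMap.det_restrictScalars, hsmul, LinearMap.det_smul, LinearMap.det_id, mul_one,
      map_pow, Algebra.norm_complex_apply, Complex.normSq_eq_norm_sq, hc, one_pow, one_pow]
  refine ⟨by fun_prop, ?_⟩
  have hmap := Measure.map_linearMap_addHaar_eq_smul_addHaar μ (hdet ▸ one_ne_zero)
  rwa [hdet, inv_one, abs_one, ENNReal.ofReal_one, one_smul] at hmap

theorem setLIntegral_ball_smul_of_norm_eq_one {c : ℂ} (hc : ‖c‖ = 1) (g : V → ENNReal) (r : ℝ) :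
    ∫⁻ u in Metric.ball 0 r, g (c • u) ∂μ = ∫⁻ u in Metric.ball 0 r, g u ∂μ := by
  have hc0 : c ≠ 0 := norm_ne_zero_iff.1 (hc ▸ one_ne_zero)
  have hpre : (fun u : V => c • u) ⁻¹' Metric.ball 0 r = Metric.ball 0 r := by
    ext u
    simp [norm_smul, hc]
  have h := (measurePreserving_smul_of_norm_eq_one μ hc).setLIntegral_comp_preimage_emb
    (Homeomorph.smulOfNeZero c hc0).measurableEmbedding g (Metric.ball 0 r)
  rwa [hpre] at h

theorem enorm_mul_measure_ball_le [CompleteSpace E] {f : V → E} {z : V} {r : ℝ}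
    (hf : DifferentiableOn ℂ f (Metric.ball z r)) :
    ‖f z‖ₑ * μ (Metric.ball z r) ≤ ∫⁻ w in Metric.ball z r, ‖f w‖ₑ ∂μ := by
  have hmeas : AEMeasurable (Function.uncurry fun (u : V) (θ : ℝ) =>
      ‖f (z + Complex.exp (θ * Complex.I) • u)‖ₑ)
      ((μ.restrict (Metric.ball 0 r)).prod (volume.restrict (Set.Ioc 0 (2 * Real.pi)))) := by
    rw [Measure.prod_restrict]
    refine ContinuousOn.aemeasurable (ContinuousOn.enorm (hf.continuousOn.comp (by fun_prop) ?_))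
      (measurableSet_ball.prod measurableSet_Ioc)
    rintro ⟨u, θ⟩ ⟨hu, -⟩
    simpa [norm_smul, Complex.norm_exp_ofReal_mul_I] using hu
  refine (ENNReal.mul_le_mul_iff_left (c := ENNReal.ofReal (2 * Real.pi))
    (by simp [Real.pi_pos]) ENNReal.ofReal_ne_top).1 ?_
  calc ‖f z‖ₑ * μ (Metric.ball z r) * ENNReal.ofReal (2 * Real.pi)
      = ∫⁻ _ in Metric.ball (0 : V) r, ‖f z‖ₑ * ENNReal.ofReal (2 * Real.pi) ∂μ := by
        rw [setLIntegral_const, Measure.addHaar_ball_center μ z r, mul_right_comm]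
    _ ≤ ∫⁻ u in Metric.ball (0 : V) r, (∫⁻ θ in Set.Ioc 0 (2 * Real.pi),
          ‖f (z + Complex.exp (θ * Complex.I) • u)‖ₑ) ∂μ :=
        setLIntegral_mono' measurableSet_ball fun _ hu => enorm_mul_two_pi_le_lintegral_circle hf hu
    _ = ∫⁻ θ in Set.Ioc 0 (2 * Real.pi), ∫⁻ u in Metric.ball (0 : V) r,
          ‖f (z + Complex.exp (θ * Complex.I) • u)‖ₑ ∂μ := lintegral_lintegral_swap hmeas
    _ = ∫⁻ _ in Set.Ioc 0 (2 * Real.pi), ∫⁻ w in Metric.ball z r, ‖f w‖ₑ ∂μ :=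
        lintegral_congr fun _ => by
          rw [setLIntegral_ball_smul_of_norm_eq_one μ (Complex.norm_exp_ofReal_mul_I _)
            fun u => ‖f (z + u)‖ₑ, setLIntegral_ball_add_left μ fun w => ‖f w‖ₑ]
    _ = (∫⁻ w in Metric.ball z r, ‖f w‖ₑ ∂μ) * ENNReal.ofReal (2 * Real.pi) := by
        rw [setLIntegral_const, Real.volume_Ioc, sub_zero]

end MeanValue

section SquareMeanValue

variable {n : ℕ} {D : Set (Fin n → ℂ)}

theorem setLIntegral_euclideanVolume (hD : IsOpen D) {z : D} {r : ℝ}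
    (hr : Metric.ball (z : Fin n → ℂ) r ⊆ D) (f : D → ENNReal) :
    ∫⁻ w in Metric.ball z r, f w ∂(euclideanVolume D) =
      ∫⁻ w in Metric.ball (z : Fin n → ℂ) r, Function.extend Subtype.val f 0 w := by
  have hext : f = fun w : D => Function.extend Subtype.val f 0 w :=
    funext fun w => (extend_val f w.2).symm
  have himage : Subtype.val '' Metric.ball z r = Metric.ball (z : Fin n → ℂ) r :=
    Set.Subset.antisymm (Set.image_subset_iff.2 fun _ hw => hw) fun w hw => ⟨⟨w, hr hw⟩, hw, rfl⟩
  conv_lhs => rw [hext]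
  rw [euclideanVolume, setLIntegral_subtype hD.measurableSet, himage]

theorem IsHolomorphic.sq_enorm_mul_le (hD : IsOpen D) {f : D → ℂ} (hf : IsHolomorphic f) {z : D}
    {r : ℝ} (hr : Metric.ball (z : Fin n → ℂ) r ⊆ D) :
    ‖f z‖ₑ ^ 2 * volume (Metric.ball (0 : Fin n → ℂ) r) ≤
      ∫⁻ w in Metric.ball z r, ‖f w‖ₑ ^ 2 ∂(euclideanVolume D) := by
  have hmean := enorm_mul_measure_ball_le volume (DifferentiableOn.mono (hf.pow 2) hr)
  rw [extend_val _ z.2, Measure.addHaar_ball_center, enorm_pow] at hmean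
  rw [setLIntegral_euclideanVolume hD hr]
  refine hmean.trans_eq (setLIntegral_congr_fun measurableSet_ball fun w hw => ?_)
  simp only [extend_val _ (hr hw), enorm_pow]

end SquareMeanValue

section Jacobian

theorem differentiableOn_det {V ι : Type*} [NormedAddCommGroup V] [NormedSpace ℂ V] [Fintype ι]
    [DecidableEq ι] {U : Set V} {A : V → Matrix ι ι ℂ}
    (h : ∀ i j, DifferentiableOn ℂ (fun z => A z i j) U) :
    DifferentiableOn ℂ (fun z => (A z).det) U := by
  simp only [Matrix.det_apply]
  exact .fun_sum fun σ _ => .const_smul (fun z hz => (HasFDerivWithinAt.finsetProd fun i _ =>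
    (h (σ i) i z hz).hasFDerivWithinAt).differentiableWithinAt) _

variable {n : ℕ} {D : Set (Fin n → ℂ)}

/-- The extension by zero of a self-map of `D` to the ambient space; its derivative defines
`jac`. -/
def ambient (g : D ≃ₜ D) : (Fin n → ℂ) → Fin n → ℂ :=
  Function.extend Subtype.val (fun w : D => (g w : Fin n → ℂ)) 0

theorem ambient_val (g : D ≃ₜ D) (z : D) : ambient g z = g z := extend_val _ z.2

theorem differentiableAt_ambient (hD : IsOpen D) {g : D ≃ₜ D} (hg : g ∈ Aut D) (z : D) :
    DifferentiableAt ℂ (ambient g) z :=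
  DifferentiableOn.differentiableAt hg.1 (hD.mem_nhds z.2)

theorem isHolomorphic_jac (hD : IsOpen D) {g : D ≃ₜ D} (hg : g ∈ Aut D) :
    IsHolomorphic (jac g) := by
  refine .of_differentiableOn (F := fun z => (LinearMap.toMatrix'
    (fderiv ℂ (ambient g) z : (Fin n → ℂ) →ₗ[ℂ] Fin n → ℂ)).det) ?_ fun z => ?_
  · refine differentiableOn_det fun i j => ?_
    simp only [LinearMap.toMatrix'_apply]
    exact differentiableOn_pi.1 (differentiableOn_fderiv_apply hD hg.1 _) _
  · rw [LinearMap.det_toMatrix']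
    rfl

theorem jac_mul (hD : IsOpen D) {g h : D ≃ₜ D} (hg : g ∈ Aut D) (hh : h ∈ Aut D) (z : D) :
    jac (g * h) z = jac g (h z) * jac h z := by
  have hcomp : ambient (g * h) =ᶠ[𝓝 (z : Fin n → ℂ)] ambient g ∘ ambient h := by
    filter_upwards [hD.mem_nhds z.2] with w hw
    lift w to D using hw
    simp only [Function.comp_apply, ambient_val]
    rfl
  have hchain : fderiv ℂ (ambient (g * h)) z =
      (fderiv ℂ (ambient g) (h z)).comp (fderiv ℂ (ambient h) z) := by
    rw [hcomp.fderiv_eq, fderiv_comp _ _ (differentiableAt_ambient hD hh z), ambient_val]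
    exact ambient_val h z ▸ differentiableAt_ambient hD hg (h z)
  calc jac (g * h) z = ((fderiv ℂ (ambient g) (h z)).comp (fderiv ℂ (ambient h) z)).det :=
        congrArg ContinuousLinearMap.det hchain
    _ = jac g (h z) * jac h z := LinearMap.det_comp _ _

theorem jac_one (hD : IsOpen D) (z : D) : jac (1 : D ≃ₜ D) z = 1 := by
  have hid : ambient (1 : D ≃ₜ D) =ᶠ[𝓝 (z : Fin n → ℂ)] id := by
    filter_upwards [hD.mem_nhds z.2] with w hw using ambient_val 1 ⟨w, hw⟩
  calc jac (1 : D ≃ₜ D) z = (ContinuousLinearMap.id ℂ (Fin n → ℂ)).det :=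
        congrArg ContinuousLinearMap.det (hid.fderiv_eq.trans fderiv_id)
    _ = 1 := LinearMap.det_id

theorem jac_ne_zero (hD : IsOpen D) {g : D ≃ₜ D} (hg : g ∈ Aut D) (z : D) : jac g z ≠ 0 := by
  have h := jac_mul hD ((Aut D).inv_mem hg) hg z
  rw [inv_mul_cancel, jac_one hD] at h
  exact right_ne_zero_of_mul (h ▸ one_ne_zero)

theorem image_ambient (g : D ≃ₜ D) : ambient g '' D = D := by
  ext w
  constructor
  · rintro ⟨u, hu, rfl⟩
    exact ambient_val g ⟨u, hu⟩ ▸ (g ⟨u, hu⟩).2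
  · intro hw
    exact ⟨g.symm ⟨w, hw⟩, Subtype.coe_prop _, by rw [ambient_val, g.apply_symm_apply]⟩

theorem injOn_ambient (g : D ≃ₜ D) : Set.InjOn (ambient g) D := by
  intro u hu v hv huv
  rw [ambient_val g ⟨u, hu⟩, ambient_val g ⟨v, hv⟩] at huv
  simpa using g.injective (Subtype.ext huv)

theorem ofReal_abs_det_restrictScalars {V : Type*} [NormedAddCommGroup V] [NormedSpace ℂ V]
    (L : V →L[ℂ] V) : ENNReal.ofReal |(L.restrictScalars ℝ).det| = ‖L.det‖ₑ ^ 2 := by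
  rw [ContinuousLinearMap.det, ContinuousLinearMap.coe_restrictScalars,
    LinearMap.det_restrictScalars, Algebra.norm_complex_apply, Complex.normSq_eq_norm_sq,
    abs_of_nonneg (by positivity), ENNReal.ofReal_pow (norm_nonneg _), ofReal_norm]

theorem lintegral_comp_aut (hD : IsOpen D) {g : D ≃ₜ D} (hg : g ∈ Aut D) (f : D → ENNReal) :
    ∫⁻ w, ‖jac g w‖ₑ ^ 2 * f (g w) ∂(euclideanVolume D) = ∫⁻ w, f w ∂(euclideanVolume D) := by
  have hcov := lintegral_image_eq_lintegral_abs_det_fderiv_mul volume hD.measurableSet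
    (f' := fun x => (fderiv ℂ (ambient g) x).restrictScalars ℝ)
    (fun x hx => ((differentiableAt_ambient hD hg ⟨x, hx⟩).hasFDerivAt.restrictScalars
      ℝ).hasFDerivWithinAt) (injOn_ambient g) (Function.extend Subtype.val f 0)
  rw [image_ambient, ← lintegral_subtype_comap hD.measurableSet,
    ← lintegral_subtype_comap hD.measurableSet] at hcov
  simp only [ofReal_abs_det_restrictScalars, ambient_val,
    extend_val f (Subtype.coe_prop _)] at hcov
  exact hcov.symm

theorem measurePreserving_aut (hD : IsOpen D) {g : D ≃ₜ D} (hg : g ∈ Aut D) :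
    MeasurePreserving g ((euclideanVolume D).withDensity fun w => ‖jac g w‖ₑ ^ 2)
      (euclideanVolume D) := by
  refine ⟨g.continuous.measurable, Measure.ext fun s hs => ?_⟩
  rw [Measure.map_apply g.continuous.measurable hs,
    withDensity_apply _ (g.continuous.measurable hs), ← lintegral_indicator_one hs,
    ← lintegral_comp_aut hD hg, ← lintegral_indicator (g.continuous.measurable hs)]
  refine lintegral_congr fun w => ?_
  by_cases h : g w ∈ s <;> simp [Set.indicator, h]

end Jacobian

section WeightedChangeOfVariables

variable {α : Type*} [MeasurableSpace α] {ν : Measure α}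

theorem memLp_two_iff_lintegral {E : Type*} [NormedAddCommGroup E] {f : α → E}
    (hf : AEStronglyMeasurable f ν) : MemLp f 2 ν ↔ ∫⁻ w, ‖f w‖ₑ ^ 2 ∂ν < ⊤ := by
  rw [MemLp, and_iff_right hf, eLpNorm_lt_top_iff_lintegral_rpow_enorm_lt_top two_ne_zero
    ENNReal.ofNat_ne_top]
  simp

theorem eLpNorm_two_sq {E : Type*} [NormedAddCommGroup E] (f : α → E) :
    eLpNorm f 2 ν ^ 2 = ∫⁻ w, ‖f w‖ₑ ^ 2 ∂ν := by
  rw [eLpNorm_eq_lintegral_rpow_enorm_toReal two_ne_zero ENNReal.ofNat_ne_top,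
    ← ENNReal.rpow_natCast, ← ENNReal.rpow_mul]
  simp

variable {g : α → α} {a : α → ℂ}

theorem lintegral_sq_enorm_mul_comp (hg : MeasurableEmbedding g) (ha : Measurable a)
    (hmp : MeasurePreserving g (ν.withDensity fun w => ‖a w‖ₑ ^ 2) ν) (f : α → ENNReal) :
    ∫⁻ w, ‖a w‖ₑ ^ 2 * f (g w) ∂ν = ∫⁻ w, f w ∂ν := by
  rw [← hmp.lintegral_comp_emb hg f,
    lintegral_withDensity_eq_lintegral_mul_non_measurable _ (ha.enorm.pow_const 2)
      (Eventually.of_forall fun w => by finiteness)]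
  rfl

theorem integral_sq_norm_smul_comp {E : Type*} [NormedAddCommGroup E] [NormedSpace ℝ E]
    (hg : MeasurableEmbedding g) (ha : Measurable a)
    (hmp : MeasurePreserving g (ν.withDensity fun w => ‖a w‖ₑ ^ 2) ν) (f : α → E) :
    ∫ w, (‖a w‖ ^ 2 : ℝ) • f (g w) ∂ν = ∫ w, f w ∂ν := by
  rw [← hmp.integral_comp hg f, integral_withDensity_eq_integral_toReal_smul
    (ha.enorm.pow_const 2) (Eventually.of_forall fun w => by finiteness)]
  simp

theorem memLp_two_mul_comp_iff (hg : MeasurableEmbedding g) (ha : Measurable a)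
    (hmp : MeasurePreserving g (ν.withDensity fun w => ‖a w‖ₑ ^ 2) ν) {f : α → ℂ}
    (hf : Measurable f) : MemLp (fun w => a w * f (g w)) 2 ν ↔ MemLp f 2 ν := by
  rw [memLp_two_iff_lintegral (f := fun w => a w * f (g w))
    (ha.mul (hf.comp hg.measurable)).aestronglyMeasurable,
    memLp_two_iff_lintegral hf.aestronglyMeasurable,
    ← lintegral_sq_enorm_mul_comp hg ha hmp fun w => ‖f w‖ₑ ^ 2]
  simp only [enorm_mul, mul_pow]

end WeightedChangeOfVariables

section Kernel

variable {V : Type*} [NormedAddCommGroup V] [NormedSpace ℂ V] [MeasurableSpace V] {D : Set V}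
  {ν : Measure D} {K : D → D → ℂ}

/-- `K` is the reproducing kernel of the space of holomorphic functions that are square integrable
with respect to `ν`. -/
structure IsReproducingKernel (ν : Measure D) (K : D → D → ℂ) : Prop where
  holomorphic : ∀ w, IsHolomorphic fun z => K z w
  memLp : ∀ w, MemLp (fun z => K z w) 2 ν
  hermitian : ∀ z w, K z w = starRingEnd ℂ (K w z)
  reproducing : ∀ f : D → ℂ, IsHolomorphic f → MemLp f 2 ν → ∀ z, f z = ∫ w : D, f w * K z w ∂ν

/-- Point evaluations of square integrable holomorphic functions are locally uniformly bounded. -/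
def EvalLocallyBounded (ν : Measure D) : Prop :=
  ∀ z : D, ∃ r > 0, ∃ C : ℝ, 0 ≤ C ∧ ∀ f : D → ℂ, IsHolomorphic f → MemLp f 2 ν →
    ∀ w ∈ Metric.ball z r, ‖f w‖ ≤ C * (eLpNorm f 2 ν).toReal

/-- The space of classes of holomorphic functions in `L²(ν)`. -/
def holomorphicL2 (ν : Measure D) : Submodule ℂ (Lp ℂ 2 ν) where
  carrier := {f | ∃ g : D → ℂ, IsHolomorphic g ∧ f =ᵐ[ν] g}
  zero_mem' := ⟨fun _ => 0, isHolomorphic_const 0, Lp.coeFn_zero _ _ _⟩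
  add_mem' := by
    rintro f f' ⟨g, hg, hfg⟩ ⟨g', hg', hfg'⟩
    exact ⟨_, hg.add hg', (Lp.coeFn_add f f').trans (hfg.add hfg')⟩
  smul_mem' := by
    rintro c f ⟨g, hg, hfg⟩
    exact ⟨_, hg.const_mul c, (Lp.coeFn_smul c f).trans (hfg.const_smul c)⟩

theorem EvalLocallyBounded.uniformCauchySeqOn (hb : EvalLocallyBounded ν) {x : ℕ → Lp ℂ 2 ν}
    (hx : CauchySeq x) {g : ℕ → D → ℂ} (hg : ∀ i, IsHolomorphic (g i)) (hxg : ∀ i, x i =ᵐ[ν] g i)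
    (z : D) : ∃ r > 0, UniformCauchySeqOn g atTop (Metric.ball z r) := by
  have hmem : ∀ i, MemLp (g i) 2 ν := fun i => (memLp_congr_ae (hxg i)).1 (Lp.memLp _)
  have hdist : ∀ i j, (eLpNorm (fun w => g i w - g j w) 2 ν).toReal = dist (x i) (x j) :=
    fun i j => by
      rw [Lp.dist_def]
      exact congrArg _ (eLpNorm_congr_ae ((hxg i).sub (hxg j)).symm)
  obtain ⟨r, hr, C, hC, h⟩ := hb z
  refine ⟨r, hr, Metric.uniformCauchySeqOn_iff.2 fun ε hε => ?_⟩
  obtain ⟨N, hN⟩ := Metric.cauchySeq_iff.1 hx (ε / (C + 1)) (by positivity)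
  refine ⟨N, fun i hi j hj w hw => ?_⟩
  calc dist (g i w) (g j w) ≤ C * dist (x i) (x j) := by
        rw [dist_eq_norm, ← hdist]
        exact h _ ((hg i).sub (hg j)) ((hmem i).sub (hmem j)) w hw
    _ ≤ (C + 1) * dist (x i) (x j) := by gcongr; linarith
    _ < ε := by rw [mul_comm, ← lt_div_iff₀ (by positivity)]; exact hN i hi j hj

theorem isClosed_holomorphicL2 (hD : IsOpen D) (hb : EvalLocallyBounded ν) :
    IsClosed (holomorphicL2 ν : Set (Lp ℂ 2 ν)) := by
  refine IsSeqClosed.isClosed fun x f hx hlim => ?_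
  choose g hg hxg using hx
  have hcauchy := hb.uniformCauchySeqOn hlim.cauchySeq hg hxg
  have hpointwise : ∀ z, ∃ a, Tendsto (fun i => g i z) atTop (𝓝 a) := fun z => by
    obtain ⟨r, hr, h⟩ := hcauchy z
    exact cauchySeq_tendsto_of_complete (h.cauchySeq (Metric.mem_ball_self hr))
  choose G hG using hpointwise
  refine ⟨G, isHolomorphic_of_tendstoUniformlyOn (l := atTop) hD hg fun z => ?_, ?_⟩
  · obtain ⟨r, hr, h⟩ := hcauchy z
    exact ⟨r, hr, h.tendstoUniformlyOn_of_tendsto fun w _ => hG w⟩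
  · obtain ⟨ns, hns, hae⟩ := (tendstoInMeasure_of_tendsto_Lp hlim).exists_seq_tendsto_ae
    filter_upwards [hae, ae_all_iff.2 hxg] with w hw hxw
    simp only [hxw] at hw
    exact tendsto_nhds_unique hw ((hG w).comp hns.tendsto_atTop)

theorem holomorphicL2.exists_inner_eq_apply [ν.IsOpenPosMeasure] (hD : IsOpen D)
    (hb : EvalLocallyBounded ν) (z : D) :
    ∃ e : holomorphicL2 ν, ∀ (f : holomorphicL2 ν) (g : D → ℂ), IsHolomorphic g →
      (f : Lp ℂ 2 ν) =ᵐ[ν] g → inner ℂ e f = g z := by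
  have : CompleteSpace (holomorphicL2 ν) := (isClosed_holomorphicL2 hD hb).completeSpace_coe
  have hrep : ∀ f : holomorphicL2 ν, ∃ g : D → ℂ, IsHolomorphic g ∧ (f : Lp ℂ 2 ν) =ᵐ[ν] g :=
    fun f => f.2
  choose rep hrep hae using hrep
  have hunique : ∀ (f : holomorphicL2 ν) (g : D → ℂ), IsHolomorphic g →
      (f : Lp ℂ 2 ν) =ᵐ[ν] g → rep f = g := fun f g hg hfg =>
    ((hrep f).continuous.ae_eq_iff_eq ν hg.continuous).1 ((hae f).symm.trans hfg)
  let eval : holomorphicL2 ν →ₗ[ℂ] ℂ :=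
    { toFun := fun f => rep f z
      map_add' := fun f g => congrFun (hunique _ _ ((hrep f).add (hrep g))
        ((Lp.coeFn_add _ _).trans ((hae f).add (hae g)))) z
      map_smul' := fun c f => congrFun (hunique _ _ ((hrep f).const_mul c)
        ((Lp.coeFn_smul _ _).trans ((hae f).const_smul c))) z }
  obtain ⟨r, hr, C, -, hC⟩ := hb z
  have hbound : ∀ f, ‖eval f‖ ≤ C * ‖f‖ := fun f =>
    (hC _ (hrep f) ((memLp_congr_ae (hae f)).1 (Lp.memLp _)) z (Metric.mem_ball_self hr)).trans_eq
      (by rw [← eLpNorm_congr_ae (hae f)]; rfl)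
  refine ⟨(InnerProductSpace.toDual ℂ _).symm (eval.mkContinuous C hbound), fun f g hg hfg => ?_⟩
  rw [InnerProductSpace.toDual_symm_apply, ← hunique f g hg hfg]
  rfl

theorem exists_isReproducingKernel [OpensMeasurableSpace V] [ν.IsOpenPosMeasure] (hD : IsOpen D)
    (hb : EvalLocallyBounded ν) : ∃ K, IsReproducingKernel ν K := by
  choose e he using holomorphicL2.exists_inner_eq_apply hD hb
  have hrep : ∀ w, ∃ g : D → ℂ, IsHolomorphic g ∧ (e w : Lp ℂ 2 ν) =ᵐ[ν] g := fun w => (e w).2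
  choose k hk hae using hrep
  have hinner : ∀ z w, inner ℂ (e z) (e w) = k w z := fun z w => he z _ _ (hk w) (hae w)
  have hherm : ∀ z w, k w z = starRingEnd ℂ (k z w) := fun z w => by
    rw [← hinner, ← hinner]
    exact (inner_conj_symm (𝕜 := ℂ) (e z) (e w)).symm
  refine ⟨fun z w => k w z, hk, fun w => (memLp_congr_ae (hae w)).1 (Lp.memLp _), hherm,
    fun f hf hfm z => ?_⟩
  rw [← he z ⟨hfm.toLp f, f, hf, hfm.coeFn_toLp⟩ f hf hfm.coeFn_toLp, Submodule.coe_inner,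
    L2.inner_def]
  refine integral_congr_ae ?_
  filter_upwards [hae z, hfm.coeFn_toLp] with w hkw hfw
  rw [hkw, hfw, hherm z w, RCLike.inner_apply]

namespace IsReproducingKernel

theorem unique {K' : D → D → ℂ} (hK : IsReproducingKernel ν K) (hK' : IsReproducingKernel ν K') :
    K = K' := by
  ext z u
  rw [hK.hermitian z u, hK'.reproducing _ (hK.holomorphic z) (hK.memLp z) u, ← integral_conj,
    hK.reproducing _ (hK'.holomorphic u) (hK'.memLp u) z]
  congr 1
  ext w
  rw [map_mul, ← hK.hermitian, ← hK'.hermitian, mul_comm]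

/-- The class of `K(·, z)` in `L²(ν)`, the Riesz representative of the evaluation at `z`. -/
def toL2 (hK : IsReproducingKernel ν K) (z : D) : Lp ℂ 2 ν :=
  (hK.memLp z).toLp _

theorem inner_toL2 (hK : IsReproducingKernel ν K) {f : D → ℂ} (hf : IsHolomorphic f)
    (hfm : MemLp f 2 ν) (z : D) : inner ℂ (hK.toL2 z) (hfm.toLp f) = f z := by
  rw [hK.reproducing f hf hfm, L2.inner_def]
  refine integral_congr_ae ?_
  filter_upwards [(hK.memLp z).coeFn_toLp, hfm.coeFn_toLp] with w hKw hfw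
  rw [toL2, hKw, hfw, hK.hermitian z w, RCLike.inner_apply]

theorem inner_toL2_toL2 (hK : IsReproducingKernel ν K) (z w : D) :
    inner ℂ (hK.toL2 z) (hK.toL2 w) = K z w :=
  hK.inner_toL2 (hK.holomorphic w) (hK.memLp w) z

theorem sq_norm_toL2 (hK : IsReproducingKernel ν K) (z : D) :
    ((‖hK.toL2 z‖ ^ 2 : ℝ) : ℂ) = K z z := by
  rw [← hK.inner_toL2_toL2, inner_self_eq_norm_sq_to_K]
  simp

theorem norm_self (hK : IsReproducingKernel ν K) (z : D) : ‖K z z‖ = ‖hK.toL2 z‖ ^ 2 := by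
  rw [← hK.sq_norm_toL2, Complex.norm_real, Real.norm_of_nonneg (sq_nonneg _)]

theorem ofReal_norm_self (hK : IsReproducingKernel ν K) (z : D) :
    ((‖K z z‖ : ℝ) : ℂ) = K z z := by
  rw [hK.norm_self, hK.sq_norm_toL2]

theorem norm_le (hK : IsReproducingKernel ν K) (z w : D) :
    ‖K z w‖ ≤ √‖K z z‖ * √‖K w w‖ := by
  rw [hK.norm_self, hK.norm_self, Real.sqrt_sq (norm_nonneg _), Real.sqrt_sq (norm_nonneg _),
    ← hK.inner_toL2_toL2]
  exact norm_inner_le_norm _ _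

theorem self_ne_zero (hK : IsReproducingKernel ν K) {f : D → ℂ} (hf : IsHolomorphic f)
    (hfm : MemLp f 2 ν) {z : D} (hz : f z ≠ 0) : K z z ≠ 0 := by
  rw [← hK.inner_toL2_toL2, Ne, inner_self_eq_zero]
  intro h0
  exact hz (by rw [← hK.inner_toL2 hf hfm z, h0, inner_zero_left])

theorem locally_bounded (hK : IsReproducingKernel ν K) (hb : EvalLocallyBounded ν) (z₀ : D) :
    ∃ r > 0, ∃ M, ∀ z ∈ Metric.ball z₀ r, ∀ w ∈ Metric.ball z₀ r, ‖K z w‖ ≤ M := by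
  obtain ⟨r, hr, C, hC, h⟩ := hb z₀
  have hle : ∀ z ∈ Metric.ball z₀ r, ‖hK.toL2 z‖ ≤ C := by
    intro z hz
    have hself : ‖hK.toL2 z‖ * ‖hK.toL2 z‖ ≤ C * ‖hK.toL2 z‖ := by
      rw [← pow_two, ← hK.norm_self]
      exact (h _ (hK.holomorphic z) (hK.memLp z) z hz).trans_eq (by rw [toL2, Lp.norm_toLp])
    rcases (norm_nonneg (hK.toL2 z)).eq_or_lt with h0 | h0
    · rwa [← h0]
    · exact le_of_mul_le_mul_right hself h0
  refine ⟨r, hr, C * C, fun z hz w hw => ?_⟩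
  rw [← hK.inner_toL2_toL2]
  exact (norm_inner_le_norm _ _).trans (mul_le_mul (hle z hz) (hle w hw) (norm_nonneg _) hC)

theorem continuous_diagonal (hD : IsOpen D) (hK : IsReproducingKernel ν K)
    (hb : EvalLocallyBounded ν) : Continuous fun z => K z z := by
  rw [continuous_iff_continuousAt]
  intro z₀
  obtain ⟨r₁, hr₁, M, hM⟩ := hK.locally_bounded hb z₀
  obtain ⟨r₂, hr₂, hsub⟩ := Metric.isOpen_iff.1 hD z₀ z₀.2
  let r := min r₁ r₂
  have hr : 0 < r := lt_min hr₁ hr₂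
  have hball : Metric.ball z₀ r ⊆ Metric.ball z₀ r₁ := Metric.ball_subset_ball (min_le_left _ _)
  have hlip : ∀ z ∈ Metric.ball z₀ r, ∀ w ∈ Metric.ball z₀ r,
      ‖K z w - K z₀ w‖ ≤ 2 * M / r * dist z z₀ := fun z hz w hw =>
    (hK.holomorphic w).norm_sub_le ((Metric.ball_subset_ball (min_le_right _ _)).trans hsub)
      (fun u hu => hM u (hball hu) w (hball hw)) hz
  have hbound : ∀ z ∈ Metric.ball z₀ r, ‖K z z - K z₀ z₀‖ ≤ 2 * (2 * M / r * dist z z₀) := by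
    intro z hz
    have hsymm : ‖K z₀ z - K z₀ z₀‖ = ‖K z z₀ - K z₀ z₀‖ := by
      rw [← Complex.norm_conj, map_sub, ← hK.hermitian, ← hK.hermitian]
    linarith [norm_sub_le_norm_sub_add_norm_sub (K z z) (K z₀ z) (K z₀ z₀), hlip z hz z hz,
      hlip z hz z₀ (Metric.mem_ball_self hr)]
  have htendsto : Continuous fun z : D => 2 * (2 * M / r * dist z z₀) := by fun_prop
  rw [ContinuousAt, tendsto_iff_norm_sub_tendsto_zero]
  exact squeeze_zero' (Eventually.of_forall fun _ => norm_nonneg _)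
    (Filter.mem_of_superset (Metric.ball_mem_nhds z₀ hr) hbound)
    (by simpa using htendsto.tendsto z₀)

variable [BorelSpace V] {g : D ≃ₜ D} {a : D → ℂ}

theorem reproducing_comp (hK : IsReproducingKernel ν K)
    (hg : IsHolomorphic fun z => (g.symm z : V)) (ha : IsHolomorphic a) (ha0 : ∀ z, a z ≠ 0)
    (hmp : MeasurePreserving g (ν.withDensity fun w => ‖a w‖ₑ ^ 2) ν) {f : D → ℂ}
    (hf : IsHolomorphic f) (hfm : MemLp f 2 ν) (z : D) :
    f z = ∫ w, f w * (K (g z) (g w) * a z * starRingEnd ℂ (a w)) ∂ν := by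
  have hI := integral_sq_norm_smul_comp (E := ℂ) g.measurableEmbedding ha.continuous.measurable hmp
  let h : D → ℂ := fun u => f (g.symm u) * (a (g.symm u))⁻¹
  have hcomp : ∀ u, h (g u) = f u * (a u)⁻¹ := fun u => by simp only [h, g.symm_apply_apply]
  have hhol : IsHolomorphic h := (hf.comp hg).mul ((ha.comp hg).inv fun z => ha0 _)
  have hmem : MemLp h 2 ν := by
    rw [← memLp_two_mul_comp_iff g.measurableEmbedding ha.continuous.measurable hmp
      hhol.continuous.measurable]
    simpa only [hcomp, mul_comm (f _), mul_inv_cancel_left₀ (ha0 _)] using hfm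
  calc f z = a z * h (g z) := by rw [hcomp, mul_comm (f z), mul_inv_cancel_left₀ (ha0 z)]
    _ = a z * ∫ w, (‖a w‖ ^ 2 : ℝ) • (h (g w) * K (g z) (g w)) ∂ν := by
        rw [hI fun w => h w * K (g z) w, ← hK.reproducing h hhol hmem]
    _ = _ := by
        rw [← integral_const_mul]
        refine integral_congr_ae (Eventually.of_forall fun w => ?_)
        have hnorm : ((‖a w‖ ^ 2 : ℝ) : ℂ) = a w * starRingEnd ℂ (a w) := by
          rw [Complex.mul_conj, Complex.normSq_eq_norm_sq]
        simp only [Complex.real_smul, hnorm, hcomp]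
        field_simp [ha0 w]

theorem covariant (hK : IsReproducingKernel ν K) (hg : IsHolomorphic fun z => (g z : V))
    (hg' : IsHolomorphic fun z => (g.symm z : V)) (ha : IsHolomorphic a) (ha0 : ∀ z, a z ≠ 0)
    (hmp : MeasurePreserving g (ν.withDensity fun w => ‖a w‖ₑ ^ 2) ν) (z w : D) :
    K (g z) (g w) * a z * starRingEnd ℂ (a w) = K z w := by
  have hKg : ∀ w, IsHolomorphic fun z => K (g z) (g w) := fun w => (hK.holomorphic (g w)).comp hg
  have htransform : IsReproducingKernel ν fun z w =>
      K (g z) (g w) * a z * starRingEnd ℂ (a w) := by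
    refine ⟨fun w => ((hKg w).mul ha).mul (isHolomorphic_const _), fun w => MemLp.mul_const ?_ _,
      fun z w => ?_, fun f hf hfm => hK.reproducing_comp hg' ha ha0 hmp hf hfm⟩
    · simpa only [mul_comm] using (memLp_two_mul_comp_iff g.measurableEmbedding
        ha.continuous.measurable hmp (hK.holomorphic (g w)).continuous.measurable).2
        (hK.memLp (g w))
    · rw [map_mul, map_mul, ← hK.hermitian, Complex.conj_conj]
      ring
  exact congr_fun₂ (htransform.unique hK) z w

end IsReproducingKernel

end Kernel

section HermitianKernel

variable {V : Type*} [NormedAddCommGroup V] [NormedSpace ℂ V] {D : Set V} {K L : D → D → ℂ}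

/-- A Hermitian kernel on `D` that is holomorphic in the first variable, hence antiholomorphic in
the second, and bounded near each point of the diagonal. -/
structure IsHermitianKernel (K : D → D → ℂ) : Prop where
  holomorphic : ∀ w, IsHolomorphic fun z => K z w
  hermitian : ∀ z w, K z w = starRingEnd ℂ (K w z)
  locally_bounded : ∀ z₀, ∃ r > 0, ∃ M, ∀ z ∈ Metric.ball z₀ r, ∀ w ∈ Metric.ball z₀ r,
    ‖K z w‖ ≤ M

theorem IsReproducingKernel.isHermitianKernel [MeasurableSpace V] {ν : Measure D}
    (hK : IsReproducingKernel ν K) (hb : EvalLocallyBounded ν) : IsHermitianKernel K :=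
  ⟨hK.holomorphic, hK.hermitian, hK.locally_bounded hb⟩

theorem IsHermitianKernel.pow (hK : IsHermitianKernel K) (k : ℕ) :
    IsHermitianKernel fun z w => K z w ^ k := by
  refine ⟨fun w => (hK.holomorphic w).pow k, fun z w => by rw [map_pow, ← hK.hermitian],
    fun z₀ => ?_⟩
  obtain ⟨r, hr, M, hM⟩ := hK.locally_bounded z₀
  refine ⟨r, hr, M ^ k, fun z hz w hw => ?_⟩
  rw [norm_pow]
  exact pow_le_pow_left₀ (norm_nonneg _) (hM z hz w hw) k

theorem IsHermitianKernel.const_mul (hK : IsHermitianKernel K) (a : ℝ) :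
    IsHermitianKernel fun z w => a * K z w := by
  refine ⟨fun w => (hK.holomorphic w).const_mul _, fun z w => by
    rw [map_mul, Complex.conj_ofReal, ← hK.hermitian], fun z₀ => ?_⟩
  obtain ⟨r, hr, M, hM⟩ := hK.locally_bounded z₀
  refine ⟨r, hr, ‖(a : ℂ)‖ * M, fun z hz w hw => ?_⟩
  rw [norm_mul]
  exact mul_le_mul_of_nonneg_left (hM z hz w hw) (norm_nonneg _)

theorem IsHermitianKernel.sub (hK : IsHermitianKernel K) (hL : IsHermitianKernel L) :
    IsHermitianKernel fun z w => K z w - L z w := by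
  refine ⟨fun w => (hK.holomorphic w).sub (hL.holomorphic w), fun z w => by
    rw [map_sub, ← hK.hermitian, ← hL.hermitian], fun z₀ => ?_⟩
  obtain ⟨r₁, hr₁, M₁, hM₁⟩ := hK.locally_bounded z₀
  obtain ⟨r₂, hr₂, M₂, hM₂⟩ := hL.locally_bounded z₀
  refine ⟨min r₁ r₂, lt_min hr₁ hr₂, M₁ + M₂, fun z hz w hw => (norm_sub_le _ _).trans ?_⟩
  simp only [Metric.mem_ball, lt_min_iff] at hz hw
  exact add_le_add (hM₁ z hz.1 w hw.1) (hM₂ z hz.2 w hw.2)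

theorem IsHermitianKernel.eq_zero_of_diagonal (hD : IsOpen D) (hc : IsPreconnected D)
    (hK : IsHermitianKernel K) (hdiag : ∀ z, K z z = 0) (z w : D) : K z w = 0 := by
  let f : V → V → ℂ := fun z w => Function.extend (Subtype.val : D → V)
    (fun z' : D => Function.extend (Subtype.val : D → V) (fun w' : D => K z' w') 0 w) 0 z
  have hf : ∀ z w : D, f z w = K z w := fun z w => by
    simp only [f, extend_val _ z.2, extend_val _ w.2]
  rw [← hf]
  refine eq_zero_of_diagonal_eq_zero hD hc (fun w hw => ?_) (fun z hz => ?_) (fun z hz => ?_)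
    (fun z hz => (hf ⟨z, hz⟩ ⟨z, hz⟩).trans (hdiag _)) z z.2 w w.2
  · refine DifferentiableOn.congr (hK.holomorphic ⟨w, hw⟩) fun z hz => ?_
    rw [extend_val _ hz, hf ⟨z, hz⟩ ⟨w, hw⟩]
  · refine DifferentiableOn.congr (hK.holomorphic ⟨z, hz⟩) fun w hw => ?_
    rw [extend_val _ hw, hf ⟨z, hz⟩ ⟨w, hw⟩, ← hK.hermitian]
  · obtain ⟨r₁, hr₁, M, hM⟩ := hK.locally_bounded ⟨z, hz⟩
    obtain ⟨r₂, hr₂, hsub⟩ := Metric.isOpen_iff.1 hD z hz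
    refine ⟨min r₁ r₂, lt_min hr₁ hr₂, M, fun u hu v hv => ?_⟩
    simp only [Metric.mem_ball, lt_min_iff] at hu hv
    rw [hf ⟨u, hsub hu.2⟩ ⟨v, hsub hv.2⟩]
    exact hM _ hu.1 _ hv.1

theorem IsHermitianKernel.ext_diagonal (hD : IsOpen D) (hc : IsPreconnected D)
    (hK : IsHermitianKernel K) (hL : IsHermitianKernel L) (hdiag : ∀ z, K z z = L z z) : K = L :=
  funext₂ fun z w => sub_eq_zero.1
    ((hK.sub hL).eq_zero_of_diagonal hD hc (fun z => sub_eq_zero.2 (hdiag z)) z w)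

end HermitianKernel

section WeightedVolume

variable {n : ℕ} {D : Set (Fin n → ℂ)} {ω : D → ℝ}

theorem isOpenPosMeasure_euclideanVolume (hD : IsOpen D) :
    (euclideanVolume D).IsOpenPosMeasure := by
  refine ⟨fun U hU hne => ?_⟩
  rw [euclideanVolume, comap_subtype_coe_apply hD.measurableSet]
  exact (hD.isOpenMap_subtype_val U hU).measure_ne_zero _ (hne.image _)

theorem isFiniteMeasure_euclideanVolume (hD : IsOpen D) (hb : Bornology.IsBounded D) :
    IsFiniteMeasure (euclideanVolume D) := by
  refine ⟨?_⟩
  rw [euclideanVolume, comap_subtype_coe_apply hD.measurableSet, Set.image_univ,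
    Subtype.range_coe]
  exact hb.measure_lt_top

/-- Lebesgue measure on `D` with the weight `ω`, which is meant to be nonnegative. -/
def weightedVolume (D : Set (Fin n → ℂ)) (ω : D → ℝ) : Measure D :=
  (euclideanVolume D).withDensity fun w => ENNReal.ofReal (ω w)

theorem weightedVolume_one : weightedVolume D (fun _ => 1) = euclideanVolume D := by
  simp [weightedVolume]

theorem isOpenPosMeasure_weightedVolume (hD : IsOpen D) (hω : Measurable ω)
    (h0 : ∀ w, 0 < ω w) : (weightedVolume D ω).IsOpenPosMeasure := by
  have := isOpenPosMeasure_euclideanVolume hD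
  exact (withDensity_absolutelyContinuous' hω.ennreal_ofReal.aemeasurable
    (Eventually.of_forall fun w => by simpa using h0 w)).isOpenPosMeasure

theorem integral_weightedVolume {E : Type*} [NormedAddCommGroup E] [NormedSpace ℝ E]
    (hω : Measurable ω) (h0 : ∀ w, 0 ≤ ω w) (f : D → E) :
    ∫ w, f w ∂(weightedVolume D ω) = ∫ w, ω w • f w ∂(euclideanVolume D) := by
  rw [weightedVolume, integral_withDensity_eq_integral_toReal_smul hω.ennreal_ofReal
    (Eventually.of_forall fun w => ENNReal.ofReal_lt_top)]
  simp only [ENNReal.toReal_ofReal (h0 _)]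

theorem lintegral_weightedVolume (hω : Measurable ω) (f : D → ENNReal) :
    ∫⁻ w, f w ∂(weightedVolume D ω) = ∫⁻ w, ENNReal.ofReal (ω w) * f w ∂(euclideanVolume D) :=
  lintegral_withDensity_eq_lintegral_mul_non_measurable _ hω.ennreal_ofReal
    (Eventually.of_forall fun _ => ENNReal.ofReal_lt_top) _

theorem memLp_two_weightedVolume_of_le (hω : Measurable ω) (h0 : ∀ w, 0 ≤ ω w) {f : D → ℂ}
    (hf : Measurable f) {b : D → ℝ} (hb : Integrable b (euclideanVolume D))
    (h : ∀ w, ω w * ‖f w‖ ^ 2 ≤ b w) : MemLp f 2 (weightedVolume D ω) := by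
  rw [memLp_two_iff_lintegral hf.aestronglyMeasurable, lintegral_weightedVolume hω]
  refine lt_of_le_of_lt (lintegral_mono fun w => ?_) hb.lintegral_lt_top
  rw [← ofReal_norm, ← ENNReal.ofReal_pow (norm_nonneg _), ← ENNReal.ofReal_mul (h0 w)]
  exact ENNReal.ofReal_le_ofReal (h w)

theorem IsHolomorphic.sq_enorm_mul_le_weighted (hD : IsOpen D) (hω : Measurable ω) {f : D → ℂ}
    (hf : IsHolomorphic f) {z : D} {r c : ℝ} (hr : Metric.ball (z : Fin n → ℂ) r ⊆ D)
    (hc : ∀ w ∈ Metric.ball z r, c ≤ ω w) :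
    ‖f z‖ₑ ^ 2 * (ENNReal.ofReal c * volume (Metric.ball (0 : Fin n → ℂ) r)) ≤
      eLpNorm f 2 (weightedVolume D ω) ^ 2 := by
  calc ‖f z‖ₑ ^ 2 * (ENNReal.ofReal c * volume (Metric.ball (0 : Fin n → ℂ) r))
      = ENNReal.ofReal c * (‖f z‖ₑ ^ 2 * volume (Metric.ball (0 : Fin n → ℂ) r)) := by ring
    _ ≤ ENNReal.ofReal c * ∫⁻ w in Metric.ball z r, ‖f w‖ₑ ^ 2 ∂(euclideanVolume D) :=
        mul_le_mul_right (hf.sq_enorm_mul_le hD hr) _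
    _ = ∫⁻ w in Metric.ball z r, ENNReal.ofReal c * ‖f w‖ₑ ^ 2 ∂(euclideanVolume D) :=
        (lintegral_const_mul' _ _ ENNReal.ofReal_ne_top).symm
    _ ≤ ∫⁻ w in Metric.ball z r, ENNReal.ofReal (ω w) * ‖f w‖ₑ ^ 2 ∂(euclideanVolume D) :=
        setLIntegral_mono' Metric.isOpen_ball.measurableSet fun w hw =>
          mul_le_mul_left (ENNReal.ofReal_le_ofReal (hc w hw)) _
    _ ≤ ∫⁻ w, ENNReal.ofReal (ω w) * ‖f w‖ₑ ^ 2 ∂(euclideanVolume D) :=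
        setLIntegral_le_lintegral _ _
    _ = eLpNorm f 2 (weightedVolume D ω) ^ 2 := by
        rw [eLpNorm_two_sq, lintegral_weightedVolume hω]

theorem IsHolomorphic.norm_le_eLpNorm_weighted (hD : IsOpen D) (hω : Measurable ω) {f : D → ℂ}
    (hf : IsHolomorphic f) (hfm : MemLp f 2 (weightedVolume D ω)) {z : D} {r c : ℝ} (hr0 : 0 < r)
    (hr : Metric.ball (z : Fin n → ℂ) r ⊆ D) (hc0 : 0 < c) (hc : ∀ w ∈ Metric.ball z r, c ≤ ω w) :
    ‖f z‖ ≤ (√(c * volume.real (Metric.ball (0 : Fin n → ℂ) r)))⁻¹ *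
      (eLpNorm f 2 (weightedVolume D ω)).toReal := by
  have hvol : 0 < c * volume.real (Metric.ball (0 : Fin n → ℂ) r) :=
    mul_pos hc0 (ENNReal.toReal_pos (Metric.measure_ball_pos _ _ hr0).ne' measure_ball_lt_top.ne)
  have hsq := ENNReal.toReal_mono (ENNReal.pow_ne_top hfm.2.ne)
    (hf.sq_enorm_mul_le_weighted hD hω hr hc)
  rw [ENNReal.toReal_pow, ENNReal.toReal_mul, ENNReal.toReal_pow, ENNReal.toReal_mul,
    ENNReal.toReal_ofReal hc0.le, toReal_enorm, ← measureReal_def] at hsq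
  rw [inv_mul_eq_div, le_div_iff₀ (Real.sqrt_pos.2 hvol)]
  refine abs_le_of_sq_le_sq' ?_ ENNReal.toReal_nonneg |>.2
  rwa [mul_pow, Real.sq_sqrt hvol.le]

theorem evalLocallyBounded_weightedVolume (hD : IsOpen D) (hω : Continuous ω)
    (h0 : ∀ w, 0 < ω w) : EvalLocallyBounded (weightedVolume D ω) := by
  intro z
  obtain ⟨r₁, hr₁, hsub⟩ := Metric.isOpen_iff.1 hD z z.2
  obtain ⟨r₂, hr₂, hlow⟩ := Metric.eventually_nhds_iff_ball.1
    (hω.continuousAt.eventually_const_lt (half_lt_self (h0 z)))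
  have hr : 0 < min r₁ r₂ / 2 := by positivity
  have hball : ∀ w ∈ Metric.ball z (min r₁ r₂ / 2), min r₁ r₂ / 2 + dist w z ≤ min r₁ r₂ :=
    fun w hw => by linarith [Metric.mem_ball.1 hw]
  refine ⟨min r₁ r₂ / 2, hr, _, inv_nonneg.2 (Real.sqrt_nonneg _), fun f hf hfm w hw =>
    hf.norm_le_eLpNorm_weighted hD hω.measurable hfm hr ?_ (half_pos (h0 z)) fun u hu =>
      (hlow u ?_).le⟩
  · exact (Metric.ball_subset_ball' (ε₂ := r₁) (y := (z : Fin n → ℂ))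
      ((hball w hw).trans (min_le_left _ _))).trans hsub
  · exact Metric.ball_subset_ball' ((hball w hw).trans (min_le_right _ _)) hu

theorem evalLocallyBounded_euclideanVolume (hD : IsOpen D) :
    EvalLocallyBounded (euclideanVolume D) := by
  simpa only [weightedVolume_one] using
    evalLocallyBounded_weightedVolume hD (ω := fun _ => 1) continuous_const fun _ => one_pos

end WeightedVolume

section Bergman

variable {n : ℕ} {D : Set (Fin n → ℂ)}

theorem isReproducingKernel_bergmanKernel (hD : IsOpen D) :
    IsReproducingKernel (euclideanVolume D) (bergmanKernel D) := by
  have := isOpenPosMeasure_euclideanVolume hD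
  obtain ⟨K, hK⟩ := exists_isReproducingKernel hD (evalLocallyBounded_euclideanVolume hD)
  have hexists : ∃ K, IsBergmanKernel D K := ⟨K, hK.1, hK.2, hK.3, hK.4⟩
  have hspec := hexists.choose_spec
  rw [bergmanKernel, dif_pos hexists]
  exact ⟨hspec.1, hspec.2, hspec.3, hspec.4⟩

/-- The square root `K(z, z) ^ (1 / 2)` of the Bergman kernel on the diagonal. -/
def bergmanRoot (D : Set (Fin n → ℂ)) (z : D) : ℝ := √‖bergmanKernel D z z‖

theorem continuous_bergmanRoot (hD : IsOpen D) : Continuous (bergmanRoot D) :=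
  ((isReproducingKernel_bergmanKernel hD).continuous_diagonal hD
    (evalLocallyBounded_euclideanVolume hD)).norm.sqrt

theorem bergmanKernel_self (hD : IsOpen D) (z : D) :
    bergmanKernel D z z = ((bergmanRoot D z ^ 2 : ℝ) : ℂ) := by
  rw [bergmanRoot, Real.sq_sqrt (norm_nonneg _)]
  exact ((isReproducingKernel_bergmanKernel hD).ofReal_norm_self z).symm

theorem bergmanKernel_self_ne_zero (hD : IsOpen D) (hb : Bornology.IsBounded D) (z : D) :
    bergmanKernel D z z ≠ 0 := by
  have := isFiniteMeasure_euclideanVolume hD hb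
  exact (isReproducingKernel_bergmanKernel hD).self_ne_zero (isHolomorphic_const 1)
    (memLp_const 1) one_ne_zero

theorem bergmanRoot_pos (hD : IsOpen D) (hb : Bornology.IsBounded D) (z : D) :
    0 < bergmanRoot D z :=
  Real.sqrt_pos.2 (norm_pos_iff.2 (bergmanKernel_self_ne_zero hD hb z))

theorem norm_bergmanKernel_le (hD : IsOpen D) (z w : D) :
    ‖bergmanKernel D z w‖ ≤ bergmanRoot D z * bergmanRoot D w :=
  (isReproducingKernel_bergmanKernel hD).norm_le z w

theorem integrable_sq_norm_bergmanKernel (hD : IsOpen D) (z : D) :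
    Integrable (fun w => ‖bergmanKernel D w z‖ ^ 2) (euclideanVolume D) :=
  (memLp_two_iff_integrable_sq_norm ((isReproducingKernel_bergmanKernel hD).memLp z).1).1
    ((isReproducingKernel_bergmanKernel hD).memLp z)

theorem bergmanKernel_aut (hD : IsOpen D) {g : D ≃ₜ D} (hg : g ∈ Aut D) (z w : D) :
    bergmanKernel D (g z) (g w) * jac g z * starRingEnd ℂ (jac g w) = bergmanKernel D z w :=
  (isReproducingKernel_bergmanKernel hD).covariant hg.1 hg.2 (isHolomorphic_jac hD hg)
    (jac_ne_zero hD hg) (measurePreserving_aut hD hg) z w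

theorem bergmanRoot_aut (hD : IsOpen D) {g : D ≃ₜ D} (hg : g ∈ Aut D) (z : D) :
    bergmanRoot D (g z) * ‖jac g z‖ = bergmanRoot D z := by
  rw [bergmanRoot, bergmanRoot, ← bergmanKernel_aut hD hg z z, norm_mul, norm_mul,
    Complex.norm_conj, mul_assoc, Real.sqrt_mul (norm_nonneg _), Real.sqrt_mul_self (norm_nonneg _)]

/-- The weight `K(w, w) ^ (-k) K(w, w)`, the density of `K(w, w) ^ (-k) dV(w)` with respect to
Lebesgue measure. -/
def bergmanWeight (D : Set (Fin n → ℂ)) (k : ℕ) (w : D) : ℝ :=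
  bergmanRoot D w ^ 2 / bergmanRoot D w ^ (2 * k)

theorem ofReal_bergmanWeight (hD : IsOpen D) (k : ℕ) (w : D) :
    (bergmanWeight D k w : ℂ) = bergmanKernel D w w / bergmanKernel D w w ^ k := by
  rw [bergmanKernel_self hD, bergmanWeight]
  push_cast
  rw [pow_mul]

theorem continuous_bergmanWeight (hD : IsOpen D) (hb : Bornology.IsBounded D) (k : ℕ) :
    Continuous (bergmanWeight D k) :=
  ((continuous_bergmanRoot hD).pow _).div ((continuous_bergmanRoot hD).pow _) fun w =>
    (pow_pos (bergmanRoot_pos hD hb w) _).ne'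

theorem bergmanWeight_pos (hD : IsOpen D) (hb : Bornology.IsBounded D) (k : ℕ) (w : D) :
    0 < bergmanWeight D k w :=
  div_pos (pow_pos (bergmanRoot_pos hD hb w) _) (pow_pos (bergmanRoot_pos hD hb w) _)

theorem bergmanWeight_aut (hD : IsOpen D) (hb : Bornology.IsBounded D) (k : ℕ) {g : D ≃ₜ D}
    (hg : g ∈ Aut D) (w : D) :
    ‖jac g w‖ ^ (2 * k) * bergmanWeight D k w = ‖jac g w‖ ^ 2 * bergmanWeight D k (g w) := by
  have hroot : 0 < bergmanRoot D (g w) := bergmanRoot_pos hD hb (g w)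
  have hjac : 0 < ‖jac g w‖ := norm_pos_iff.2 (jac_ne_zero hD hg w)
  rw [bergmanWeight, bergmanWeight, ← bergmanRoot_aut hD hg w, mul_pow, mul_pow]
  field_simp

theorem measurePreserving_withDensity_comp {α β : Type*} [MeasurableSpace α] [MeasurableSpace β]
    {μ : Measure α} {ν : Measure β} {g : α → β} (hg : MeasurePreserving g μ ν) {ω : β → ENNReal}
    (hω : Measurable ω) :
    MeasurePreserving g (μ.withDensity fun x => ω (g x)) (ν.withDensity ω) := by
  refine ⟨hg.measurable, Measure.ext fun s hs => ?_⟩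
  rw [Measure.map_apply hg.measurable hs, withDensity_apply _ (hg.measurable hs),
    withDensity_apply _ hs, hg.setLIntegral_comp_preimage hs hω]

theorem ofReal_bergmanWeight_mul_sq_enorm_jac (hD : IsOpen D) (hb : Bornology.IsBounded D) (k : ℕ)
    {g : D ≃ₜ D} (hg : g ∈ Aut D) (w : D) :
    ENNReal.ofReal (bergmanWeight D k w) * ‖jac g w ^ k‖ₑ ^ 2 =
      ‖jac g w‖ₑ ^ 2 * ENNReal.ofReal (bergmanWeight D k (g w)) := by
  rw [← ofReal_norm, ← ofReal_norm, norm_pow, ← ENNReal.ofReal_pow (by positivity),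
    ← ENNReal.ofReal_pow (by positivity), ← ENNReal.ofReal_mul (bergmanWeight_pos hD hb k w).le,
    ← ENNReal.ofReal_mul (by positivity), ← bergmanWeight_aut hD hb k hg, ← pow_mul, mul_comm k,
    mul_comm]

theorem weightedVolume_withDensity_jac (hD : IsOpen D) (hb : Bornology.IsBounded D) (k : ℕ)
    {g : D ≃ₜ D} (hg : g ∈ Aut D) :
    (weightedVolume D (bergmanWeight D k)).withDensity (fun w => ‖jac g w ^ k‖ₑ ^ 2) =
      ((euclideanVolume D).withDensity fun w => ‖jac g w‖ₑ ^ 2).withDensity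
        fun w => ENNReal.ofReal (bergmanWeight D k (g w)) := by
  have hω : Measurable (bergmanWeight D k) := (continuous_bergmanWeight hD hb k).measurable
  have hωg : Measurable fun w => bergmanWeight D k (g w) := hω.comp g.continuous.measurable
  have hj : Measurable (jac g) := (isHolomorphic_jac hD hg).continuous.measurable
  rw [weightedVolume, ← withDensity_mul _ hω.ennreal_ofReal ((hj.pow_const k).enorm.pow_const 2),
    ← withDensity_mul _ (hj.enorm.pow_const 2) hωg.ennreal_ofReal]
  refine congrArg (euclideanVolume D).withDensity (funext fun w => ?_)
  exact ofReal_bergmanWeight_mul_sq_enorm_jac hD hb k hg w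

theorem measurePreserving_aut_weightedVolume (hD : IsOpen D) (hb : Bornology.IsBounded D) (k : ℕ)
    {g : D ≃ₜ D} (hg : g ∈ Aut D) :
    MeasurePreserving g
      ((weightedVolume D (bergmanWeight D k)).withDensity fun w => ‖jac g w ^ k‖ₑ ^ 2)
      (weightedVolume D (bergmanWeight D k)) := by
  rw [weightedVolume_withDensity_jac hD hb k hg, weightedVolume]
  exact measurePreserving_withDensity_comp (ω := fun w => ENNReal.ofReal (bergmanWeight D k w))
    (measurePreserving_aut hD hg) (continuous_bergmanWeight hD hb k).measurable.ennreal_ofReal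

theorem memLp_bergmanKernel_pow (hD : IsOpen D) (hb : Bornology.IsBounded D) {k : ℕ} (hk : 1 ≤ k)
    (z : D) :
    MemLp (fun w => bergmanKernel D w z ^ k) 2 (weightedVolume D (bergmanWeight D k)) := by
  obtain ⟨l, rfl⟩ := Nat.exists_eq_add_of_le hk
  refine memLp_two_weightedVolume_of_le (continuous_bergmanWeight hD hb _).measurable
    (fun w => (bergmanWeight_pos hD hb _ w).le)
    (((isReproducingKernel_bergmanKernel hD).holomorphic z).pow _).continuous.measurable
    ((integrable_sq_norm_bergmanKernel hD z).const_mul (bergmanRoot D z ^ (2 * l))) fun w => ?_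
  have hroot : 0 < bergmanRoot D w := bergmanRoot_pos hD hb w
  rw [bergmanWeight, norm_pow, div_mul_eq_mul_div, div_le_iff₀ (by positivity)]
  calc bergmanRoot D w ^ 2 * (‖bergmanKernel D w z‖ ^ (1 + l)) ^ 2
      = bergmanRoot D w ^ 2 * ‖bergmanKernel D w z‖ ^ 2 * ‖bergmanKernel D w z‖ ^ (2 * l) := by
        ring
    _ ≤ bergmanRoot D w ^ 2 * ‖bergmanKernel D w z‖ ^ 2 *
          (bergmanRoot D w * bergmanRoot D z) ^ (2 * l) := by
        gcongr
        exact norm_bergmanKernel_le hD w z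
    _ = _ := by ring

end Bergman

section WeightConst

variable {n : ℕ} {D : Set (Fin n → ℂ)}

/-- Bounded domains on which `Aut(D)` acts transitively. -/
structure IsBoundedHomogeneousDomain (D : Set (Fin n → ℂ)) : Prop where
  isOpen : IsOpen D
  isConnected : IsConnected D
  isBounded : Bornology.IsBounded D
  transitive : ∀ p q : D, ∃ g ∈ Aut D, g p = q

theorem IsBoundedSymmetricDomain.isBoundedHomogeneousDomain (hD : IsBoundedSymmetricDomain D) :
    IsBoundedHomogeneousDomain D :=
  ⟨hD.isOpen, hD.isConnected, hD.isBounded, hD.transitive⟩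

theorem exists_diagonal_eq_mul_pow (hD : IsBoundedHomogeneousDomain D) {k : ℕ} {L : D → D → ℂ}
    (hL : IsReproducingKernel (weightedVolume D (bergmanWeight D k)) L) :
    ∃ a : ℝ, ∀ z, L z z = a * bergmanKernel D z z ^ k := by
  obtain ⟨p⟩ := hD.isConnected.nonempty.to_subtype
  refine ⟨‖L p p‖ / bergmanRoot D p ^ (2 * k), fun z => ?_⟩
  obtain ⟨g, hg, rfl⟩ := hD.transitive p z
  have hcov := hL.covariant hg.1 hg.2 ((isHolomorphic_jac hD.isOpen hg).pow k)
    (fun z => pow_ne_zero _ (jac_ne_zero hD.isOpen hg z))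
    (measurePreserving_aut_weightedVolume hD.isOpen hD.isBounded k hg) p p
  have hK := bergmanKernel_aut hD.isOpen hg p p
  have hj : jac g p ≠ 0 := jac_ne_zero hD.isOpen hg p
  have hj' : starRingEnd ℂ (jac g p) ≠ 0 := by simpa using hj
  have hK0 := bergmanKernel_self_ne_zero hD.isOpen hD.isBounded (g p)
  have hself : ((bergmanRoot D p ^ (2 * k) : ℝ) : ℂ) = bergmanKernel D p p ^ k := by
    rw [bergmanKernel_self hD.isOpen, pow_mul, Complex.ofReal_pow]
  rw [Complex.ofReal_div, hL.ofReal_norm_self, hself, ← hcov, ← hK, map_pow, mul_pow, mul_pow]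
  field_simp

theorem exists_isReproducingKernel_pow (hD : IsBoundedHomogeneousDomain D) (k : ℕ) :
    ∃ a : ℝ, IsReproducingKernel (weightedVolume D (bergmanWeight D k))
      fun z w => a * bergmanKernel D z w ^ k := by
  have hω := continuous_bergmanWeight hD.isOpen hD.isBounded k
  have hω0 := bergmanWeight_pos hD.isOpen hD.isBounded k
  have := isOpenPosMeasure_weightedVolume hD.isOpen hω.measurable hω0
  have heval := evalLocallyBounded_weightedVolume hD.isOpen hω hω0
  obtain ⟨L, hL⟩ := exists_isReproducingKernel hD.isOpen heval
  obtain ⟨a, ha⟩ := exists_diagonal_eq_mul_pow hD hL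
  have hK := (isReproducingKernel_bergmanKernel hD.isOpen).isHermitianKernel
    (evalLocallyBounded_euclideanVolume hD.isOpen)
  exact ⟨a, (hL.isHermitianKernel heval).ext_diagonal hD.isOpen hD.isConnected.isPreconnected
    ((hK.pow k).const_mul a) ha ▸ hL⟩

theorem isWeightConst_of_isReproducingKernel (hD : IsOpen D) (hb : Bornology.IsBounded D) {k : ℕ}
    (hk : 1 ≤ k) {a : ℂ} (ha : IsReproducingKernel (weightedVolume D (bergmanWeight D k))
      fun z w => a * bergmanKernel D z w ^ k) : IsWeightConst D k a := by
  intro z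
  rw [ha.reproducing _ (((isReproducingKernel_bergmanKernel hD).holomorphic z).pow k)
    (memLp_bergmanKernel_pow hD hb hk z) z, integral_weightedVolume
    (continuous_bergmanWeight hD hb k).measurable fun w => (bergmanWeight_pos hD hb k w).le,
    ← integral_const_mul]
  refine integral_congr_ae (Eventually.of_forall fun w => ?_)
  simp only [Complex.real_smul, ofReal_bergmanWeight hD]
  ring

theorem IsWeightConst.ne_zero (hD : IsBoundedHomogeneousDomain D) {k : ℕ} {c : ℂ}
    (hc : IsWeightConst D k c) : c ≠ 0 := by
  rintro rfl
  obtain ⟨p⟩ := hD.isConnected.nonempty.to_subtype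
  have hp := hc p
  rw [zero_mul] at hp
  exact pow_ne_zero k (bergmanKernel_self_ne_zero hD.isOpen hD.isBounded p) hp.symm

theorem IsWeightConst.unique (hD : IsBoundedHomogeneousDomain D) {k : ℕ} {c c' : ℂ}
    (hc : IsWeightConst D k c) (hc' : IsWeightConst D k c') : c = c' := by
  obtain ⟨p⟩ := hD.isConnected.nonempty.to_subtype
  refine mul_right_cancel₀ (fun h0 => ?_) ((hc p).trans (hc' p).symm)
  have hp := hc p
  rw [h0, mul_zero] at hp
  exact pow_ne_zero k (bergmanKernel_self_ne_zero hD.isOpen hD.isBounded p) hp.symm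

theorem isWeightConst_weightConst (hD : IsBoundedHomogeneousDomain D) {k : ℕ} (hk : 1 ≤ k) :
    IsWeightConst D k (weightConst D k) := by
  obtain ⟨a, ha⟩ := exists_isReproducingKernel_pow hD k
  have hexists : ∃ c, IsWeightConst D k c :=
    ⟨a, isWeightConst_of_isReproducingKernel hD.isOpen hD.isBounded hk ha⟩
  rw [weightConst, dif_pos hexists]
  exact hexists.choose_spec

theorem weightConst_ne_zero (hD : IsBoundedHomogeneousDomain D) {k : ℕ} (hk : 1 ≤ k) :
    weightConst D k ≠ 0 :=
  (isWeightConst_weightConst hD hk).ne_zero hD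

theorem isReproducingKernel_weightConst (hD : IsBoundedHomogeneousDomain D) {k : ℕ} (hk : 1 ≤ k) :
    IsReproducingKernel (weightedVolume D (bergmanWeight D k))
      fun z w => weightConst D k * bergmanKernel D z w ^ k := by
  obtain ⟨a, ha⟩ := exists_isReproducingKernel_pow hD k
  rwa [(isWeightConst_weightConst hD hk).unique hD
    (isWeightConst_of_isReproducingKernel hD.isOpen hD.isBounded hk ha)]

end WeightConst

section Moments

variable {α : Type*} [MeasurableSpace α] {μ : Measure α} {g : α → ℂ} {b : α → ℝ}

theorem integrable_pow_mul_one_sub_pow_mul (hg : Integrable g μ) (hb : Measurable b)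
    (hb0 : ∀ x, 0 ≤ b x) (hb1 : ∀ x, b x ≤ 1) (l N : ℕ) :
    Integrable (fun x => ((b x ^ l * (1 - b x) ^ N : ℝ) : ℂ) * g x) μ := by
  refine hg.bdd_mul (c := 1) (Complex.measurable_ofReal.comp
    ((hb.pow_const l).mul ((measurable_const.sub hb).pow_const N))).aestronglyMeasurable
    (Eventually.of_forall fun x => ?_)
  have h0 : 0 ≤ b x := hb0 x
  have h1 : 0 ≤ 1 - b x := by linarith [hb1 x]
  rw [Complex.norm_real, Real.norm_of_nonneg (by positivity)]
  exact mul_le_one₀ (pow_le_one₀ h0 (hb1 x)) (by positivity) (pow_le_one₀ h1 (by linarith))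

theorem integral_pow_mul_one_sub_pow_succ_mul (hg : Integrable g μ) (hb : Measurable b)
    (hb0 : ∀ x, 0 ≤ b x) (hb1 : ∀ x, b x ≤ 1) (l N : ℕ) :
    ∫ x, ((b x ^ l * (1 - b x) ^ (N + 1) : ℝ) : ℂ) * g x ∂μ =
      ∫ x, ((b x ^ l * (1 - b x) ^ N : ℝ) : ℂ) * g x ∂μ -
        ∫ x, ((b x ^ (l + 1) * (1 - b x) ^ N : ℝ) : ℂ) * g x ∂μ := by
  have hint := integrable_pow_mul_one_sub_pow_mul hg hb hb0 hb1
  rw [← integral_sub (hint l N) (hint (l + 1) N)]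
  refine integral_congr_ae (Eventually.of_forall fun x => ?_)
  push_cast
  ring

theorem integral_pow_mul_one_sub_pow_mul_eq_zero (hg : Integrable g μ) (hb : Measurable b)
    (hb0 : ∀ x, 0 ≤ b x) (hb1 : ∀ x, b x ≤ 1)
    (hmom : ∀ l : ℕ, 1 ≤ l → ∫ x, ((b x ^ l : ℝ) : ℂ) * g x ∂μ = 0) (N : ℕ) {l : ℕ} (hl : 1 ≤ l) :
    ∫ x, ((b x ^ l * (1 - b x) ^ N : ℝ) : ℂ) * g x ∂μ = 0 := by
  induction N generalizing l with
  | zero => simpa using hmom l hl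
  | succ N ih =>
    rw [integral_pow_mul_one_sub_pow_succ_mul hg hb hb0 hb1, ih hl, ih (by omega), sub_zero]

theorem integral_one_sub_pow_mul_eq_integral (hg : Integrable g μ) (hb : Measurable b)
    (hb0 : ∀ x, 0 ≤ b x) (hb1 : ∀ x, b x ≤ 1)
    (hmom : ∀ l : ℕ, 1 ≤ l → ∫ x, ((b x ^ l : ℝ) : ℂ) * g x ∂μ = 0) (N : ℕ) :
    ∫ x, (((1 - b x) ^ N : ℝ) : ℂ) * g x ∂μ = ∫ x, g x ∂μ := by
  induction N with
  | zero => simp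
  | succ N ih =>
    have h := integral_pow_mul_one_sub_pow_succ_mul hg hb hb0 hb1 0 N
    rw [integral_pow_mul_one_sub_pow_mul_eq_zero hg hb hb0 hb1 hmom N le_rfl, sub_zero] at h
    simpa only [pow_zero, one_mul, ih] using h

theorem tendsto_integral_one_sub_pow_mul (hg : Integrable g μ) (hb : Measurable b)
    (hb0 : ∀ x, 0 ≤ b x) (hb1 : ∀ x, b x ≤ 1) (hz : ∀ x, b x = 0 → g x = 0) :
    Tendsto (fun N : ℕ => ∫ x, (((1 - b x) ^ N : ℝ) : ℂ) * g x ∂μ) atTop (𝓝 0) := by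
  rw [← integral_zero α ℂ (μ := μ)]
  refine tendsto_integral_of_dominated_convergence (fun x => ‖g x‖) (fun N => ?_) hg.norm
    (fun N => Eventually.of_forall fun x => ?_) (Eventually.of_forall fun x => ?_)
  · simpa using (integrable_pow_mul_one_sub_pow_mul hg hb hb0 hb1 0 N).1
  · have h1 : 0 ≤ 1 - b x := by linarith [hb1 x]
    rw [norm_mul, Complex.norm_real, Real.norm_of_nonneg (by positivity)]
    exact mul_le_of_le_one_left (norm_nonneg _) (pow_le_one₀ h1 (by linarith [hb0 x]))
  · rcases (hb0 x).eq_or_lt with h | h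
    · simp [hz x h.symm]
    · have hpow := tendsto_pow_atTop_nhds_zero_of_lt_one (r := 1 - b x) (by linarith [hb1 x])
        (by linarith)
      simpa using ((Complex.continuous_ofReal.tendsto 0).comp hpow).mul_const (g x)

theorem integral_eq_zero_of_moments (hg : Integrable g μ) (hb : Measurable b)
    (hb0 : ∀ x, 0 ≤ b x) (hb1 : ∀ x, b x ≤ 1) (hz : ∀ x, b x = 0 → g x = 0)
    (hmom : ∀ l : ℕ, 1 ≤ l → ∫ x, ((b x ^ l : ℝ) : ℂ) * g x ∂μ = 0) : ∫ x, g x ∂μ = 0 := by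
  have h := tendsto_integral_one_sub_pow_mul hg hb hb0 hb1 hz
  simp only [integral_one_sub_pow_mul_eq_integral hg hb hb0 hb1 hmom] at h
  exact tendsto_nhds_unique tendsto_const_nhds h

end Moments

section Reproducing

variable {n : ℕ} {D : Set (Fin n → ℂ)}

theorem bergmanKernel_symm (hD : IsOpen D) (z w : D) :
    bergmanKernel D z w = starRingEnd ℂ (bergmanKernel D w z) :=
  (isReproducingKernel_bergmanKernel hD).hermitian z w

theorem norm_bergmanKernel_symm (hD : IsOpen D) (z w : D) :
    ‖bergmanKernel D z w‖ = ‖bergmanKernel D w z‖ := by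
  rw [bergmanKernel_symm hD, Complex.norm_conj]

theorem isHolomorphic_bergmanKernel (hD : IsOpen D) (w : D) :
    IsHolomorphic fun z => bergmanKernel D z w :=
  (isReproducingKernel_bergmanKernel hD).holomorphic w

theorem continuous_bergmanKernel_right (hD : IsOpen D) (z : D) :
    Continuous fun w => bergmanKernel D z w := by
  simp only [bergmanKernel_symm hD z]
  exact Complex.continuous_conj.comp (isHolomorphic_bergmanKernel hD z).continuous

theorem norm_bergmanKernel_pow_le (hD : IsOpen D) (k : ℕ) (z w : D) :
    ‖bergmanKernel D z w ^ k‖ ≤ bergmanRoot D z ^ k * bergmanRoot D w ^ k := by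
  rw [norm_pow, ← mul_pow]
  exact pow_le_pow_left₀ (norm_nonneg _) (norm_bergmanKernel_le hD z w) k

theorem bergmanRoot_pow_mul_bergmanWeight_le (hD : IsOpen D) (hb : Bornology.IsBounded D) {k : ℕ}
    (hk : 2 ≤ k) (z w : D) :
    bergmanRoot D w ^ k * ‖bergmanKernel D w z ^ k‖ * bergmanWeight D k w ≤
      bergmanRoot D z ^ (k - 2) * ‖bergmanKernel D w z‖ ^ 2 := by
  obtain ⟨l, rfl⟩ := Nat.exists_eq_add_of_le hk
  have hw : 0 < bergmanRoot D w := bergmanRoot_pos hD hb w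
  rw [bergmanWeight, mul_div_assoc', div_le_iff₀ (by positivity), Nat.add_sub_cancel_left,
    pow_add (bergmanKernel D w z), norm_mul, norm_pow _ 2]
  calc bergmanRoot D w ^ (2 + l) * (‖bergmanKernel D w z‖ ^ 2 * ‖bergmanKernel D w z ^ l‖) *
        bergmanRoot D w ^ 2
      ≤ bergmanRoot D w ^ (2 + l) * (‖bergmanKernel D w z‖ ^ 2 *
          (bergmanRoot D w ^ l * bergmanRoot D z ^ l)) * bergmanRoot D w ^ 2 := by
        gcongr
        exact norm_bergmanKernel_pow_le hD l w z
    _ = _ := by ring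

theorem integrable_mul_bergmanKernel_pow (hD : IsOpen D) (hb : Bornology.IsBounded D) {k : ℕ}
    (hk : 2 ≤ k) {H : D → ℂ} (hH : Continuous H) {C : ℝ}
    (hC : ∀ w, ‖H w‖ ≤ C * bergmanRoot D w ^ k) (z : D) :
    Integrable (fun w => (bergmanWeight D k w : ℂ) * (H w * bergmanKernel D z w ^ k))
      (euclideanVolume D) := by
  have hC0 : 0 ≤ C := nonneg_of_mul_nonneg_left ((norm_nonneg _).trans (hC z))
    (pow_pos (bergmanRoot_pos hD hb z) k)
  refine ((integrable_sq_norm_bergmanKernel hD z).const_mul (C * bergmanRoot D z ^ (k - 2))).mono'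
    ((Complex.continuous_ofReal.comp (continuous_bergmanWeight hD hb k)).mul
      (hH.mul ((continuous_bergmanKernel_right hD z).pow k))).aestronglyMeasurable
    (Eventually.of_forall fun w => ?_)
  have hw : 0 ≤ bergmanWeight D k w := (bergmanWeight_pos hD hb k w).le
  rw [norm_mul, norm_mul, Complex.norm_real, Real.norm_of_nonneg hw, norm_pow,
    norm_bergmanKernel_symm hD z w, ← norm_pow]
  calc bergmanWeight D k w * (‖H w‖ * ‖bergmanKernel D w z ^ k‖)
      ≤ bergmanWeight D k w * (C * bergmanRoot D w ^ k * ‖bergmanKernel D w z ^ k‖) := by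
        gcongr
        exact hC w
    _ = C * (bergmanRoot D w ^ k * ‖bergmanKernel D w z ^ k‖ * bergmanWeight D k w) := by ring
    _ ≤ C * (bergmanRoot D z ^ (k - 2) * ‖bergmanKernel D w z‖ ^ 2) :=
        mul_le_mul_of_nonneg_left (bergmanRoot_pow_mul_bergmanWeight_le hD hb hk z w) hC0
    _ = _ := by ring

/-- The biholomorphically invariant quantity `|K(z, w)|² / (K(z, z) K(w, w))`. -/
def berezin (D : Set (Fin n → ℂ)) (z w : D) : ℝ :=
  ‖bergmanKernel D z w‖ ^ 2 / (bergmanRoot D z ^ 2 * bergmanRoot D w ^ 2)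

theorem continuous_berezin (hD : IsOpen D) (hb : Bornology.IsBounded D) (z : D) :
    Continuous (berezin D z) :=
  ((continuous_bergmanKernel_right hD z).norm.pow 2).div
    (continuous_const.mul ((continuous_bergmanRoot hD).pow 2)) fun w =>
      (mul_pos (pow_pos (bergmanRoot_pos hD hb z) 2) (pow_pos (bergmanRoot_pos hD hb w) 2)).ne'

theorem berezin_nonneg (z w : D) : 0 ≤ berezin D z w := by
  unfold berezin
  positivity

theorem berezin_le_one (hD : IsOpen D) (z w : D) : berezin D z w ≤ 1 := by
  refine div_le_one_of_le₀ ?_ (by positivity)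
  rw [← mul_pow]
  exact pow_le_pow_left₀ (norm_nonneg _) (norm_bergmanKernel_le hD z w) 2

theorem berezin_eq_zero_iff (hD : IsOpen D) (hb : Bornology.IsBounded D) {z w : D} :
    berezin D z w = 0 ↔ bergmanKernel D z w = 0 := by
  simp [berezin, (bergmanRoot_pos hD hb z).ne', (bergmanRoot_pos hD hb w).ne']

theorem ofReal_berezin_mul (hD : IsOpen D) (hb : Bornology.IsBounded D) (z w : D) :
    (berezin D z w : ℂ) * ((bergmanRoot D z : ℂ) ^ 2 * (bergmanRoot D w : ℂ) ^ 2) =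
      bergmanKernel D w z * bergmanKernel D z w := by
  have hz : (bergmanRoot D z : ℂ) ≠ 0 := Complex.ofReal_ne_zero.2 (bergmanRoot_pos hD hb z).ne'
  have hw : (bergmanRoot D w : ℂ) ≠ 0 := Complex.ofReal_ne_zero.2 (bergmanRoot_pos hD hb w).ne'
  rw [bergmanKernel_symm hD w z, mul_comm (starRingEnd ℂ _), Complex.mul_conj,
    Complex.normSq_eq_norm_sq, berezin]
  push_cast
  field_simp

theorem memLp_mul_bergmanKernel_pow (hD : IsOpen D) (hb : Bornology.IsBounded D) {k l : ℕ}
    (hl : 1 ≤ l) {H : D → ℂ} (hH : Continuous H) {C : ℝ}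
    (hC : ∀ w, ‖H w‖ ≤ C * bergmanRoot D w ^ k) (z : D) :
    MemLp (fun w => H w * bergmanKernel D w z ^ l) 2
      (weightedVolume D (bergmanWeight D (k + l))) := by
  obtain ⟨q, rfl⟩ := Nat.exists_eq_add_of_le hl
  refine memLp_two_weightedVolume_of_le (continuous_bergmanWeight hD hb _).measurable
    (fun w => (bergmanWeight_pos hD hb _ w).le)
    (hH.mul ((isHolomorphic_bergmanKernel hD z).pow _).continuous).measurable
    ((integrable_sq_norm_bergmanKernel hD z).const_mul (C ^ 2 * bergmanRoot D z ^ (2 * q)))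
    fun w => ?_
  have hw : 0 < bergmanRoot D w := bergmanRoot_pos hD hb w
  have hCw : 0 ≤ C * bergmanRoot D w ^ k := (norm_nonneg _).trans (hC w)
  rw [bergmanWeight, norm_mul, div_mul_eq_mul_div, div_le_iff₀ (by positivity), pow_add, norm_mul,
    pow_one]
  calc bergmanRoot D w ^ 2 * (‖H w‖ * (‖bergmanKernel D w z‖ * ‖bergmanKernel D w z ^ q‖)) ^ 2
      ≤ bergmanRoot D w ^ 2 * (C * bergmanRoot D w ^ k * (‖bergmanKernel D w z‖ *
          (bergmanRoot D w ^ q * bergmanRoot D z ^ q))) ^ 2 := by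
        gcongr
        exacts [hC w, norm_bergmanKernel_pow_le hD q w z]
    _ = _ := by ring

theorem integral_berezin_pow_mul_eq_zero (hD : IsBoundedHomogeneousDomain D) {k l : ℕ}
    (hl : 1 ≤ l) {H : D → ℂ} (hH : IsHolomorphic H) {C : ℝ}
    (hC : ∀ w, ‖H w‖ ≤ C * bergmanRoot D w ^ k) {z : D} (hz : H z = 0) :
    ∫ w, ((berezin D z w ^ l : ℝ) : ℂ) *
      ((bergmanWeight D k w : ℂ) * (H w * bergmanKernel D z w ^ k)) ∂(euclideanVolume D) = 0 := by
  have hroot := bergmanRoot_pos hD.isOpen hD.isBounded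
  have hz0 : (bergmanRoot D z : ℂ) ≠ 0 := Complex.ofReal_ne_zero.2 (hroot z).ne'
  have hrep := (isReproducingKernel_weightConst hD (hl.trans (Nat.le_add_left l k))).reproducing _
    (hH.mul ((isHolomorphic_bergmanKernel hD.isOpen z).pow l))
    (memLp_mul_bergmanKernel_pow hD.isOpen hD.isBounded hl hH.continuous hC z) z
  rw [hz, zero_mul, integral_weightedVolume
    (continuous_bergmanWeight hD.isOpen hD.isBounded _).measurable
    fun w => (bergmanWeight_pos hD.isOpen hD.isBounded _ w).le] at hrep
  have hintegrand : ∀ w, bergmanWeight D (k + l) w • (H w * bergmanKernel D w z ^ l *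
      (weightConst D (k + l) * bergmanKernel D z w ^ (k + l))) =
      (weightConst D (k + l) * (bergmanRoot D z : ℂ) ^ (2 * l)) * (((berezin D z w ^ l : ℝ) : ℂ) *
        ((bergmanWeight D k w : ℂ) * (H w * bergmanKernel D z w ^ k))) := by
    intro w
    have hw0 : (bergmanRoot D w : ℂ) ≠ 0 := Complex.ofReal_ne_zero.2 (hroot w).ne'
    have hpow := congrArg (· ^ l) (ofReal_berezin_mul hD.isOpen hD.isBounded z w)
    simp only [mul_pow, ← pow_mul] at hpow
    rw [Complex.real_smul, bergmanWeight, bergmanWeight, pow_add, mul_add, pow_add]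
    push_cast
    field_simp
    linear_combination (-(H w * bergmanKernel D z w ^ k * weightConst D (k + l))) * hpow
  simp only [hintegrand, integral_const_mul] at hrep
  exact (mul_eq_zero.1 hrep.symm).resolve_left (mul_ne_zero
    (weightConst_ne_zero hD (hl.trans (Nat.le_add_left l k))) (pow_ne_zero _ hz0))

theorem integral_eq_zero_of_apply_eq_zero (hD : IsBoundedHomogeneousDomain D) {k : ℕ}
    (hk : 2 ≤ k) {H : D → ℂ} (hH : IsHolomorphic H) {C : ℝ}
    (hC : ∀ w, ‖H w‖ ≤ C * bergmanRoot D w ^ k) {z : D} (hz : H z = 0) :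
    ∫ w, (bergmanWeight D k w : ℂ) * (H w * bergmanKernel D z w ^ k) ∂(euclideanVolume D) = 0 := by
  refine integral_eq_zero_of_moments
    (integrable_mul_bergmanKernel_pow hD.isOpen hD.isBounded hk hH.continuous hC z)
    (continuous_berezin hD.isOpen hD.isBounded z).measurable (berezin_nonneg z)
    (berezin_le_one hD.isOpen z) (fun w hw => ?_)
    fun l hl => integral_berezin_pow_mul_eq_zero hD hl hH hC hz
  rw [(berezin_eq_zero_iff hD.isOpen hD.isBounded).1 hw, zero_pow (by omega), mul_zero, mul_zero]

theorem bergmanKernel_self_pow_eq_integral (hD : IsBoundedHomogeneousDomain D) {k : ℕ}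
    (hk : 1 ≤ k) (z : D) :
    bergmanKernel D z z ^ k = weightConst D k * ∫ w, (bergmanWeight D k w : ℂ) *
      (bergmanKernel D w z ^ k * bergmanKernel D z w ^ k) ∂(euclideanVolume D) := by
  rw [← isWeightConst_weightConst hD hk z]
  congr 1
  refine integral_congr_ae (Eventually.of_forall fun w => ?_)
  simp only [ofReal_bergmanWeight hD.isOpen]
  ring

theorem eq_weightConst_mul_integral (hD : IsBoundedHomogeneousDomain D) {k : ℕ}
    (hk : 2 ≤ k) {H : D → ℂ} (hH : IsHolomorphic H) {C : ℝ}
    (hC : ∀ w, ‖H w‖ ≤ C * bergmanRoot D w ^ k) (z : D) :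
    H z = weightConst D k *
      ∫ w, (bergmanWeight D k w : ℂ) * (H w * bergmanKernel D z w ^ k) ∂(euclideanVolume D) := by
  have hKh : IsHolomorphic fun w => bergmanKernel D w z ^ k :=
    (isHolomorphic_bergmanKernel hD.isOpen z).pow k
  have hKC : ∀ w, ‖bergmanKernel D w z ^ k‖ ≤ bergmanRoot D z ^ k * bergmanRoot D w ^ k :=
    fun w => (norm_bergmanKernel_pow_le hD.isOpen k w z).trans_eq (mul_comm _ _)
  have hKz : bergmanKernel D z z ^ k ≠ 0 :=
    pow_ne_zero _ (bergmanKernel_self_ne_zero hD.isOpen hD.isBounded z)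
  have hvanish := integral_eq_zero_of_apply_eq_zero hD hk (z := z)
    (H := fun w => bergmanKernel D z z ^ k * H w - H z * bergmanKernel D w z ^ k)
    ((hH.const_mul _).sub (hKh.const_mul _))
    (C := ‖bergmanKernel D z z ^ k‖ * C + ‖H z‖ * bergmanRoot D z ^ k) (fun w => by
      refine (norm_sub_le _ _).trans ?_
      rw [norm_mul, norm_mul, add_mul, mul_assoc, mul_assoc]
      gcongr
      exacts [hC w, hKC w]) (by ring)
  have hint {H : D → ℂ} := integrable_mul_bergmanKernel_pow hD.isOpen hD.isBounded hk (H := H)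
  simp only [sub_mul, mul_sub, mul_assoc,
    mul_left_comm (bergmanWeight D k _ : ℂ) (bergmanKernel D z z ^ k),
    mul_left_comm (bergmanWeight D k _ : ℂ) (H z)] at hvanish
  rw [integral_sub ((hint hH.continuous hC z).const_mul _)
    ((hint hKh.continuous hKC z).const_mul _), integral_const_mul, integral_const_mul,
    sub_eq_zero] at hvanish
  refine mul_left_cancel₀ hKz ?_
  rw [mul_left_comm, hvanish, mul_left_comm,
    ← bergmanKernel_self_pow_eq_integral hD (by omega), mul_comm]

end Reproducing

section ProperDiscontinuity

variable {n : ℕ} {D : Set (Fin n → ℂ)}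

/-- The Carathéodory-type pseudodistance of `z` and `w`, given by the holomorphic maps into the unit
disc, is at most `ε`. Unlike the Euclidean distance it is invariant under automorphisms. -/
def Near (ε : ℝ) (z w : D) : Prop :=
  ∀ f : D → ℂ, IsHolomorphic f → (∀ u, ‖f u‖ ≤ 1) → ‖f z - f w‖ ≤ ε

namespace Near

variable {ε δ : ℝ} {z w u : D}

theorem symm (h : Near ε z w) : Near ε w z := fun f hf hf1 => by
  rw [norm_sub_rev]; exact h f hf hf1

theorem trans (h : Near ε z w) (h' : Near δ w u) : Near (ε + δ) z u := fun f hf hf1 =>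
  (norm_sub_le_norm_sub_add_norm_sub (f z) (f w) (f u)).trans
    (add_le_add (h f hf hf1) (h' f hf hf1))

theorem mono (h : Near ε z w) (hεδ : ε ≤ δ) : Near δ z w :=
  fun f hf hf1 => (h f hf hf1).trans hεδ

theorem aut (h : Near ε z w) {g : D ≃ₜ D} (hg : g ∈ Aut D) : Near ε (g z) (g w) :=
  fun _ hf hf1 => h _ (hf.comp hg.1) fun u => hf1 (g u)

end Near

theorem near_of_mem_ball {z w : D} {r : ℝ} (hr : Metric.ball (z : Fin n → ℂ) r ⊆ D)
    (hw : w ∈ Metric.ball z r) : Near (2 / r * dist w z) w z := fun f hf hf1 => by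
  simpa using hf.norm_sub_le hr (fun u _ => hf1 u) hw

theorem near_mem_nhds (hD : IsOpen D) (z : D) {ε : ℝ} (hε : 0 < ε) :
    {w | Near ε z w} ∈ 𝓝 z := by
  obtain ⟨r, hr, hsub⟩ := Metric.isOpen_iff.1 hD z z.2
  filter_upwards [Metric.ball_mem_nhds z hr,
    Metric.ball_mem_nhds z (show 0 < ε * r / 2 by positivity)] with w hw hw'
  refine ((near_of_mem_ball hsub hw).mono ?_).symm
  rw [div_mul_eq_mul_div, div_le_iff₀ hr]
  linarith [Metric.mem_ball.1 hw']

theorem exists_finset_near (hD : IsOpen D) {Q : Set D} (hQ : IsCompact Q) {ε : ℝ} (hε : 0 < ε) :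
    ∃ T : Finset D, ∀ w ∈ Q, ∃ q ∈ T, Near ε q w := by
  obtain ⟨T, -, hT⟩ := hQ.elim_nhds_subcover (fun q => {w | Near ε q w})
    fun q _ => near_mem_nhds hD q hε
  exact ⟨T, fun w hw => by simpa using hT hw⟩

/-- The coordinates, divided by a bound for `D`, are maps into the unit disc. -/
theorem exists_dist_le_of_near (hb : Bornology.IsBounded D) :
    ∃ R > 0, ∀ (ε : ℝ) (z w : D), Near ε z w → dist z w ≤ R * ε := by
  obtain ⟨R, hR, hRD⟩ := hb.exists_pos_norm_le
  refine ⟨R, hR, fun ε z w h => ?_⟩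
  have hε : 0 ≤ ε := by simpa using h (fun _ => 0) (isHolomorphic_const 0) (by simp)
  have hnorm (c : ℂ) : ‖((R : ℝ) : ℂ)⁻¹ * c‖ = R⁻¹ * ‖c‖ := by
    rw [norm_mul, norm_inv, Complex.norm_real, Real.norm_of_nonneg hR.le]
  have hid : IsHolomorphic fun u : D => (u : Fin n → ℂ) :=
    .of_differentiableOn differentiableOn_id fun _ => rfl
  rw [Subtype.dist_eq, dist_eq_norm, pi_norm_le_iff_of_nonneg (by positivity)]
  intro i
  have hi := h _ ((hid.apply i).const_mul ((R : ℝ) : ℂ)⁻¹) fun u => by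
    rw [hnorm, inv_mul_le_iff₀ hR, mul_one]
    exact (norm_le_pi_norm _ _).trans (hRD u u.2)
  rwa [← mul_sub, hnorm, inv_mul_le_iff₀ hR] at hi

theorem isCompact_closedBall_of_subset {z : D} {r : ℝ}
    (h : Metric.closedBall (z : Fin n → ℂ) r ⊆ D) : IsCompact (Metric.closedBall z r) := by
  refine Topology.IsInducing.subtypeVal.isCompact_preimage' (isCompact_closedBall _ r) ?_
  rwa [Subtype.range_coe]

theorem exists_closedBall_subset (hD : IsOpen D) (z : D) :
    ∃ r > 0, Metric.closedBall (z : Fin n → ℂ) r ⊆ D :=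
  Metric.nhds_basis_closedBall.mem_iff.1 (hD.mem_nhds z.2)

theorem exists_near_subset_isCompact (hD : IsBoundedHomogeneousDomain D) :
    ∃ ε > 0, ∀ z : D, ∃ Q : Set D, IsCompact Q ∧ ∀ w, Near ε z w → w ∈ Q := by
  obtain ⟨z₀, hz₀⟩ := hD.isConnected.nonempty
  obtain ⟨R, hR, hdist⟩ := exists_dist_le_of_near hD.isBounded
  obtain ⟨r, hr, hsub⟩ := exists_closedBall_subset hD.isOpen ⟨z₀, hz₀⟩
  refine ⟨r / R, by positivity, fun z => ?_⟩
  obtain ⟨g, hg, hgz⟩ := hD.transitive z ⟨z₀, hz₀⟩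
  refine ⟨g ⁻¹' Metric.closedBall ⟨z₀, hz₀⟩ r,
    g.isCompact_preimage.2 (isCompact_closedBall_of_subset hsub), fun w hw => ?_⟩
  have := hdist _ _ _ (hw.aut hg)
  rwa [hgz, mul_div_cancel₀ _ hR.ne', dist_comm] at this

theorem exists_isCompact_forall_mem_of_near (hD : IsOpen D) {S : Set (D ≃ₜ D)} (hS : S ⊆ Aut D)
    {ε : ℝ} (hε : 0 < ε) (hcpt : ∀ z : D, ∃ Q : Set D, IsCompact Q ∧ ∀ w, Near ε z w → w ∈ Q)
    {x y : D} (hxy : Near (ε / 2) x y) (hx : ∃ Q : Set D, IsCompact Q ∧ ∀ g ∈ S, g x ∈ Q) :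
    ∃ Q : Set D, IsCompact Q ∧ ∀ g ∈ S, g y ∈ Q := by
  obtain ⟨Q, hQ, hgx⟩ := hx
  choose P hP hmem using hcpt
  obtain ⟨T, hT⟩ := exists_finset_near hD hQ (half_pos hε)
  refine ⟨⋃ q ∈ T, P q, T.isCompact_biUnion fun q _ => hP q, fun g hg => ?_⟩
  obtain ⟨q, hq, hqx⟩ := hT _ (hgx g hg)
  exact Set.mem_iUnion₂.2 ⟨q, hq, hmem q _ ((hqx.trans (hxy.aut (hS hg))).mono (add_halves ε).le)⟩

theorem exists_isCompact_forall_mem (hD : IsBoundedHomogeneousDomain D) {S : Set (D ≃ₜ D)}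
    (hS : S ⊆ Aut D) {z : D} {Q : Set D} (hQ : IsCompact Q) (hz : ∀ g ∈ S, g z ∈ Q) (x : D) :
    ∃ Q' : Set D, IsCompact Q' ∧ ∀ g ∈ S, g x ∈ Q' := by
  obtain ⟨ε, hε, hcpt⟩ := exists_near_subset_isCompact hD
  let B : Set D := {x | ∃ Q' : Set D, IsCompact Q' ∧ ∀ g ∈ S, g x ∈ Q'}
  have hB {x y : D} (hxy : Near (ε / 2) x y) (hx : x ∈ B) : y ∈ B :=
    exists_isCompact_forall_mem_of_near hD.isOpen hS hε hcpt hxy hx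
  have hnhds (x : D) : {y | Near (ε / 2) x y} ∈ 𝓝 x := near_mem_nhds hD.isOpen x (half_pos hε)
  have hclopen : IsClopen B :=
    ⟨⟨isOpen_iff_mem_nhds.2 fun x hx => mem_of_superset (hnhds x) fun _ hy hyB =>
      hx (hB (Near.symm hy) hyB)⟩,
      isOpen_iff_mem_nhds.2 fun x hx => mem_of_superset (hnhds x) fun _ hy => hB hy hx⟩
  have : PreconnectedSpace D := Subtype.preconnectedSpace hD.isConnected.isPreconnected
  have hBuniv : B = Set.univ := hclopen.eq_univ ⟨z, Q, hQ, hz⟩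
  exact hBuniv.ge (Set.mem_univ x)

/-- The discrete subgroups of `Aut D`, for the compact-open topology. -/
structure IsDiscreteInAut (Γ : Subgroup (D ≃ₜ D)) : Prop where
  le_aut : Γ ≤ Aut D
  discrete : IsDiscrete ((fun g : D ≃ₜ D => (g : C(D, D))) '' (Γ : Set (D ≃ₜ D)))

theorem IsCocompactSmooth.isDiscreteInAut {Γ : Subgroup (D ≃ₜ D)} (hΓ : IsCocompactSmooth Γ) :
    IsDiscreteInAut Γ :=
  ⟨hΓ.le_aut, hΓ.discrete⟩

theorem exists_near_imp_eq_one (hb : Bornology.IsBounded D) {Γ : Subgroup (D ≃ₜ D)}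
    (hΓ : IsDiscrete ((fun g : D ≃ₜ D => (g : C(D, D))) '' (Γ : Set (D ≃ₜ D)))) :
    ∃ L : Set D, IsCompact L ∧ ∃ ε > 0, ∀ γ ∈ Γ, (∀ x ∈ L, Near ε (γ x) x) → γ = 1 := by
  obtain ⟨R, hR, hdist⟩ := exists_dist_le_of_near hb
  obtain ⟨O, hO, hOΓ⟩ := isDiscrete_iff_forall_mem_exists_isOpen.1 hΓ
    ((1 : D ≃ₜ D) : C(D, D)) ⟨1, Γ.one_mem, rfl⟩
  have h1 : O ∈ 𝓝 ((1 : D ≃ₜ D) : C(D, D)) := hO.mem_nhds (hOΓ.ge rfl).1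
  obtain ⟨W, hW, hWO⟩ := UniformSpace.mem_nhds_iff.1 h1
  obtain ⟨L, U, hL, hU, hLU⟩ := (ContinuousMap.mem_compactConvergence_entourage_iff W).1 hW
  obtain ⟨η, hη, hηU⟩ := Metric.mem_uniformity_dist.1 hU
  refine ⟨L, hL, η / (2 * R), by positivity, fun γ hγ hn => ?_⟩
  have hγO : (γ : C(D, D)) ∈ O := hWO (hLU fun x hx => hηU <|
    calc dist x (γ x) ≤ R * (η / (2 * R)) := hdist _ _ _ (hn x hx).symm
      _ = η / 2 := by field_simp
      _ < η := half_lt_self hη)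
  have hγ1 : (γ : C(D, D)) = ((1 : D ≃ₜ D) : C(D, D)) := hOΓ.le ⟨hγO, γ, hγ, rfl⟩
  ext x : 1
  exact congr_arg (fun f : C(D, D) => f x) hγ1

theorem eq_of_near_on_net {Γ : Subgroup (D ≃ₜ D)} (hΓ : Γ ≤ Aut D) {L t : Set D} {ε : ℝ}
    (hone : ∀ γ ∈ Γ, (∀ x ∈ L, Near ε (γ x) x) → γ = 1)
    (ht : ∀ y ∈ L, ∃ x ∈ t, Near (ε / 3) x y) {γ γ' : D ≃ₜ D} (hγ : γ ∈ Γ) (hγ' : γ' ∈ Γ)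
    (h : ∀ x ∈ t, Near (ε / 3) (γ x) (γ' x)) : γ = γ' := by
  refine (inv_mul_eq_one.1 (hone (γ'⁻¹ * γ) (Γ.mul_mem (Γ.inv_mem hγ') hγ) fun y hy => ?_)).symm
  obtain ⟨x, hx, hxy⟩ := ht y hy
  have hnear : Near ε (γ y) (γ' y) :=
    (((hxy.symm.aut (hΓ hγ)).trans (h x hx)).trans (hxy.aut (hΓ hγ'))).mono (by linarith)
  have := hnear.aut (hΓ (Γ.inv_mem hγ'))
  rwa [show γ'⁻¹ (γ' y) = y from γ'.symm_apply_apply y] at this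

theorem finite_setOf_apply_mem (hD : IsBoundedHomogeneousDomain D) {Γ : Subgroup (D ≃ₜ D)}
    (hΓ : IsDiscreteInAut Γ) (z : D) {Q : Set D} (hQ : IsCompact Q) :
    {γ : Γ | γ.1 z ∈ Q}.Finite := by
  obtain ⟨L, hL, ε, hε, hone⟩ := exists_near_imp_eq_one hD.isBounded hΓ.discrete
  obtain ⟨t, ht⟩ := exists_finset_near hD.isOpen hL (ε := ε / 3) (by positivity)
  let S : Set (D ≃ₜ D) := {γ | γ ∈ Γ ∧ γ z ∈ Q}
  have hSA : S ⊆ Aut D := fun γ hγ => hΓ.le_aut hγ.1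
  have hnet (x : D) : ∃ T : Finset D, ∀ γ ∈ S, ∃ q ∈ T, Near (ε / 6) q (γ x) := by
    obtain ⟨P, hP, hPS⟩ := exists_isCompact_forall_mem hD hSA hQ (fun γ hγ => hγ.2) x
    obtain ⟨T, hT⟩ := exists_finset_near hD.isOpen hP (ε := ε / 6) (by positivity)
    exact ⟨T, fun γ hγ => hT _ (hPS γ hγ)⟩
  choose T hT using hnet
  choose! c hcT hc using hT
  -- `γ` is determined by the net points next to its values at the finitely many points of `t`
  have hfin : S.Finite := by
    refine Set.Finite.of_injOn (f := fun γ (x : t) => c x γ)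
      (t := Set.pi Set.univ fun x : t => (T x : Set D)) (fun γ hγ x _ => hcT x γ hγ) ?_
      (Set.Finite.pi fun x => (T x).finite_toSet)
    intro γ hγ γ' hγ' heq
    refine eq_of_near_on_net hΓ.le_aut hone ht hγ.1 hγ'.1 fun x hx => ?_
    have hcc : c x γ = c x γ' := congr_fun heq ⟨x, hx⟩
    exact ((hc x γ hγ).symm.trans (hcc ▸ hc x γ' hγ')).mono (by linarith)
  exact (hfin.preimage Subtype.val_injective.injOn).subset fun γ hγ => ⟨γ.2, hγ⟩

theorem countable_of_isDiscreteInAut (hD : IsBoundedHomogeneousDomain D) {Γ : Subgroup (D ≃ₜ D)}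
    (hΓ : IsDiscreteInAut Γ) : Countable Γ := by
  obtain ⟨z₀, hz₀⟩ := hD.isConnected.nonempty
  have : LocallyCompactSpace D := hD.isOpen.locallyCompactSpace
  have h : (⋃ i, {γ : Γ | γ.1 ⟨z₀, hz₀⟩ ∈ compactCovering D i}).Countable :=
    Set.countable_iUnion fun i =>
      (finite_setOf_apply_mem hD hΓ _ (isCompact_compactCovering D i)).countable
  refine Set.countable_univ_iff.1 (h.mono fun γ _ => ?_)
  exact Set.mem_iUnion.2 (exists_mem_compactCovering _)

theorem exists_ball_finite (hD : IsBoundedHomogeneousDomain D) {Γ : Subgroup (D ≃ₜ D)}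
    (hΓ : IsDiscreteInAut Γ) (z : D) : ∃ r > 0, Metric.ball (z : Fin n → ℂ) r ⊆ D ∧
      {γ : Γ | ∃ w ∈ Metric.ball z r, γ.1 w ∈ Metric.ball z r}.Finite := by
  obtain ⟨R, hR, hdist⟩ := exists_dist_le_of_near hD.isBounded
  obtain ⟨r₀, hr₀, hsub⟩ := exists_closedBall_subset hD.isOpen z
  have hsub' : Metric.ball (z : Fin n → ℂ) r₀ ⊆ D := Metric.ball_subset_closedBall.trans hsub
  set r := r₀ / (1 + 2 * R / r₀) with hr
  have hr0 : 0 < r := by positivity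
  have hrr : r + r * (2 * R / r₀) = r₀ := by rw [hr]; field_simp
  have hle : r ≤ r₀ := by rw [← hrr]; exact le_add_of_nonneg_right (by positivity)
  refine ⟨r, hr0, (Metric.ball_subset_ball hle).trans hsub',
    (finite_setOf_apply_mem hD hΓ z (isCompact_closedBall_of_subset hsub)).subset ?_⟩
  rintro γ ⟨w, hw, hγw⟩
  have hnear : Near (2 / r₀ * dist w z) (γ.1 w) (γ.1 z) :=
    (near_of_mem_ball hsub' (Metric.ball_subset_ball hle hw)).aut (hΓ.le_aut γ.2)
  rw [Metric.mem_ball] at hw hγw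
  calc dist (γ.1 z) z ≤ dist (γ.1 w) z + dist (γ.1 w) (γ.1 z) := by
        rw [add_comm]; exact dist_triangle_left _ _ _
    _ ≤ r + R * (2 / r₀ * dist w z) := add_le_add hγw.le (hdist _ _ _ hnear)
    _ = r + dist w z * (2 * R / r₀) := by ring
    _ ≤ r + r * (2 * R / r₀) := by gcongr
    _ = r₀ := hrr

end ProperDiscontinuity

instance continuousConstSMul_subgroup {X : Type*} [TopologicalSpace X] (Γ : Subgroup (X ≃ₜ X)) :
    ContinuousConstSMul Γ X :=
  ⟨fun γ => γ.1.continuous⟩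

theorem exists_isCompact_forall_exists_smul_mem (G X : Type*) [Group G] [TopologicalSpace X]
    [LocallyCompactSpace X] [MulAction G X] [ContinuousConstSMul G X]
    [CompactSpace (MulAction.orbitRel.Quotient G X)] :
    ∃ C : Set X, IsCompact C ∧ ∀ x : X, ∃ g : G, g • x ∈ C := by
  let π : X → MulAction.orbitRel.Quotient G X := Quotient.mk''
  have hπ : IsOpenMap π := isOpenMap_quotient_mk'_mul
  choose N hN hNx using fun x : X => exists_compact_mem_nhds x
  obtain ⟨t, ht⟩ := isCompact_univ.elim_finite_subcover (fun x : X => π '' interior (N x))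
    (fun x => hπ _ isOpen_interior) fun q _ => by
      obtain ⟨x, rfl⟩ := Quotient.mk''_surjective q
      exact Set.mem_iUnion.2 ⟨x, x, mem_interior_iff_mem_nhds.2 (hNx x), rfl⟩
  refine ⟨⋃ x ∈ t, N x, t.isCompact_biUnion fun x _ => hN x, fun z => ?_⟩
  obtain ⟨x, hx, y, hy, hyz⟩ := Set.mem_iUnion₂.1 (ht (Set.mem_univ (π z)))
  obtain ⟨g, rfl⟩ := MulAction.orbitRel_apply.1 (Quotient.exact' hyz)
  exact ⟨g, Set.mem_iUnion₂.2 ⟨x, hx, interior_subset hy⟩⟩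

section Translates

variable {G α : Type*} [Group G] [MulAction G α]

theorem encard_setOf_inv_smul_mem_le (B : Set α) (x : α) :
    {g : G | g⁻¹ • x ∈ B}.encard ≤ {g : G | ∃ w ∈ B, g • w ∈ B}.encard := by
  obtain h | ⟨g₀, hg₀⟩ := {g : G | g⁻¹ • x ∈ B}.eq_empty_or_nonempty
  · simp only [h, Set.encard_empty, zero_le]
  refine Set.encard_le_encard_of_injOn (f := fun g => g⁻¹ * g₀) (fun g hg => ?_)
    fun g _ g' _ h => inv_injective (mul_right_cancel h)
  exact ⟨g₀⁻¹ • x, hg₀, by rwa [smul_smul, mul_assoc, mul_inv_cancel, mul_one]⟩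

theorem tsum_indicator_inv_smul_preimage_le (B : Set α) (f : α → ENNReal) (x : α) :
    ∑' g : G, ((g⁻¹ • ·) ⁻¹' B).indicator f x ≤
      {g : G | ∃ w ∈ B, g • w ∈ B}.encard * f x := by
  calc ∑' g : G, ((g⁻¹ • ·) ⁻¹' B).indicator f x
      = ∑' g : G, {g : G | g⁻¹ • x ∈ B}.indicator (fun _ => f x) g := rfl
    _ = {g : G | g⁻¹ • x ∈ B}.encard * f x := by
        rw [← tsum_subtype, ENNReal.tsum_set_const]
    _ ≤ _ := mul_le_mul_left
        (by exact_mod_cast encard_setOf_inv_smul_mem_le (G := G) B x) (f x)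

theorem tsum_setLIntegral_inv_smul_preimage_le [Countable G] [MeasurableSpace α]
    [MeasurableConstSMul G α] {μ : Measure α} {B : Set α} (hB : MeasurableSet B)
    {f : α → ENNReal} (hf : Measurable f) :
    ∑' g : G, ∫⁻ x in (g⁻¹ • ·) ⁻¹' B, f x ∂μ ≤
      {g : G | ∃ w ∈ B, g • w ∈ B}.encard * ∫⁻ x, f x ∂μ := by
  have hgB (g : G) : MeasurableSet ((g⁻¹ • · : α → α) ⁻¹' B) := measurable_const_smul g⁻¹ hB
  simp only [← lintegral_indicator (hgB _)]
  rw [← lintegral_tsum fun g => (hf.indicator (hgB g)).aemeasurable, ← lintegral_const_mul _ hf]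
  exact lintegral_mono fun x => tsum_indicator_inv_smul_preimage_le B f x

end Translates

section Poincare

variable {n : ℕ} {D : Set (Fin n → ℂ)} {m : ℕ} {Γ : Subgroup (D ≃ₜ D)}
  {ρ : Γ →* Matrix.unitaryGroup (Fin m) ℂ} {k : ℕ}

theorem poincareTerm_apply (j : Fin m) (p z : D) (γ : Γ) (i : Fin m) :
    poincareTerm Γ ρ k j p z γ i =
      (jac γ.1 z * bergmanKernel D (γ.1 z) p) ^ k * (ρ γ⁻¹ : Matrix (Fin m) (Fin m) ℂ) i j := by
  rw [poincareTerm, Matrix.mulVec_single, Pi.smul_apply, Pi.smul_apply, Matrix.col_apply,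
    MulOpposite.smul_eq_mul_unop, MulOpposite.unop_op, smul_eq_mul, mul_pow]
  ring

theorem norm_poincareTerm_le (j : Fin m) (p z : D) (γ : Γ) :
    ‖poincareTerm Γ ρ k j p z γ‖ ≤ ‖jac γ.1 z * bergmanKernel D (γ.1 z) p‖ ^ k := by
  rw [pi_norm_le_iff_of_nonneg (by positivity)]
  intro i
  rw [poincareTerm_apply, norm_mul, norm_pow]
  exact mul_le_of_le_one_right (by positivity) (entry_norm_bound_of_unitary (ρ γ⁻¹).2 i j)

theorem norm_jac_mul_bergmanKernel_le (hD : IsOpen D) {g : D ≃ₜ D} (hg : g ∈ Aut D) (z p : D) :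
    ‖jac g z * bergmanKernel D (g z) p‖ ≤ bergmanRoot D z * bergmanRoot D p := by
  rw [norm_mul, ← bergmanRoot_aut hD hg z, mul_comm (bergmanRoot D (g z)), mul_assoc]
  exact mul_le_mul_of_nonneg_left (norm_bergmanKernel_le hD _ _) (norm_nonneg _)

theorem isHolomorphic_jac_mul_bergmanKernel (hD : IsOpen D) {g : D ≃ₜ D} (hg : g ∈ Aut D) (p : D) :
    IsHolomorphic fun z => jac g z * bergmanKernel D (g z) p :=
  (isHolomorphic_jac hD hg).mul ((isHolomorphic_bergmanKernel hD p).comp hg.1)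

theorem setLIntegral_comp_aut (hD : IsOpen D) {g : D ≃ₜ D} (hg : g ∈ Aut D) {A : Set D}
    (hA : MeasurableSet A) (f : D → ENNReal) :
    ∫⁻ w in g ⁻¹' A, ‖jac g w‖ₑ ^ 2 * f (g w) ∂euclideanVolume D =
      ∫⁻ w in A, f w ∂euclideanVolume D := by
  rw [← lintegral_indicator hA, ← lintegral_comp_aut hD hg,
    ← lintegral_indicator (g.continuous.measurable hA)]
  refine lintegral_congr fun w => ?_
  by_cases hw : g w ∈ A
  · rw [Set.indicator_of_mem hw, Set.indicator_of_mem (by exact hw)]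
  · rw [Set.indicator_of_notMem hw, Set.indicator_of_notMem (by exact hw), mul_zero]

theorem sq_enorm_jac_mul_bergmanKernel_mul_le (hD : IsOpen D) {g : D ≃ₜ D} (hg : g ∈ Aut D)
    (p : D) {z : D} {r : ℝ} (hr : Metric.ball (z : Fin n → ℂ) r ⊆ D) {A : Set D}
    (hA : MeasurableSet A) (hgA : Metric.ball z r ⊆ g ⁻¹' A) :
    ‖jac g z * bergmanKernel D (g z) p‖ₑ ^ 2 * volume (Metric.ball (0 : Fin n → ℂ) r) ≤
      ∫⁻ u in A, ‖bergmanKernel D u p‖ₑ ^ 2 ∂euclideanVolume D :=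
  calc _ ≤ ∫⁻ w in Metric.ball z r, ‖jac g w * bergmanKernel D (g w) p‖ₑ ^ 2 ∂euclideanVolume D :=
        (isHolomorphic_jac_mul_bergmanKernel hD hg p).sq_enorm_mul_le hD hr
    _ ≤ ∫⁻ w in g ⁻¹' A, ‖jac g w * bergmanKernel D (g w) p‖ₑ ^ 2 ∂euclideanVolume D :=
        lintegral_mono_set hgA
    _ = _ := by
        simp only [enorm_mul, mul_pow]
        exact setLIntegral_comp_aut hD hg hA fun u => ‖bergmanKernel D u p‖ₑ ^ 2

/-- The mean value inequality on a ball meeting finitely many of its translates compares the series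
with the integral of `|K(·, p)|²`. -/
theorem exists_summable_bound_two (hD : IsBoundedHomogeneousDomain D) (hΓ : IsDiscreteInAut Γ)
    (p z₀ : D) : ∃ r > 0, ∃ u : Γ → ℝ, Summable u ∧
      ∀ γ : Γ, ∀ z ∈ Metric.ball z₀ r, ‖jac γ.1 z * bergmanKernel D (γ.1 z) p‖ ^ 2 ≤ u γ := by
  have := countable_of_isDiscreteInAut hD hΓ
  have hK := isReproducingKernel_bergmanKernel hD.isOpen
  obtain ⟨r, hr, hsub, hfin⟩ := exists_ball_finite hD hΓ z₀
  let B := Metric.ball z₀ r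
  have hB : MeasurableSet B := Metric.isOpen_ball.measurableSet
  let I : Γ → ENNReal := fun γ =>
    ∫⁻ u in (γ⁻¹ • ·) ⁻¹' B, ‖bergmanKernel D u p‖ₑ ^ 2 ∂euclideanVolume D
  have hI : ∑' γ, I γ ≠ ⊤ := by
    refine ne_top_of_le_ne_top (ENNReal.mul_ne_top ?_ ?_) (tsum_setLIntegral_inv_smul_preimage_le hB
      ((hK.holomorphic p).continuous.enorm.measurable.pow_const 2))
    · exact_mod_cast hfin.encard_lt_top.ne
    · exact ((memLp_two_iff_lintegral (hK.memLp p).1).1 (hK.memLp p)).ne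
  let v := volume (Metric.ball (0 : Fin n → ℂ) (r / 2))
  have hv : 0 < v.toReal :=
    ENNReal.toReal_pos (Metric.measure_ball_pos _ _ (half_pos hr)).ne' measure_ball_lt_top.ne
  refine ⟨r / 2, half_pos hr, fun γ => (I γ).toReal / v.toReal,
    (ENNReal.summable_toReal hI).div_const _, fun γ z hz => ?_⟩
  have hzr : r / 2 + dist z z₀ ≤ r := by linarith [Metric.mem_ball.1 hz]
  have hle : ‖jac γ.1 z * bergmanKernel D (γ.1 z) p‖ₑ ^ 2 * v ≤ I γ := by
    refine sq_enorm_jac_mul_bergmanKernel_mul_le hD.isOpen (hΓ.le_aut γ.2) p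
      (.trans (Metric.ball_subset_ball' (by exact hzr)) hsub) (measurable_const_smul γ⁻¹ hB)
      fun w hw => ?_
    change γ⁻¹ • γ • w ∈ B
    rw [inv_smul_smul]
    exact Metric.ball_subset_ball' hzr hw
  rw [le_div_iff₀ hv]
  simpa only [ENNReal.toReal_mul, ENNReal.toReal_pow, toReal_enorm] using
    ENNReal.toReal_mono (ENNReal.ne_top_of_tsum_ne_top hI γ) hle

theorem exists_summable_bound (hD : IsBoundedHomogeneousDomain D) (hΓ : IsDiscreteInAut Γ)
    (ρ : Γ →* Matrix.unitaryGroup (Fin m) ℂ) (hk : 2 ≤ k) (j : Fin m) (p z₀ : D) :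
    ∃ r > 0, ∃ u : Γ → ℝ, Summable u ∧
      ∀ γ : Γ, ∀ z ∈ Metric.ball z₀ r, ‖poincareTerm Γ ρ k j p z γ‖ ≤ u γ := by
  have hroot := bergmanRoot_pos hD.isOpen hD.isBounded
  obtain ⟨r₁, hr₁, u, hu, hle⟩ := exists_summable_bound_two hD hΓ p z₀
  obtain ⟨r₂, hr₂, hM⟩ := Metric.eventually_nhds_iff_ball.1
    ((continuous_bergmanRoot hD.isOpen).continuousAt.eventually_lt_const
      (lt_add_one (bergmanRoot D z₀)))
  obtain ⟨l, rfl⟩ := Nat.exists_eq_add_of_le hk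
  refine ⟨min r₁ r₂, lt_min hr₁ hr₂,
    fun γ => u γ * ((bergmanRoot D z₀ + 1) * bergmanRoot D p) ^ l, hu.mul_right _, fun γ z hz => ?_⟩
  have htwo := hle γ z (Metric.ball_subset_ball (min_le_left _ _) hz)
  have hone : ‖jac γ.1 z * bergmanKernel D (γ.1 z) p‖ ≤ (bergmanRoot D z₀ + 1) * bergmanRoot D p :=
    (norm_jac_mul_bergmanKernel_le hD.isOpen (hΓ.le_aut γ.2) z p).trans
      (mul_le_mul_of_nonneg_right (hM z (Metric.ball_subset_ball (min_le_right _ _) hz)).le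
        (hroot p).le)
  refine (norm_poincareTerm_le j p z γ).trans ?_
  rw [pow_add]
  exact mul_le_mul htwo (pow_le_pow_left₀ (norm_nonneg _) hone l) (by positivity)
    ((sq_nonneg _).trans htwo)

theorem summable_norm_poincareTerm (hD : IsBoundedHomogeneousDomain D) (hΓ : IsDiscreteInAut Γ)
    (ρ : Γ →* Matrix.unitaryGroup (Fin m) ℂ) (hk : 2 ≤ k) (j : Fin m) (p z : D) :
    Summable fun γ : Γ => ‖poincareTerm Γ ρ k j p z γ‖ := by
  obtain ⟨r, hr, u, hu, h⟩ := exists_summable_bound hD hΓ ρ hk j p z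
  exact hu.of_nonneg_of_le (fun _ => norm_nonneg _) fun γ => h γ z (Metric.mem_ball_self hr)

theorem summable_poincareTerm (hD : IsBoundedHomogeneousDomain D) (hΓ : IsDiscreteInAut Γ)
    (ρ : Γ →* Matrix.unitaryGroup (Fin m) ℂ) (hk : 2 ≤ k) (j : Fin m) (p z : D) :
    Summable fun γ : Γ => poincareTerm Γ ρ k j p z γ :=
  (summable_norm_poincareTerm hD hΓ ρ hk j p z).of_norm

theorem isHolomorphic_poincareTerm (hD : IsOpen D) (hΓ : Γ ≤ Aut D)
    (ρ : Γ →* Matrix.unitaryGroup (Fin m) ℂ) (k : ℕ) (j : Fin m) (p : D) (γ : Γ) :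
    IsHolomorphic fun z => poincareTerm Γ ρ k j p z γ := by
  refine (((isHolomorphic_jac_mul_bergmanKernel hD (hΓ γ.2) p).pow k).smul
    (isHolomorphic_const fun i => (ρ γ⁻¹ : Matrix (Fin m) (Fin m) ℂ) i j)).congr fun z => ?_
  ext i
  rw [poincareTerm_apply, Pi.smul_apply, smul_eq_mul]

theorem isHolomorphic_tsum_poincareTerm (hD : IsBoundedHomogeneousDomain D)
    (hΓ : IsDiscreteInAut Γ) (ρ : Γ →* Matrix.unitaryGroup (Fin m) ℂ) (hk : 2 ≤ k) (j : Fin m)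
    (p : D) : IsHolomorphic fun z => ∑' γ : Γ, poincareTerm Γ ρ k j p z γ := by
  refine isHolomorphic_of_tendstoUniformlyOn (l := atTop) hD.isOpen
    (F := fun (s : Finset Γ) z => ∑ γ ∈ s, poincareTerm Γ ρ k j p z γ)
    (fun s => .sum s fun γ _ => isHolomorphic_poincareTerm hD.isOpen hΓ.le_aut ρ k j p γ)
    fun z => ?_
  obtain ⟨r, hr, u, hu, h⟩ := exists_summable_bound hD hΓ ρ hk j p z
  exact ⟨r, hr, tendstoUniformlyOn_tsum hu h⟩

theorem mulVec_poincareTerm_mul (hD : IsOpen D) (hΓ : Γ ≤ Aut D) (j : Fin m) (p z : D) (γ σ : Γ) :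
    (ρ σ : Matrix (Fin m) (Fin m) ℂ).mulVec (poincareTerm Γ ρ k j p z (γ * σ)) =
      jac σ.1 z ^ k • poincareTerm Γ ρ k j p (σ.1 z) γ := by
  have hρ : (ρ σ : Matrix (Fin m) (Fin m) ℂ) * (ρ (γ * σ)⁻¹ : Matrix (Fin m) (Fin m) ℂ) =
      (ρ γ⁻¹ : Matrix (Fin m) (Fin m) ℂ) := by
    rw [← Submonoid.coe_mul, ← map_mul, mul_inv_rev, mul_inv_cancel_left]
  have hjac : jac (γ * σ).1 z = jac γ.1 (σ.1 z) * jac σ.1 z := jac_mul hD (hΓ γ.2) (hΓ σ.2) z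
  have hmul : (γ * σ).1 z = γ.1 (σ.1 z) := rfl
  rw [poincareTerm, poincareTerm, Matrix.mulVec_smul, Matrix.mulVec_mulVec, hρ, hjac, hmul,
    smul_smul, mul_pow, mul_comm]

theorem jac_smul_tsum_poincareTerm (hD : IsBoundedHomogeneousDomain D) (hΓ : IsDiscreteInAut Γ)
    (hk : 2 ≤ k) (j : Fin m) (p z : D) (σ : Γ) :
    jac σ.1 z ^ k • ∑' γ : Γ, poincareTerm Γ ρ k j p (σ.1 z) γ =
      (ρ σ : Matrix (Fin m) (Fin m) ℂ).mulVec (∑' γ : Γ, poincareTerm Γ ρ k j p z γ) := by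
  let L : (Fin m → ℂ) →L[ℂ] Fin m → ℂ :=
    (ρ σ : Matrix (Fin m) (Fin m) ℂ).mulVecLin.toContinuousLinearMap
  calc jac σ.1 z ^ k • ∑' γ : Γ, poincareTerm Γ ρ k j p (σ.1 z) γ
      = ∑' γ : Γ, jac σ.1 z ^ k • poincareTerm Γ ρ k j p (σ.1 z) γ :=
        ((summable_poincareTerm hD hΓ ρ hk j p (σ.1 z)).tsum_const_smul _).symm
    _ = ∑' γ : Γ, L (poincareTerm Γ ρ k j p z (γ * σ)) :=
        tsum_congr fun γ => (mulVec_poincareTerm_mul hD.isOpen hΓ.le_aut j p z γ σ).symm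
    _ = ∑' γ : Γ, L (poincareTerm Γ ρ k j p z γ) :=
        (Equiv.mulRight σ).tsum_eq fun γ => L (poincareTerm Γ ρ k j p z γ)
    _ = L (∑' γ : Γ, poincareTerm Γ ρ k j p z γ) :=
        (L.map_tsum (summable_poincareTerm hD hΓ ρ hk j p z)).symm

theorem poincareSeries_mem (hD : IsBoundedHomogeneousDomain D) (hΓ : IsDiscreteInAut Γ)
    (ρ : Γ →* Matrix.unitaryGroup (Fin m) ℂ) (hk : 2 ≤ k) (j : Fin m) (p : D) :
    poincareSeries Γ ρ k j p ∈ automorphicForms Γ ρ k :=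
  Submodule.smul_mem _ (weightConst D k) (x := fun z => ∑' γ : Γ, poincareTerm Γ ρ k j p z γ)
    ⟨isHolomorphic_tsum_poincareTerm hD hΓ ρ hk j p,
      fun σ z => jac_smul_tsum_poincareTerm hD hΓ hk j p z σ⟩

theorem norm_toLp_mulVec {U : Matrix (Fin m) (Fin m) ℂ} (hU : U ∈ Matrix.unitaryGroup (Fin m) ℂ)
    (v : Fin m → ℂ) : ‖WithLp.toLp 2 (U.mulVec v)‖ = ‖WithLp.toLp 2 v‖ :=
  Unitary.norm_map ⟨Matrix.toEuclideanCLM (𝕜 := ℂ) U, Unitary.map_mem _ hU⟩ (WithLp.toLp 2 v)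

theorem norm_toLp_of_mem {F : D → Fin m → ℂ} (hF : F ∈ automorphicForms Γ ρ k) (γ : Γ) (z : D) :
    ‖WithLp.toLp 2 (F z)‖ = ‖jac γ.1 z‖ ^ k * ‖WithLp.toLp 2 (F (γ.1 z))‖ := by
  rw [← norm_toLp_mulVec (ρ γ).2, ← hF.2, WithLp.toLp_smul, norm_smul, norm_pow]

theorem exists_norm_apply_le_mul_bergmanRoot_pow (hD : IsOpen D) (hb : Bornology.IsBounded D)
    (hΓ : Γ ≤ Aut D) [CompactSpace (MulAction.orbitRel.Quotient Γ D)] {F : D → Fin m → ℂ}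
    (hF : F ∈ automorphicForms Γ ρ k) : ∃ C : ℝ, ∀ z i, ‖F z i‖ ≤ C * bergmanRoot D z ^ k := by
  have hroot (z : D) : 0 < bergmanRoot D z ^ k := pow_pos (bergmanRoot_pos hD hb z) k
  have : LocallyCompactSpace D := hD.locallyCompactSpace
  obtain ⟨Q, hQ, hQΓ⟩ := exists_isCompact_forall_exists_smul_mem Γ D
  have hc : Continuous fun z => ‖WithLp.toLp 2 (F z)‖ / bergmanRoot D z ^ k :=
    ((PiLp.continuous_toLp 2 _).comp hF.1.continuous).norm.div
      ((continuous_bergmanRoot hD).pow k) fun z => (hroot z).ne'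
  obtain ⟨C, hC⟩ := hQ.exists_bound_of_continuousOn hc.continuousOn
  refine ⟨C, fun z i => ?_⟩
  obtain ⟨γ, hγ⟩ := hQΓ z
  calc ‖F z i‖ ≤ ‖WithLp.toLp 2 (F z)‖ := PiLp.norm_apply_le (WithLp.toLp 2 (F z)) i
    _ = ‖jac γ.1 z‖ ^ k * ‖WithLp.toLp 2 (F (γ.1 z))‖ := norm_toLp_of_mem hF γ z
    _ ≤ ‖jac γ.1 z‖ ^ k * (C * bergmanRoot D (γ.1 z) ^ k) := by
        gcongr
        exact (div_le_iff₀ (hroot _)).1 ((le_abs_self _).trans (hC _ hγ))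
    _ = C * bergmanRoot D z ^ k := by
        rw [← bergmanRoot_aut hD (hΓ γ.2) z]
        ring

end Poincare

section OrthonormalFamilies

variable {V H : Type*} [AddCommGroup V] [Module ℂ V] [NormedAddCommGroup H] [InnerProductSpace ℂ H]
  {T : V →ₗ[ℂ] H}

theorem sum_sq_norm_apply_le_of_orthonormal {C : ℝ} {ℓ : V →ₗ[ℂ] ℂ}
    (hℓ : ∀ v, ‖ℓ v‖ ^ 2 ≤ C * ‖T v‖ ^ 2) {N : ℕ} {b : Fin N → V}
    (hb : Orthonormal ℂ (T ∘ b)) (hC : 0 ≤ C) : ∑ a, ‖ℓ (b a)‖ ^ 2 ≤ C := by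
  set s := ∑ a, ‖ℓ (b a)‖ ^ 2 with hs
  let v := ∑ a, starRingEnd ℂ (ℓ (b a)) • b a
  have hℓv : ℓ v = (s : ℂ) := by
    simp only [v, map_sum, map_smul, smul_eq_mul, Complex.conj_mul', hs, Complex.ofReal_sum,
      Complex.ofReal_pow]
  have hTv : ‖T v‖ ^ 2 = s := by
    have hT : T v = ∑ a, starRingEnd ℂ (ℓ (b a)) • (T ∘ b) a := by
      simp only [v, map_sum, map_smul, Function.comp_apply]
    apply Complex.ofReal_injective
    calc ((‖T v‖ ^ 2 : ℝ) : ℂ) = inner ℂ (T v) (T v) := by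
          rw [inner_self_eq_norm_sq_to_K, Complex.ofReal_pow]; rfl
      _ = ∑ a, starRingEnd ℂ (starRingEnd ℂ (ℓ (b a))) * starRingEnd ℂ (ℓ (b a)) := by
          rw [hT, hb.inner_sum]
      _ = (s : ℂ) := by
          simp only [Complex.conj_conj, Complex.mul_conj', hs, Complex.ofReal_sum,
            Complex.ofReal_pow]
  have hs0 : 0 ≤ s := hs ▸ Finset.sum_nonneg fun a _ => sq_nonneg _
  have hsC := hℓ v
  rw [hTv, hℓv, Complex.norm_of_nonneg hs0, pow_two] at hsC
  obtain h0 | h0 := hs0.eq_or_lt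
  · exact h0 ▸ hC
  · exact le_of_mul_le_mul_right hsC h0

theorem finiteDimensional_of_orthonormal_card_le (hT : Function.Injective T) (c : ℕ)
    (hc : ∀ (N : ℕ) (b : Fin N → V), Orthonormal ℂ (T ∘ b) → N ≤ c) : FiniteDimensional ℂ V := by
  refine Module.rank_lt_aleph0_iff.1
    ((rank_le (n := c) fun s hs => ?_).trans_lt Cardinal.natCast_lt_aleph0)
  let W := Submodule.span ℂ (Set.range (T ∘ ((↑) : s → V)))
  have hW : Module.finrank ℂ W = s.card := by
    rw [finrank_span_eq_card (hs.map' T (LinearMap.ker_eq_bot.2 hT)), Fintype.card_coe]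
  have : FiniteDimensional ℂ W := FiniteDimensional.span_of_finite ℂ (Set.finite_range _)
  have hle : W ≤ T.range := Submodule.span_le.2 (Set.range_subset_iff.2 fun v => ⟨v, rfl⟩)
  choose b hb using fun a => hle (stdOrthonormalBasis ℂ W a).2
  rw [← hW]
  refine hc _ b ?_
  rw [show T ∘ b = W.subtypeₗᵢ ∘ stdOrthonormalBasis ℂ W from funext hb]
  exact (stdOrthonormalBasis ℂ W).orthonormal.comp_linearIsometry W.subtypeₗᵢ

variable {ι : Type*} [Fintype ι]

theorem sum_sq_norm_euclidean_apply_le_of_orthonormal {C : ℝ} {ℓ : V →ₗ[ℂ] EuclideanSpace ℂ ι}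
    (hℓ : ∀ v, ‖ℓ v‖ ^ 2 ≤ C * ‖T v‖ ^ 2) {N : ℕ} {b : Fin N → V}
    (hb : Orthonormal ℂ (T ∘ b)) (hC : 0 ≤ C) :
    ∑ a, ‖ℓ (b a)‖ ^ 2 ≤ Fintype.card ι * C := by
  have hcoord (i : ι) : ∑ a, ‖ℓ (b a) i‖ ^ 2 ≤ C :=
    sum_sq_norm_apply_le_of_orthonormal (ℓ := (EuclideanSpace.proj i).toLinearMap ∘ₗ ℓ)
      (fun v => (pow_le_pow_left₀ (norm_nonneg _) (PiLp.norm_apply_le (ℓ v) i) 2).trans (hℓ v))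
      hb hC
  simp only [EuclideanSpace.norm_sq_eq]
  rw [Finset.sum_comm]
  exact (Finset.sum_le_sum fun i _ => hcoord i).trans_eq
    (by rw [Finset.sum_const, nsmul_eq_mul, Finset.card_univ])

variable {X : Type*} [MeasurableSpace X] {μ : Measure X} {ev : V →ₗ[ℂ] X → EuclideanSpace ℂ ι}

/-- A space of square integrable functions, mapped to its classes in `L²`. -/
def toL2 (hev : ∀ v, MemLp (ev v) 2 μ) : V →ₗ[ℂ] Lp (EuclideanSpace ℂ ι) 2 μ where
  toFun v := (hev v).toLp
  map_add' v w := by simp only [map_add, MemLp.toLp_add (hev v) (hev w)]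
  map_smul' c v := by simp only [map_smul, MemLp.toLp_const_smul c (hev v), RingHom.id_apply]

theorem sq_enorm_toL2 (hev : ∀ v, MemLp (ev v) 2 μ) (v : V) :
    ‖toL2 hev v‖ₑ ^ 2 = ∫⁻ y, ‖ev v y‖ₑ ^ 2 ∂μ := by
  rw [← eLpNorm_two_sq, ← Lp.enorm_toLp (hev v)]
  rfl

theorem natCast_le_of_orthonormal_toL2 (hev : ∀ v, MemLp (ev v) 2 μ) {C : NNReal}
    (hC : ∀ᵐ x ∂μ, ∀ v, ‖ev v x‖ₑ ^ 2 ≤ C * ∫⁻ y, ‖ev v y‖ₑ ^ 2 ∂μ) {N : ℕ} {b : Fin N → V}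
    (hb : Orthonormal ℂ (toL2 hev ∘ b)) :
    (N : ENNReal) ≤ Fintype.card ι * C * μ Set.univ := by
  have hpt : ∀ᵐ x ∂μ, ∑ a, ‖ev (b a) x‖ₑ ^ 2 ≤ Fintype.card ι * C := by
    filter_upwards [hC] with x hx
    let ℓ : V →ₗ[ℂ] EuclideanSpace ℂ ι := LinearMap.proj x ∘ₗ ev
    have hℓ (v : V) : ‖ℓ v‖ ^ 2 ≤ C * ‖toL2 hev v‖ ^ 2 := by
      have hv := hx v
      rw [← sq_enorm_toL2 hev, enorm_eq_nnnorm, enorm_eq_nnnorm] at hv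
      exact_mod_cast hv
    have h : ∑ a, ‖ℓ (b a)‖₊ ^ 2 ≤ Fintype.card ι * C := by
      rw [← NNReal.coe_le_coe]
      push_cast
      exact sum_sq_norm_euclidean_apply_le_of_orthonormal hℓ hb C.2
    change ∑ a, ‖ℓ (b a)‖ₑ ^ 2 ≤ _
    simp only [enorm_eq_nnnorm]
    exact_mod_cast h
  have hb1 (a : Fin N) : ‖toL2 hev (b a)‖ₑ ^ 2 = 1 := by
    rw [← ofReal_norm, show ‖toL2 hev (b a)‖ = 1 from hb.1 a, ENNReal.ofReal_one, one_pow]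
  calc (N : ENNReal) = ∑ a, ‖toL2 hev (b a)‖ₑ ^ 2 := by simp [hb1]
    _ = ∑ a, ∫⁻ x, ‖ev (b a) x‖ₑ ^ 2 ∂μ := by simp only [sq_enorm_toL2]
    _ = ∫⁻ x, ∑ a, ‖ev (b a) x‖ₑ ^ 2 ∂μ :=
        (lintegral_finsetSum' _ fun a _ => (hev (b a)).1.enorm.pow_const 2).symm
    _ ≤ ∫⁻ _, Fintype.card ι * C ∂μ := lintegral_mono_ae hpt
    _ = Fintype.card ι * C * μ Set.univ := lintegral_const _

theorem finiteDimensional_of_sq_enorm_le_lintegral [IsFiniteMeasure μ]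
    (hev : ∀ v, MemLp (ev v) 2 μ) (hinj : ∀ v, ev v =ᵐ[μ] 0 → v = 0) {C : NNReal}
    (hC : ∀ᵐ x ∂μ, ∀ v, ‖ev v x‖ₑ ^ 2 ≤ C * ∫⁻ y, ‖ev v y‖ₑ ^ 2 ∂μ) : FiniteDimensional ℂ V := by
  obtain ⟨c, hc⟩ := ENNReal.exists_nat_gt (r := Fintype.card ι * C * μ Set.univ) (by finiteness)
  refine finiteDimensional_of_orthonormal_card_le (T := toL2 hev)
    ((injective_iff_map_eq_zero _).2 fun v hv => hinj v ?_) c fun N b hb => ?_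
  · exact (MemLp.toLp_eq_toLp_iff (hev v) MemLp.zero).1 hv
  · exact_mod_cast ((natCast_le_of_orthonormal_toL2 hev hC hb).trans_lt hc).le

end OrthonormalFamilies

section FiniteDimensional

variable {n : ℕ} {D : Set (Fin n → ℂ)} {m : ℕ} {Γ : Subgroup (D ≃ₜ D)}
  {ρ : Γ →* Matrix.unitaryGroup (Fin m) ℂ} {k : ℕ}

theorem exists_isCompact_forall_ball_subset_image (hD : IsOpen D) {Q : Set D} (hQ : IsCompact Q) :
    ∃ δ > 0, ∃ S : Set D, IsCompact S ∧ ∀ z ∈ Q, Metric.ball (z : Fin n → ℂ) δ ⊆ (↑) '' S := by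
  have hQimage := hQ.image continuous_subtype_val
  obtain ⟨δ, hδ, hsub⟩ := hQimage.exists_cthickening_subset_open hD
    (Set.image_subset_iff.2 fun z _ => z.2)
  have himage : Subtype.val '' (Subtype.val ⁻¹' Metric.cthickening δ (Subtype.val '' Q) : Set D) =
      Metric.cthickening δ (Subtype.val '' Q) := by
    rw [Set.image_preimage_eq_iff, Subtype.range_coe]
    exact hsub
  refine ⟨δ, hδ, _, Subtype.isCompact_iff.2 (himage ▸ hQimage.cthickening), fun z hz => ?_⟩
  rw [himage]
  exact (Metric.ball_subset_thickening (Set.mem_image_of_mem _ hz) δ).trans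
    (Metric.thickening_subset_cthickening _ _)

theorem sq_enorm_toLp (v : Fin m → ℂ) : ‖WithLp.toLp 2 v‖ₑ ^ 2 = ∑ i, ‖v i‖ₑ ^ 2 := by
  have h : ‖WithLp.toLp 2 v‖₊ ^ 2 = ∑ i, ‖v i‖₊ ^ 2 := by
    rw [← NNReal.coe_inj]
    push_cast
    exact EuclideanSpace.norm_sq_eq _
  simp only [enorm_eq_nnnorm]
  exact_mod_cast h

theorem IsHolomorphic.sq_enorm_toLp_mul_le (hD : IsOpen D) {F : D → Fin m → ℂ}
    (hF : IsHolomorphic F) {z : D} {r : ℝ} (hr : Metric.ball (z : Fin n → ℂ) r ⊆ D) :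
    ‖WithLp.toLp 2 (F z)‖ₑ ^ 2 * volume (Metric.ball (0 : Fin n → ℂ) r) ≤
      ∫⁻ w in Metric.ball z r, ‖WithLp.toLp 2 (F w)‖ₑ ^ 2 ∂(euclideanVolume D) := by
  simp only [sq_enorm_toLp]
  rw [Finset.sum_mul, lintegral_finsetSum _ fun i _ =>
    (hF.apply i).continuous.enorm.measurable.pow_const 2]
  exact Finset.sum_le_sum fun i _ => (hF.apply i).sq_enorm_mul_le hD hr

theorem exists_norm_jac_le (hD : IsOpen D) (hb : Bornology.IsBounded D) {S Q : Set D}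
    (hS : IsCompact S) (hQ : IsCompact Q) :
    ∃ M : NNReal, ∀ g ∈ Aut D, ∀ z ∈ S, g z ∈ Q → ‖jac g z‖₊ ≤ M := by
  have hroot := bergmanRoot_pos hD hb
  obtain ⟨M₁, hM₁⟩ := hS.exists_bound_of_continuousOn (continuous_bergmanRoot hD).continuousOn
  obtain ⟨M₂, hM₂⟩ := hQ.exists_bound_of_continuousOn
    ((continuous_bergmanRoot hD).inv₀ fun z => (hroot z).ne').continuousOn
  refine ⟨(M₁ * M₂).toNNReal, fun g hg z hz hgz => NNReal.le_toNNReal_of_coe_le ?_⟩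
  have hjac : ‖jac g z‖ = bergmanRoot D z * (bergmanRoot D (g z))⁻¹ := by
    rw [← bergmanRoot_aut hD hg z, mul_right_comm, mul_inv_cancel₀ (hroot _).ne', one_mul]
  rw [coe_nnnorm, hjac]
  exact mul_le_mul ((le_abs_self _).trans (hM₁ z hz)) ((le_abs_self _).trans (hM₂ _ hgz))
    (inv_nonneg.2 (hroot _).le) ((norm_nonneg _).trans (hM₁ z hz))

theorem exists_sq_enorm_toLp_le_lintegral (hD : IsOpen D) (hb : Bornology.IsBounded D)
    (hΓ : Γ ≤ Aut D) [CompactSpace (MulAction.orbitRel.Quotient Γ D)]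
    (ρ : Γ →* Matrix.unitaryGroup (Fin m) ℂ) (k : ℕ) :
    ∃ S : Set D, IsCompact S ∧ (∀ z, ∃ γ : Γ, γ.1 z ∈ S) ∧ ∃ C : NNReal,
      ∀ F ∈ automorphicForms Γ ρ k, ∀ z ∈ S, ‖WithLp.toLp 2 (F z)‖ₑ ^ 2 ≤
        C * ∫⁻ w in S, ‖WithLp.toLp 2 (F w)‖ₑ ^ 2 ∂(euclideanVolume D) := by
  have : LocallyCompactSpace D := hD.locallyCompactSpace
  obtain ⟨Q, hQ, hQΓ⟩ := exists_isCompact_forall_exists_smul_mem Γ D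
  obtain ⟨δ, hδ, S, hS, hball⟩ := exists_isCompact_forall_ball_subset_image hD hQ
  have hsub {z : D} (hz : z ∈ Q) : Metric.ball z δ ⊆ S := fun w hw =>
    (Subtype.val_injective.mem_set_image).1 (hball z hz hw)
  obtain ⟨M, hM⟩ := exists_norm_jac_le hD hb hS hQ
  let v := volume (Metric.ball (0 : Fin n → ℂ) δ)
  have hv0 : v ≠ 0 := (Metric.measure_ball_pos _ _ hδ).ne'
  have hv : v ≠ ⊤ := measure_ball_lt_top.ne
  refine ⟨S, hS, fun z => (hQΓ z).imp fun γ hγ =>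
    hsub hγ (Metric.mem_ball_self hδ), ((M : ENNReal) ^ k) ^ 2 / v |>.toNNReal,
    fun F hF z hz => ?_⟩
  obtain ⟨γ, hγ⟩ := hQΓ z
  rw [ENNReal.coe_toNNReal (by finiteness)]
  have hmean : ‖WithLp.toLp 2 (F (γ.1 z))‖ₑ ^ 2 * v ≤
      ∫⁻ w in S, ‖WithLp.toLp 2 (F w)‖ₑ ^ 2 ∂(euclideanVolume D) :=
    (hF.1.sq_enorm_toLp_mul_le hD ((hball _ hγ).trans
      (Set.image_subset_iff.2 fun w _ => w.2))).trans (lintegral_mono_set (hsub hγ))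
  calc ‖WithLp.toLp 2 (F z)‖ₑ ^ 2
      = (‖jac γ.1 z‖ₑ ^ k * ‖WithLp.toLp 2 (F (γ.1 z))‖ₑ) ^ 2 := by
        rw [← ofReal_norm, norm_toLp_of_mem hF γ z, ENNReal.ofReal_mul (by positivity),
          ENNReal.ofReal_pow (norm_nonneg _), ofReal_norm, ofReal_norm]
    _ ≤ ((M : ENNReal) ^ k * ‖WithLp.toLp 2 (F (γ.1 z))‖ₑ) ^ 2 := by
        gcongr
        exact ENNReal.coe_le_coe.2 (hM _ (hΓ γ.2) z hz hγ)
    _ = ((M : ENNReal) ^ k) ^ 2 / v * (‖WithLp.toLp 2 (F (γ.1 z))‖ₑ ^ 2 * v) := by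
        rw [mul_pow, mul_comm _ v, ← mul_assoc, ENNReal.div_mul_cancel hv0 hv]
    _ ≤ _ := by gcongr

theorem finiteDimensional_automorphicForms (hD : IsOpen D) (hb : Bornology.IsBounded D)
    (hΓ : Γ ≤ Aut D) [CompactSpace (MulAction.orbitRel.Quotient Γ D)]
    (ρ : Γ →* Matrix.unitaryGroup (Fin m) ℂ) (k : ℕ) :
    FiniteDimensional ℂ (automorphicForms Γ ρ k) := by
  have := isFiniteMeasure_euclideanVolume hD hb
  obtain ⟨S, hS, hSΓ, C, hC⟩ := exists_sq_enorm_toLp_le_lintegral hD hb hΓ ρ k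
  let ev : automorphicForms Γ ρ k →ₗ[ℂ] D → EuclideanSpace ℂ (Fin m) :=
    (WithLp.linearEquiv 2 ℂ (Fin m → ℂ)).symm.toLinearMap.compLeft D ∘ₗ Submodule.subtype _
  have hcont (F : automorphicForms Γ ρ k) : Continuous (ev F) :=
    (PiLp.continuous_toLp 2 _).comp F.2.1.continuous
  refine finiteDimensional_of_sq_enorm_le_lintegral (ev := ev)
    (μ := (euclideanVolume D).restrict S) (C := C) (fun F => ?_) (fun F hF => ?_)
    ((ae_restrict_mem hS.measurableSet).mono fun z hz F => hC F F.2 z hz)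
  · have hlt := setLIntegral_lt_top_of_isCompact (measure_ne_top (euclideanVolume D) S) hS
      ((hcont F).nnnorm.pow 2)
    exact (memLp_two_iff_lintegral (hcont F).aestronglyMeasurable).2
      (by simpa [enorm_eq_nnnorm] using hlt)
  · have hzero : ∀ z ∈ S, F.1 z = 0 := fun z hz => by
      have h := hC F F.2 z hz
      rw [lintegral_congr_ae (hF.mono fun w hw => by
        rw [show WithLp.toLp 2 (F.1 w) = 0 from hw])] at h
      simpa using h
    refine Subtype.ext (funext fun z => ?_)
    obtain ⟨γ, hγ⟩ := hSΓ z
    simpa [hzero _ hγ] using norm_toLp_of_mem F.2 γ z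

end FiniteDimensional

section Unfolding

variable {G X : Type*} [Group G] [MulAction G X] {e : X → ENNReal}

theorem tsum_indicator_one_smul_ne_zero {B : Set X} {x : X} (h : ∃ g : G, g • x ∈ B) :
    ∑' g : G, B.indicator (1 : X → ENNReal) (g • x) ≠ 0 := by
  obtain ⟨g, hg⟩ := h
  exact fun h0 => one_ne_zero ((Set.indicator_of_mem hg 1).symm.trans (ENNReal.tsum_eq_zero.1 h0 g))

theorem tsum_indicator_one_smul_ne_top {B : Set X} {x : X} (h : {g : G | g • x ∈ B}.Finite) :
    ∑' g : G, B.indicator (1 : X → ENNReal) (g • x) ≠ ⊤ := by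
  rw [tsum_eq_sum (s := h.toFinset) fun g hg => Set.indicator_of_notMem (by simpa using hg) 1]
  exact ENNReal.sum_ne_top.2 fun g _ =>
    ((Set.indicator_le_self' (fun _ _ => zero_le_one) _).trans_lt ENNReal.one_lt_top).ne

theorem exists_measurable_tsum_inv_smul_eq_one [Countable G] [MeasurableSpace X]
    [MeasurableConstSMul G X] {B : Set X} (hB : MeasurableSet B)
    (hfin : ∀ x, {g : G | g • x ∈ B}.Finite) (hcov : ∀ x, ∃ g : G, g • x ∈ B) :
    ∃ e : X → ENNReal, Measurable e ∧ (∀ x ∉ B, e x = 0) ∧ ∀ x, ∑' g : G, e (g⁻¹ • x) = 1 := by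
  let b : X → ENNReal := B.indicator 1
  let N : X → ENNReal := fun x => ∑' g : G, b (g • x)
  have hb : Measurable b := measurable_one.indicator hB
  have hN : Measurable N := Measurable.tsum fun g => hb.comp (measurable_const_smul g)
  have hinv (g : G) (x : X) : N (g⁻¹ • x) = N x := by
    simpa only [N, smul_smul, Equiv.coe_mulRight] using
      (Equiv.mulRight g⁻¹).tsum_eq fun σ : G => b (σ • x)
  refine ⟨fun x => b x / N x, hb.div hN, fun x hx => ?_, fun x => ?_⟩
  · simp only [b, Set.indicator_of_notMem hx, ENNReal.zero_div]
  · calc ∑' g : G, b (g⁻¹ • x) / N (g⁻¹ • x) = (∑' g : G, b (g⁻¹ • x)) * (N x)⁻¹ := by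
          simp only [hinv, div_eq_mul_inv, ENNReal.tsum_mul_right]
      _ = N x * (N x)⁻¹ := 
          congrArg (· * (N x)⁻¹) ((Equiv.inv G).tsum_eq fun g : G => b (g • x))
      _ = 1 := ENNReal.mul_inv_cancel (tsum_indicator_one_smul_ne_zero (hcov x))
          (tsum_indicator_one_smul_ne_top (hfin x))

theorem le_one_of_tsum_inv_smul_eq_one (hsum : ∀ x, ∑' g : G, e (g⁻¹ • x) = 1) (x : X) :
    e x ≤ 1 := by
  simpa using (ENNReal.le_tsum (f := fun g : G => e (g⁻¹ • x)) 1).trans_eq (hsum x)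

theorem integral_toReal_smul_tsum_smul [Countable G] [MeasurableSpace X] [MeasurableConstSMul G X]
    {μ : Measure X} [SMulInvariantMeasure G X μ] {E : Type*} [NormedAddCommGroup E]
    [NormedSpace ℝ E] (he : Measurable e) (hsum : ∀ x, ∑' g : G, e (g⁻¹ • x) = 1) {h : X → E}
    (hh : Integrable h μ) :
    ∫ x, (e x).toReal • ∑' g : G, h (g • x) ∂μ = ∫ x, h x ∂μ := by
  let t : G → X → E := fun g x => (e (g⁻¹ • x)).toReal • h x
  have hetop (g : G) (x : X) : e (g⁻¹ • x) ≠ ⊤ :=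
    ENNReal.ne_top_of_tsum_ne_top (hsum x ▸ ENNReal.one_ne_top) g
  have ht (g : G) : AEStronglyMeasurable (t g) μ :=
    (he.comp (measurable_const_smul g⁻¹)).ennreal_toReal.aestronglyMeasurable.smul hh.1
  have htg (g : G) : AEStronglyMeasurable (fun x => t g (g • x)) μ :=
    (ht g).comp_measurePreserving (measurePreserving_smul g μ)
  have hfin : ∑' g, ∫⁻ x, ‖t g x‖ₑ ∂μ ≠ ⊤ := by
    have henorm (g : G) (x : X) : ‖t g x‖ₑ = e (g⁻¹ • x) * ‖h x‖ₑ := by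
      rw [enorm_smul, Real.enorm_of_nonneg ENNReal.toReal_nonneg, ENNReal.ofReal_toReal (hetop g x)]
    rw [← lintegral_tsum fun g => (ht g).enorm]
    simpa only [henorm, ENNReal.tsum_mul_right, hsum, one_mul] using hh.2.ne
  have hfing : ∑' g, ∫⁻ x, ‖t g (g • x)‖ₑ ∂μ ≠ ⊤ := by
    convert hfin using 3 with g
    exact (measurePreserving_smul g μ).lintegral_comp_emb (measurableEmbedding_const_smul g)
      fun x => ‖t g x‖ₑ
  calc ∫ x, (e x).toReal • ∑' g : G, h (g • x) ∂μ = ∫ x, ∑' g : G, t g (g • x) ∂μ := by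
        simp only [t, inv_smul_smul, tsum_const_smul'']
    _ = ∑' g : G, ∫ x, t g (g • x) ∂μ := integral_tsum htg hfing
    _ = ∑' g : G, ∫ x, t g x ∂μ := tsum_congr fun g => integral_smul_eq_self (t g)
    _ = ∫ x, ∑' g : G, t g x ∂μ := (integral_tsum ht hfin).symm
    _ = ∫ x, h x ∂μ := by
        refine integral_congr_ae (.of_forall fun x => ?_)
        have hsum' : ∑' g : G, (e (g⁻¹ • x)).toReal = 1 := by
          rw [← ENNReal.tsum_toReal_eq (hetop · x), hsum, ENNReal.toReal_one]
        have hs : Summable fun g : G => (e (g⁻¹ • x)).toReal :=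
          ENNReal.summable_toReal (hsum x ▸ ENNReal.one_ne_top)
        simp only [t, hs.tsum_smul_const, hsum', one_smul]

end Unfolding

section SesquilinearSpan

theorem span_eq_top_of_forall_apply_eq_zero {K V W : Type*} [Field K] [AddCommGroup V] [Module K V]
    [AddCommGroup W] [Module K W] [FiniteDimensional K V] [FiniteDimensional K W] {σ : K →+* K}
    (hdim : Module.finrank K W ≤ Module.finrank K V) (B : V →ₗ[K] W →ₛₗ[σ] K) {s : Set W}
    (hB : ∀ x, (∀ y ∈ s, B x y = 0) → x = 0) : Submodule.span K s = ⊤ := by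
  by_contra hne
  let b := Module.finBasis K (Submodule.span K s)
  let T := LinearMap.pi fun a => B.flip (b a : W)
  obtain ⟨x, hx, hx0⟩ := Submodule.exists_mem_ne_zero_of_ne_bot
    (LinearMap.ker_ne_bot_of_finrank_lt (f := T)
      (by simpa using (Submodule.finrank_lt hne).trans_le hdim))
  have hspan : (B x).comp (Submodule.span K s).subtype = 0 :=
    b.ext fun a => congrFun (LinearMap.mem_ker.1 hx) a
  exact hx0 (hB x fun y hy => LinearMap.congr_fun hspan ⟨y, Submodule.subset_span hy⟩)

end SesquilinearSpan

section Pairing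

variable {n m : ℕ} {D : Set (Fin n → ℂ)}

theorem conj_weightConst (hD : IsBoundedHomogeneousDomain D) {k : ℕ} (hk : 1 ≤ k) :
    starRingEnd ℂ (weightConst D k) = weightConst D k := by
  obtain ⟨z⟩ := hD.isConnected.nonempty.to_subtype
  set I := ∫ w, (bergmanWeight D k w : ℂ) *
    (bergmanKernel D w z ^ k * bergmanKernel D z w ^ k) ∂(euclideanVolume D) with hI
  have hz : bergmanKernel D z z ^ k = weightConst D k * I :=
    bergmanKernel_self_pow_eq_integral hD hk z
  have hconjI : starRingEnd ℂ I = I := by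
    rw [hI, ← integral_conj]
    simp only [map_mul, map_pow, Complex.conj_ofReal, ← bergmanKernel_symm hD.isOpen, mul_comm]
  have hconj : starRingEnd ℂ (weightConst D k) * I = weightConst D k * I := by
    rw [← hz, ← hconjI, ← map_mul, ← hz, map_pow, ← bergmanKernel_symm hD.isOpen]
  have hne : bergmanKernel D z z ^ k ≠ 0 :=
    pow_ne_zero _ (bergmanKernel_self_ne_zero hD.isOpen hD.isBounded z)
  exact mul_right_cancel₀ (right_ne_zero_of_mul (hz ▸ hne)) hconj

/-- The invariant volume `dV(w) = K(w, w) dV_e(w)`. -/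
def invariantVolume (D : Set (Fin n → ℂ)) : Measure D :=
  weightedVolume D (bergmanWeight D 0)

theorem integral_invariantVolume {E : Type*} [NormedAddCommGroup E] [NormedSpace ℝ E]
    (hD : IsOpen D) (hb : Bornology.IsBounded D) (f : D → E) :
    ∫ w, f w ∂(invariantVolume D) = ∫ w, bergmanWeight D 0 w • f w ∂(euclideanVolume D) :=
  integral_weightedVolume (continuous_bergmanWeight hD hb 0).measurable
    (fun w => (bergmanWeight_pos hD hb 0 w).le) f

theorem integrable_invariantVolume_iff {E : Type*} [NormedAddCommGroup E] [NormedSpace ℝ E]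
    (hD : IsOpen D) (hb : Bornology.IsBounded D) {f : D → E} :
    Integrable f (invariantVolume D) ↔
      Integrable (fun w => bergmanWeight D 0 w • f w) (euclideanVolume D) := by
  rw [invariantVolume, weightedVolume, integrable_withDensity_iff_integrable_smul'
    (continuous_bergmanWeight hD hb 0).measurable.ennreal_ofReal
    (.of_forall fun _ => ENNReal.ofReal_lt_top)]
  simp only [ENNReal.toReal_ofReal (bergmanWeight_pos hD hb 0 _).le]

theorem measurePreserving_aut_invariantVolume (hD : IsOpen D) (hb : Bornology.IsBounded D)
    {g : D ≃ₜ D} (hg : g ∈ Aut D) :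
    MeasurePreserving g (invariantVolume D) (invariantVolume D) := by
  simpa [invariantVolume] using measurePreserving_aut_weightedVolume hD hb 0 hg

theorem smulInvariantMeasure_invariantVolume (hD : IsOpen D) (hb : Bornology.IsBounded D)
    {Γ : Subgroup (D ≃ₜ D)} (hΓ : Γ ≤ Aut D) : SMulInvariantMeasure Γ D (invariantVolume D) where
  measure_preimage_smul γ _ hs :=
    (measurePreserving_aut_invariantVolume hD hb (hΓ γ.2)).measure_preimage hs.nullMeasurableSet

theorem isLocallyFiniteMeasure_invariantVolume (hD : IsOpen D) (hb : Bornology.IsBounded D) :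
    IsLocallyFiniteMeasure (invariantVolume D) := by
  have := isFiniteMeasure_euclideanVolume hD hb
  exact IsLocallyFiniteMeasure.withDensity_ofReal (continuous_bergmanWeight hD hb 0)

/-- The Hermitian metric `K(w, w) ^ (-k) ⟨u, v⟩`, linear in `u`, on the fibre at `w` of the bundle
whose sections are the automorphic forms of weight `k`. -/
def fiberInner (D : Set (Fin n → ℂ)) (k : ℕ) (w : D) :
    (Fin m → ℂ) →ₗ[ℂ] (Fin m → ℂ) →ₗ⋆[ℂ] ℂ :=
  LinearMap.mk₂'ₛₗ (RingHom.id ℂ) (starRingEnd ℂ)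
    (fun u v => ((bergmanRoot D w ^ (2 * k))⁻¹ : ℝ) * (u ⬝ᵥ star v))
    (fun u u' v => by rw [add_dotProduct, mul_add])
    (fun c u v => by
      rw [smul_dotProduct, RingHom.id_apply, smul_eq_mul, smul_eq_mul, mul_left_comm])
    (fun u v v' => by rw [star_add, dotProduct_add, mul_add])
    fun c u v => by
      rw [star_smul, dotProduct_smul, smul_eq_mul, smul_eq_mul, mul_left_comm, starRingEnd_apply]

theorem fiberInner_apply (k : ℕ) (w : D) (u v : Fin m → ℂ) :
    fiberInner D k w u v = ((bergmanRoot D w ^ (2 * k))⁻¹ : ℝ) * (u ⬝ᵥ star v) :=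
  rfl

theorem continuous_fiberInner (hD : IsOpen D) (hb : Bornology.IsBounded D) (k : ℕ)
    {X : Type*} [TopologicalSpace X] {f : X → D} (hf : Continuous f)
    {u v : X → Fin m → ℂ} (hu : Continuous u) (hv : Continuous v) :
    Continuous fun x => fiberInner D k (f x) (u x) (v x) := by
  simp only [fiberInner_apply]
  exact (Complex.continuous_ofReal.comp ((((continuous_bergmanRoot hD).comp hf).pow _).inv₀
    fun x => (pow_pos (bergmanRoot_pos hD hb _) _).ne')).mul (hu.dotProduct hv.star)

theorem fiberInner_aut (hD : IsOpen D) {k : ℕ} {g : D ≃ₜ D} (hg : g ∈ Aut D) {w : D}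
    {U : Matrix (Fin m) (Fin m) ℂ} {u u' : Fin m → ℂ}
    (hu : jac g w ^ k • u' = U.mulVec u) (v : Fin m → ℂ) :
    fiberInner D k w u (jac g w ^ k • (star U).mulVec v) = fiberInner D k (g w) u' v := by
  have hU : u ⬝ᵥ star ((star U).mulVec v) = U.mulVec u ⬝ᵥ star v := by
    rw [Matrix.star_mulVec, Matrix.star_eq_conjTranspose, Matrix.conjTranspose_conjTranspose,
      dotProduct_comm, ← Matrix.dotProduct_mulVec, dotProduct_comm]
  have hjac : starRingEnd ℂ (jac g w ^ k) * jac g w ^ k = ((‖jac g w‖ ^ (2 * k) : ℝ) : ℂ) := by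
    rw [Complex.conj_mul', norm_pow, ← Complex.ofReal_pow, ← pow_mul, mul_comm k]
  have hne : ((‖jac g w‖ ^ (2 * k) : ℝ) : ℂ) ≠ 0 := by
    simpa using fun h => absurd h (jac_ne_zero hD hg w)
  rw [LinearMap.map_smulₛₗ, fiberInner_apply, hU, ← hu, smul_dotProduct, smul_eq_mul, smul_eq_mul,
    mul_left_comm, ← mul_assoc (starRingEnd ℂ _), hjac, fiberInner_apply, ← bergmanRoot_aut hD hg,
    mul_pow, mul_inv, Complex.ofReal_mul, Complex.ofReal_inv (‖jac g w‖ ^ (2 * k))]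
  field_simp

end Pairing

section Petersson

variable {n m k : ℕ} {D : Set (Fin n → ℂ)} {Γ : Subgroup (D ≃ₜ D)} {e : D → ENNReal}
  {ρ : Γ →* Matrix.unitaryGroup (Fin m) ℂ} {F : D → Fin m → ℂ}

/-- A compactly supported weight whose translates under `Γ` sum to one. Integrating a
`Γ`-invariant function against it amounts to integrating over `Γ \ D`. -/
structure IsUnfoldingWeight (Γ : Subgroup (D ≃ₜ D)) (e : D → ENNReal) : Prop where
  measurable : Measurable e
  exists_isCompact : ∃ Q, IsCompact Q ∧ ∀ w ∉ Q, e w = 0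
  tsum_eq_one : ∀ w, ∑' γ : Γ, e (γ⁻¹ • w) = 1

theorem exists_isUnfoldingWeight (hD : IsBoundedHomogeneousDomain D) (hΓ : IsDiscreteInAut Γ)
    [CompactSpace (MulAction.orbitRel.Quotient Γ D)] : ∃ e, IsUnfoldingWeight Γ e := by
  have := hD.isOpen.locallyCompactSpace
  have := countable_of_isDiscreteInAut hD hΓ
  obtain ⟨Q, hQ, hQΓ⟩ := exists_isCompact_forall_exists_smul_mem Γ D
  obtain ⟨e, he, he0, hsum⟩ := exists_measurable_tsum_inv_smul_eq_one hQ.measurableSet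
    (fun z => finite_setOf_apply_mem hD hΓ z hQ) hQΓ
  exact ⟨e, he, ⟨Q, hQ, he0⟩, hsum⟩

theorem IsUnfoldingWeight.integrable_toReal_mul (he : IsUnfoldingWeight Γ e) {μ : Measure D}
    [IsLocallyFiniteMeasure μ] {h : D → ℂ} (hh : Continuous h) :
    Integrable (fun w => ((e w).toReal : ℂ) * h w) μ := by
  obtain ⟨Q, hQ, he0⟩ := he.exists_isCompact
  have hbound (w : D) : ‖((e w).toReal : ℂ)‖ ≤ 1 := by
    rw [Complex.norm_real, Real.norm_of_nonneg ENNReal.toReal_nonneg]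
    exact ENNReal.toReal_le_of_le_ofReal zero_le_one
      (by simpa using le_one_of_tsum_inv_smul_eq_one he.tsum_eq_one w)
  have hQint : IntegrableOn (fun w => ((e w).toReal : ℂ) * h w) Q μ :=
    (hh.continuousOn.integrableOn_compact hQ).bdd_mul
      (Complex.measurable_ofReal.comp he.measurable.ennreal_toReal).aestronglyMeasurable
      (.of_forall hbound)
  exact (integrableOn_iff_integrable_of_support_subset fun w hw =>
    not_not.1 fun hwQ => hw (by simp [he0 w hwQ])).1 hQint

/-- The Petersson pairing of automorphic forms of weight `k`: the integral of their fibrewise inner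
product over `Γ \ D`, computed by means of an unfolding weight `e`. -/
def petersson (e : D → ENNReal) (k : ℕ) (F G : D → Fin m → ℂ) : ℂ :=
  ∫ w, ((e w).toReal : ℂ) * fiberInner D k w (F w) (G w) ∂(invariantVolume D)

theorem exists_sesquilinear_eq_petersson (hD : IsOpen D) (hb : Bornology.IsBounded D)
    (he : IsUnfoldingWeight Γ e) (ρ : Γ →* Matrix.unitaryGroup (Fin m) ℂ) (k : ℕ) :
    ∃ B : automorphicForms Γ ρ k →ₗ[ℂ] automorphicForms Γ ρ k →ₗ⋆[ℂ] ℂ,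
      ∀ F G, B F G = petersson e k F.1 G.1 := by
  have := isLocallyFiniteMeasure_invariantVolume hD hb
  have hint (F G : automorphicForms Γ ρ k) : Integrable (fun w => ((e w).toReal : ℂ) *
      fiberInner D k w (F.1 w) (G.1 w)) (invariantVolume D) := he.integrable_toReal_mul
    (continuous_fiberInner hD hb k continuous_id F.2.1.continuous G.2.1.continuous)
  refine ⟨LinearMap.mk₂'ₛₗ (RingHom.id ℂ) (starRingEnd ℂ) (fun F G => petersson e k F.1 G.1)
    (fun F F' G => ?_) (fun c F G => ?_) (fun F G G' => ?_) (fun c F G => ?_), fun _ _ => rfl⟩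
  · rw [petersson, petersson, petersson, ← integral_add (hint F G) (hint F' G)]
    exact integral_congr_ae (.of_forall fun w => by simp [mul_add])
  · rw [petersson, petersson, smul_eq_mul, ← integral_const_mul]
    exact integral_congr_ae (.of_forall fun w => by simp [mul_left_comm])
  · rw [petersson, petersson, petersson, ← integral_add (hint F G) (hint F G')]
    exact integral_congr_ae (.of_forall fun w => by simp [mul_add])
  · rw [petersson, petersson, smul_eq_mul, ← integral_const_mul]
    exact integral_congr_ae (.of_forall fun w => by simp [mul_left_comm])

theorem fiberInner_poincareTerm (hD : IsOpen D) (hΓ : Γ ≤ Aut D)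
    (hF : F ∈ automorphicForms Γ ρ k) (j : Fin m) (p w : D) (γ : Γ) :
    fiberInner D k w (F w) (poincareTerm Γ ρ k j p w γ) =
      fiberInner D k (γ • w) (F (γ • w)) (Pi.single j (bergmanKernel D (γ • w) p ^ k)) := by
  rw [poincareTerm, map_inv]
  exact fiberInner_aut hD (hΓ γ.2) (hF.2 γ w) _

theorem fiberInner_poincareSeries (hD : IsBoundedHomogeneousDomain D) (hΓ : IsDiscreteInAut Γ)
    (hk : 2 ≤ k) (hF : F ∈ automorphicForms Γ ρ k) (j : Fin m) (p w : D) :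
    fiberInner D k w (F w) (poincareSeries Γ ρ k j p w) = weightConst D k *
      ∑' γ : Γ, fiberInner D k (γ • w) (F (γ • w))
        (Pi.single j (bergmanKernel D (γ • w) p ^ k)) := by
  have hcont : Continuous (fiberInner D k w (F w)) := continuous_fiberInner hD.isOpen hD.isBounded k
    continuous_const continuous_const continuous_id
  rw [poincareSeries, LinearMap.map_smulₛₗ, conj_weightConst hD (by omega), smul_eq_mul,
    (summable_poincareTerm hD hΓ ρ hk j p w).map_tsum _ hcont]
  simp only [fiberInner_poincareTerm hD.isOpen hΓ.le_aut hF]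

theorem bergmanWeight_zero_smul_fiberInner_single (hD : IsOpen D) (u : Fin m → ℂ) (j : Fin m)
    (p w : D) :
    bergmanWeight D 0 w • fiberInner D k w u (Pi.single j (bergmanKernel D w p ^ k)) =
      (bergmanWeight D k w : ℂ) * (u j * bergmanKernel D p w ^ k) := by
  rw [fiberInner_apply, ← Pi.single_star, dotProduct_single, star_pow, bergmanKernel_symm hD p w,
    Complex.real_smul, bergmanWeight, bergmanWeight]
  push_cast
  simp only [starRingEnd_apply]
  ring

theorem petersson_poincareSeries (hD : IsBoundedHomogeneousDomain D) (hΓ : IsDiscreteInAut Γ)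
    [CompactSpace (MulAction.orbitRel.Quotient Γ D)] (he : IsUnfoldingWeight Γ e) (hk : 2 ≤ k)
    (hF : F ∈ automorphicForms Γ ρ k) (j : Fin m) (p : D) :
    petersson e k F (poincareSeries Γ ρ k j p) = F p j := by
  have hO := hD.isOpen
  have := countable_of_isDiscreteInAut hD hΓ
  have := smulInvariantMeasure_invariantVolume hO hD.isBounded hΓ.le_aut
  obtain ⟨C, hC⟩ := exists_norm_apply_le_mul_bergmanRoot_pow hO hD.isBounded hΓ.le_aut hF
  let h : D → ℂ := fun w => fiberInner D k w (F w) (Pi.single j (bergmanKernel D w p ^ k))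
  have hh : Integrable h (invariantVolume D) := by
    rw [integrable_invariantVolume_iff hO hD.isBounded]
    simpa only [h, bergmanWeight_zero_smul_fiberInner_single hO] using
      integrable_mul_bergmanKernel_pow hO hD.isBounded hk (hF.1.apply j).continuous (hC · j) p
  calc petersson e k F (poincareSeries Γ ρ k j p)
      = weightConst D k *
          ∫ w, (e w).toReal • ∑' γ : Γ, h (γ • w) ∂(invariantVolume D) := by
        rw [petersson, ← integral_const_mul]
        simp only [fiberInner_poincareSeries hD hΓ hk hF, Complex.real_smul, mul_left_comm, h]
    _ = weightConst D k * ∫ w, h w ∂(invariantVolume D) := by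
        rw [integral_toReal_smul_tsum_smul he.measurable he.tsum_eq_one hh]
    _ = weightConst D k * ∫ w, (bergmanWeight D k w : ℂ) * (F w j * bergmanKernel D p w ^ k)
          ∂(euclideanVolume D) := by
        rw [integral_invariantVolume hO hD.isBounded]
        simp only [h, bergmanWeight_zero_smul_fiberInner_single hO]
    _ = F p j := (eq_weightConst_mul_integral hD hk (hF.1.apply j) (hC · j) p).symm

theorem apply_eq_zero_of_inGeneralPosition {d : ℕ} {p : Fin d → D}
    (hp : InGeneralPosition Γ ρ k p) {F : automorphicForms Γ ρ k} (hF : ∀ l, F.1 (p l) = 0) :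
    F = 0 := by
  obtain ⟨φ, -, hφ⟩ := hp
  by_contra hF0
  refine hφ ⟨LinearMap.ker (Module.Dual.eval ℂ _ F), ?_, fun l => ?_⟩
  · exact LinearMap.isCoatom_ker_of_surjective
      (LinearMap.surjective fun h => hF0 ((Module.eval_apply_eq_zero_iff ℂ F).1 h))
  · change φ l (F.1 (p l)) = 0
    rw [hF, map_zero]

theorem span_poincareSeries (hD : IsBoundedHomogeneousDomain D) (hΓ : IsDiscreteInAut Γ)
    [CompactSpace (MulAction.orbitRel.Quotient Γ D)] (ρ : Γ →* Matrix.unitaryGroup (Fin m) ℂ)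
    (hk : 2 ≤ k) {d : ℕ} {p : Fin d → D} (hp : InGeneralPosition Γ ρ k p) :
    Submodule.span ℂ (Set.range fun q : Fin d × Fin m => poincareSeries Γ ρ k q.2 (p q.1)) =
      automorphicForms Γ ρ k := by
  have := finiteDimensional_automorphicForms hD.isOpen hD.isBounded hΓ.le_aut ρ k
  obtain ⟨e, he⟩ := exists_isUnfoldingWeight hD hΓ
  obtain ⟨B, hB⟩ := exists_sesquilinear_eq_petersson hD.isOpen hD.isBounded he ρ k
  let Θ : Fin d × Fin m → automorphicForms Γ ρ k := fun q =>
    ⟨poincareSeries Γ ρ k q.2 (p q.1), poincareSeries_mem hD hΓ ρ hk q.2 (p q.1)⟩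
  have hspan : Submodule.span ℂ (Set.range Θ) = ⊤ :=
    span_eq_top_of_forall_apply_eq_zero le_rfl B fun F hF =>
      apply_eq_zero_of_inGeneralPosition hp fun l => funext fun j => by
        rw [← petersson_poincareSeries hD hΓ he hk F.2 j (p l)]
        exact (hB F (Θ (l, j))).symm.trans (hF _ ⟨(l, j), rfl⟩)
  have hmap := congrArg (Submodule.map (automorphicForms Γ ρ k).subtype) hspan
  rwa [Submodule.map_span, Submodule.map_subtype_top, ← Set.range_comp] at hmap

end Petersson

section Generic

theorem exists_linearIndependent_comp {K V ι : Type*} [Field K] [AddCommGroup V] [Module K V]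
    [FiniteDimensional K V] {N : ℕ} (hN : Module.finrank K V = N) {f : ι → V}
    (hf : Submodule.span K (Set.range f) = ⊤) :
    ∃ q : Fin N → ι, LinearIndependent K (f ∘ q) := by
  obtain ⟨g, hg, -, hli⟩ := Submodule.exists_fun_fin_finrank_span_eq K (Set.range f)
  have hcard : N = Module.finrank K (Submodule.span K (Set.range f)) := by
    rw [hf, finrank_top, hN]
  choose q hq using hg
  obtain rfl : f ∘ q = g := funext hq
  exact ⟨q ∘ Fin.cast hcard, hli.comp _ (Fin.cast_injective hcard)⟩

variable {n m k : ℕ} {D : Set (Fin n → ℂ)} {Γ : Subgroup (D ≃ₜ D)}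
  {ρ : Γ →* Matrix.unitaryGroup (Fin m) ℂ}

theorem span_evalFunctional_eq_top [FiniteDimensional ℂ (automorphicForms Γ ρ k)] :
    Submodule.span ℂ (Set.range fun q : D × Fin m =>
      evalFunctional Γ ρ k q.1 (LinearMap.proj q.2)) = ⊤ := by
  have hdim : Module.finrank ℂ (Module.Dual ℂ (automorphicForms Γ ρ k)) ≤
      Module.finrank ℂ (automorphicForms Γ ρ k) := Subspace.dual_finrank_eq.le
  refine span_eq_top_of_forall_apply_eq_zero hdim
    (Module.Dual.eval ℂ (automorphicForms Γ ρ k)) fun F hF => ?_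
  ext z i
  exact hF (evalFunctional Γ ρ k z (LinearMap.proj i)) ⟨(z, i), rfl⟩

theorem inGeneralPosition_of_span_eq_top {d : ℕ} {p : Fin d → D}
    {φ : Fin d → Module.Dual ℂ (Fin m → ℂ)} (hφ : ∀ l, φ l ≠ 0)
    (hspan : Submodule.span ℂ (Set.range fun l => evalFunctional Γ ρ k (p l) (φ l)) = ⊤) :
    InGeneralPosition Γ ρ k p :=
  ⟨φ, hφ, fun ⟨_, hS, hmem⟩ => hS.1 (top_le_iff.1
    (hspan ▸ Submodule.span_le.2 (Set.range_subset_iff.2 hmem)))⟩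

variable {κ : Type*} [Fintype κ] [DecidableEq κ]

/-- The matrix of the `ι l`-th components of the basis forms at the points `p l`, for `p l` ranging
over all of `ℂⁿ`; rows outside `D` are zero. -/
def evalMatrix (b : Module.Basis κ ℂ (automorphicForms Γ ρ k)) (ι : κ → Fin m)
    (p : κ → Fin n → ℂ) : Matrix κ κ ℂ :=
  fun i l => Function.extend Subtype.val (b i).1 0 (p l) (ι l)

theorem det_evalMatrix (b : Module.Basis κ ℂ (automorphicForms Γ ρ k)) (ι : κ → Fin m)
    (p : κ → D) : (evalMatrix b ι fun l => p l).det =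
      b.dualBasis.det fun l => evalFunctional Γ ρ k (p l) (LinearMap.proj (ι l)) := by
  rw [Module.Basis.det_apply]
  congr 1
  ext i l
  rw [Module.Basis.toMatrix_apply, Module.Basis.dualBasis_repr, evalMatrix, extend_val _ (p l).2]
  rfl

theorem differentiableOn_det_evalMatrix (b : Module.Basis κ ℂ (automorphicForms Γ ρ k))
    (ι : κ → Fin m) :
    DifferentiableOn ℂ (fun p => (evalMatrix b ι p).det) {p | ∀ l, p l ∈ D} := by
  refine differentiableOn_det fun i l => ?_
  have hcomp := DifferentiableOn.comp (t := D) (s := {p : κ → Fin n → ℂ | ∀ l, p l ∈ D}) (b i).2.1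
    (differentiable_apply (𝕜 := ℂ) l).differentiableOn fun p hp => hp l
  exact differentiableOn_pi.1 hcomp (ι l)

theorem holdsGenerically_inGeneralPosition (hD : D.Nonempty) (hm : 0 < m)
    [FiniteDimensional ℂ (automorphicForms Γ ρ k)] {d : ℕ}
    (hd : Module.finrank ℂ (automorphicForms Γ ρ k) ≤ d) :
    HoldsGenerically fun p : Fin d → D => InGeneralPosition Γ ρ k p := by
  let b := Module.finBasis ℂ (automorphicForms Γ ρ k)
  obtain ⟨q, hq⟩ := exists_linearIndependent_comp Subspace.dual_finrank_eq
    (span_evalFunctional_eq_top (Γ := Γ) (ρ := ρ) (k := k))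
  obtain ⟨z₀, hz₀⟩ := hD
  let q' : Fin d → D × Fin m := Function.extend (Fin.castLE hd) q fun _ => (⟨z₀, hz₀⟩, ⟨0, hm⟩)
  let ι (l : Fin d) : Fin m := (q' l).2
  have hq' (l) : q' (Fin.castLE hd l) = q l := (Fin.castLE_injective hd).extend_apply q _ l
  refine ⟨fun p => (evalMatrix b (ι ∘ Fin.castLE hd) (p ∘ Fin.castLE hd)).det, ?_,
    ⟨fun l => (q' l).1, ?_⟩, fun p hp => ?_⟩
  · exact (differentiableOn_det_evalMatrix b _).comp
      (differentiable_pi.2 fun l => differentiable_apply _).differentiableOn fun p hp l => hp _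
  · have hdet := det_evalMatrix b (ι ∘ Fin.castLE hd) fun l => (q' (Fin.castLE hd l)).1
    refine hdet.trans_ne ?_
    have hli : LinearIndependent ℂ fun l => evalFunctional Γ ρ k (q' (Fin.castLE hd l)).1
        (LinearMap.proj (ι (Fin.castLE hd l))) := by
      simp only [ι, hq']
      exact hq
    exact ((Module.Basis.is_basis_iff_det b.dualBasis).1 ⟨hli, hli.span_eq_top_of_card_eq_finrank'
      (by rw [Fintype.card_fin, Subspace.dual_finrank_eq])⟩).ne_zero
  · have hdet := det_evalMatrix b (ι ∘ Fin.castLE hd) (p ∘ Fin.castLE hd)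
    have hspan := ((Module.Basis.is_basis_iff_det b.dualBasis).2
      (isUnit_iff_ne_zero.2 (hdet.symm.trans_ne hp))).2
    refine inGeneralPosition_of_span_eq_top (φ := fun l => LinearMap.proj (ι l))
      (fun l h => ?_) (top_le_iff.1 (hspan.ge.trans (Submodule.span_mono ?_)))
    · simpa using LinearMap.congr_fun h (Pi.single (ι l) 1)
    · exact Set.range_comp_subset_range (Fin.castLE hd) fun l =>
        evalFunctional Γ ρ k (p l) (LinearMap.proj (ι l))

end Generic

end BoundedSymmetric

end

open BoundedSymmetric in
theorem theorem3p3_general {n : ℕ} {D : Set (Fin n → ℂ)} (hD : IsBoundedHomogeneousDomain D)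
    {Γ : Subgroup (D ≃ₜ D)} (hΓ : IsDiscreteInAut Γ)
    [CompactSpace (MulAction.orbitRel.Quotient Γ D)] {m : ℕ} (hm : 0 < m)
    (ρ : Γ →* Matrix.unitaryGroup (Fin m) ℂ) {k : ℕ} (hk : 2 ≤ k) :
    (∀ (j : Fin m) (p z : D), Summable fun γ : Γ => ‖poincareTerm Γ ρ k j p z γ‖) ∧
    FiniteDimensional ℂ (automorphicForms Γ ρ k) ∧
    (∀ d ≥ Module.finrank ℂ (automorphicForms Γ ρ k),
      HoldsGenerically fun p : Fin d → D => InGeneralPosition Γ ρ k p) ∧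
    ∀ (d : ℕ) (p : Fin d → D), InGeneralPosition Γ ρ k p →
      Submodule.span ℂ
          (Set.range fun q : Fin d × Fin m => poincareSeries Γ ρ k q.2 (p q.1)) =
        automorphicForms Γ ρ k := by
  have := finiteDimensional_automorphicForms hD.isOpen hD.isBounded hΓ.le_aut ρ k
  exact ⟨fun j p z => summable_norm_poincareTerm hD hΓ ρ hk j p z, this,
    fun d hd => holdsGenerically_inGeneralPosition hD.isConnected.nonempty hm hd,
    fun d p hp => span_poincareSeries hD hΓ ρ hk hp⟩

open BoundedSymmetric in
theorem theorem3p3 {n : ℕ} (hn : 0 < n) {D : Set (Fin n → ℂ)} (hD : IsBoundedSymmetricDomain D)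
    (Γ : Subgroup (D ≃ₜ D)) (hΓ : IsCocompactSmooth Γ) {m : ℕ} (hm : 0 < m)
    (ρ : Γ →* Matrix.unitaryGroup (Fin m) ℂ) :
    ∃ k₀ : ℕ, ∀ k ≥ k₀,
      (∀ (j : Fin m) (p z : D), Summable fun γ : Γ => ‖poincareTerm Γ ρ k j p z γ‖) ∧
      FiniteDimensional ℂ (automorphicForms Γ ρ k) ∧
      (∀ d ≥ Module.finrank ℂ (automorphicForms Γ ρ k),
        HoldsGenerically fun p : Fin d → D => InGeneralPosition Γ ρ k p) ∧
      ∀ (d : ℕ) (p : Fin d → D), InGeneralPosition Γ ρ k p →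
        Submodule.span ℂ
            (Set.range fun q : Fin d × Fin m => poincareSeries Γ ρ k q.2 (p q.1)) =
          automorphicForms Γ ρ k := by
  have := hΓ.compact
  exact ⟨2, fun k hk => theorem3p3_general hD.isBoundedHomogeneousDomain hΓ.isDiscreteInAut hm ρ hk⟩
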